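/- Let $a\ge b\ge 1$ be fixed integers. An $(a:b)$-coloring of a graph $G$ assigns to each vertex a $b$-element subset of $\{1,\dots,a\}$ so that adjacent vertices get disjoint subsets. A $(k,l)$-tree in $G$ is a subgraph of $G$ that is a tree with exactly $k$ vertices, exactly $l$ of which are leaves (vertices of degree $1$ in the tree). We put $\binom{m}{t}=0$ if $m<t$ (in particular if $m<0$). For every $t\in\{1,\dots,b\}$ there is a Monte-Carlo algorithm (a probabilistic random access machine with logarithmic cost) which, given an undirected finite graph $G$, an $(a:b)$-coloring of $G$ and integers $k,l\ge 0$, decides whether $G$ contains a $(k,l)$-tree, and which has the following properties: - for all outcomes of its random bits it halts within time \[O^*\Bigl(2^{\bigl(1-\frac{\binom{a-b}{t}-\binom{a-2b}{t}}{\binom{a}{t}}\bigr)k+\bigl(1-\frac{\binom{a-b}{t}}{\binom{a}{t}}\bigr)l}\Bigr)\] and uses space polynomial in the input size, where $O^*$ hides a factor polynomial in the input size (the polynomials may depend on $a,b,t$); - if $G$ contains no $(k,l)$-tree, it always answers NO; - if $G$ contains a $(k,l)$-tree, it answers NO with probability at most $\frac12$. In particular (from $t=1$), there is such an algorithm with running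 time $O^*\bigl(2^{(1-\frac ba)k+\frac ba l}\bigr)$. -/

import Mathlib

open MeasureTheory

/-! ### A probabilistic random access machine with logarithmic cost -/

namespace RAM

/-- The contents of the memory together with the number of coins tossed so far.  The memory
consists of countably many arrays of natural numbers, `mem (x, i)` being the cell with index `i`
of array number `x`; all but finitely many cells hold `0`. -/
structure State where
  mem : ℕ × ℕ →₀ ℕ
  coins : ℕ

/-- The space occupied by a state: the number of bits needed to write down the addresses and the
contents of all cells in use. -/
def State.space (s : State) : ℕ :=
  ∑ p ∈ s.mem.support, (Nat.size p.1 + Nat.size p.2 + Nat.size (s.mem p))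

/-- Write the value `v` into the cell with index `i` of array `x`. -/
noncomputable def State.write (s : State) (x i v : ℕ) : State :=
  { s with mem := s.mem.update (x, i) v }

/-- Toss a coin: read the next random bit of `ω` into the cell with index `i` of array `x`. -/
noncomputable def State.toss (s : State) (ω : ℕ → Bool) (x i : ℕ) : State :=
  { mem := s.mem.update (x, i) (ω s.coins).toNat, coins := s.coins + 1 }

/-- The arithmetic instructions on natural numbers. -/
inductive Op
  | add | sub | mul | div | mod | xor | eq | lt

/-- Subtraction is truncated, `xor` is bitwise, and the comparisons return `1` or `0`. -/
def Op.eval : Op → ℕ → ℕ → ℕ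
  | .add, x, y => x + y
  | .sub, x, y => x - y
  | .mul, x, y => x * y
  | .div, x, y => x / y
  | .mod, x, y => x % y
  | .xor, x, y => x ^^^ y
  | .eq, x, y => if x = y then 1 else 0
  | .lt, x, y => if x < y then 1 else 0

/-- Expressions: constants, the contents of a cell with a computed index in a given array, and
arithmetic instructions. -/
inductive Expr
  | const (c : ℕ)
  | read (x : ℕ) (i : Expr)
  | op (o : Op) (e₁ e₂ : Expr)

/-- The value of an expression. -/
def Expr.eval (s : State) : Expr → ℕ
  | .const c => c
  | .read x i => s.mem (x, i.eval s)
  | .op o e₁ e₂ => o.eval (e₁.eval s) (e₂.eval s)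

/-- The time for evaluating an expression.  Access to a cell is charged the bit lengths of its
index and of its contents, and an arithmetic instruction is charged (up to the additions of `1`)
the product of the bit lengths of its operands, as for the schoolbook methods. -/
def Expr.cost (s : State) : Expr → ℕ
  | .const c => 1 + Nat.size c
  | .read x i => i.cost s + 1 + Nat.size (i.eval s) + Nat.size (s.mem (x, i.eval s))
  | .op _ e₁ e₂ =>
      e₁.cost s + e₂.cost s + (Nat.size (e₁.eval s) + 1) * (Nat.size (e₂.eval s) + 1)

/-- Programs.  A condition counts as true if its value is nonzero. -/
inductive Program
  | skip
  | store (x : ℕ) (i e : Expr)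
  | toss (x : ℕ) (i : Expr)
  | seq (P Q : Program)
  | cond (e : Expr) (P Q : Program)
  | loop (e : Expr) (P : Program)

/-- `Run ω P s s' t m`: with the sequence of random bits `ω`, the program `P` started in state `s`
halts in state `s'` after time `t`, and the maximum of the space occupied by the states in between
is `m`. (The finitely many intermediate values of the expressions in a fixed program are at most a
constant factor longer than the contents of the memory, so they are not counted separately.) -/
inductive Run (ω : ℕ → Bool) : Program → State → State → ℕ → ℕ → Prop
  | skip (s : State) : Run ω .skip s s 1 s.space
  | store (x : ℕ) (i e : Expr) (s : State) :
      Run ω (.store x i e) s (s.write x (i.eval s) (e.eval s))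
        (i.cost s + e.cost s + 1 + Nat.size (i.eval s) + Nat.size (e.eval s))
        (max s.space (s.write x (i.eval s) (e.eval s)).space)
  | toss (x : ℕ) (i : Expr) (s : State) :
      Run ω (.toss x i) s (s.toss ω x (i.eval s)) (i.cost s + 2 + Nat.size (i.eval s))
        (max s.space (s.toss ω x (i.eval s)).space)
  | seq {P Q : Program} {s s₁ s₂ : State} {t₁ t₂ m₁ m₂ : ℕ} :
      Run ω P s s₁ t₁ m₁ → Run ω Q s₁ s₂ t₂ m₂ →
      Run ω (.seq P Q) s s₂ (t₁ + t₂) (max m₁ m₂)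
  | cond_true {e : Expr} {P Q : Program} {s s₁ : State} {t m : ℕ} :
      e.eval s ≠ 0 → Run ω P s s₁ t m → Run ω (.cond e P Q) s s₁ (e.cost s + 1 + t) m
  | cond_false {e : Expr} {P Q : Program} {s s₁ : State} {t m : ℕ} :
      e.eval s = 0 → Run ω Q s s₁ t m → Run ω (.cond e P Q) s s₁ (e.cost s + 1 + t) m
  | loop_true {e : Expr} {P : Program} {s s₁ s₂ : State} {t₁ t₂ m₁ m₂ : ℕ} :
      e.eval s ≠ 0 → Run ω P s s₁ t₁ m₁ → Run ω (.loop e P) s₁ s₂ t₂ m₂ →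
      Run ω (.loop e P) s s₂ (e.cost s + 1 + t₁ + t₂) (max m₁ m₂)
  | loop_false {e : Expr} {P : Program} {s : State} :
      e.eval s = 0 → Run ω (.loop e P) s s (e.cost s + 1) s.space

/-- The initial state: array `0` holds the input, everything else is `0`. -/
noncomputable def start (input : List ℕ) : State where
  mem := ∑ i ∈ Finset.range input.length, Finsupp.single (0, i) (input.getD i 0)
  coins := 0

/-- The length of an input in bits, with one separator after each number. -/
def inputSize (input : List ℕ) : ℕ := (input.map fun x => Nat.size x + 1).sum

/-- `P` halts and answers YES, that is, leaves a nonzero number in cell `0` of array `0`. -/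
def Accepts (P : Program) (input : List ℕ) (ω : ℕ → Bool) : Prop :=
  ∃ s' t m, Run ω P (start input) s' t m ∧ s'.mem (0, 0) ≠ 0

/-- The distribution of an infinite sequence of independent fair coin tosses. -/
noncomputable def coinMeasure : Measure (ℕ → Bool) :=
  Measure.infinitePi fun _ => (PMF.uniformOfFintype Bool).toMeasure

end RAM

/-! ### The problem -/

/-- `c` is an `(a:b)`-coloring of `G`: every vertex gets a set of `b` out of `a` colors, and adjacent
vertices get disjoint sets. -/
def IsFractionalColoring {V : Type*} (G : SimpleGraph V) (a b : ℕ) (c : V → Finset (Fin a)) :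
    Prop :=
  (∀ v, (c v).card = b) ∧ ∀ u v, G.Adj u v → Disjoint (c u) (c v)

/-- `G` contains a tree with exactly `k` vertices, exactly `l` of which are leaves, that is,
vertices of degree `1` in the tree. -/
def HasKLTree {V : Type*} (G : SimpleGraph V) (k l : ℕ) : Prop :=
  ∃ T : G.Subgraph, T.coe.IsTree ∧ T.verts.ncard = k ∧
    {v ∈ T.verts | (T.neighborSet v).ncard = 1}.ncard = l

open Classical in
/-- The input: the numbers `n`, `k`, `l`, the rows of the adjacency matrix of the graph, and for each
vertex the indicator vector of its set of colors. -/
noncomputable def encodeInstance {n a : ℕ} (G : SimpleGraph (Fin n)) (c : Fin n → Finset (Fin a))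
    (k l : ℕ) : List ℕ :=
  [n, k, l]
    ++ (List.ofFn fun u : Fin n => List.ofFn fun v : Fin n => if G.Adj u v then 1 else 0).flatten
    ++ (List.ofFn fun u : Fin n => List.ofFn fun i : Fin a => if i ∈ c u then 1 else 0).flatten

/-- There is a Monte-Carlo algorithm that, given a graph with an `(a:b)`-coloring and numbers `k` and
`l`, decides whether the graph contains a tree with `k` vertices and `l` leaves.  For all random
bits it halts within time `2 ^ e k l` times a polynomial in the input size and within polynomial
space; it never answers YES wrongly, and answers NO wrongly with probability at most one half. -/
def KLTreeSolvableInTime (a b : ℕ) (e : ℕ → ℕ → ℝ) : Prop :=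
  ∃ (P : RAM.Program) (p q : Polynomial ℕ),
    ∀ (n : ℕ) (G : SimpleGraph (Fin n)) (c : Fin n → Finset (Fin a)),
      IsFractionalColoring G a b c → ∀ k l : ℕ,
        (∀ ω : ℕ → Bool, ∃ s' t m, RAM.Run ω P (RAM.start (encodeInstance G c k l)) s' t m ∧
          (t : ℝ) ≤ ((p.eval (RAM.inputSize (encodeInstance G c k l)) : ℕ) : ℝ) * (2 : ℝ) ^ e k l ∧
          m ≤ q.eval (RAM.inputSize (encodeInstance G c k l))) ∧
        (HasKLTree G k l →
          1 / 2 ≤ RAM.coinMeasure {ω | RAM.Accepts P (encodeInstance G c k l) ω}) ∧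
        (¬ HasKLTree G k l → ∀ ω, ¬ RAM.Accepts P (encodeInstance G c k l) ω)

/-! The algorithm is an algebraic sieve over trees of walks. A tree of walks is a tree with a
locally injective map to `G`, rooted at a leaf over `ρ` whose neighbor lies over `σ`. It is stored
as the set of images of its paths to the root. Local injectivity only forbids a step straight back,
so the generating function of these trees, with markers for nodes, leaves and items, obeys a
recursion over pairs of adjacent vertices (`sum_walkFamily_succ`, `sum_walkFamily_eq_table`).
Genuine subtrees are the trees of walks whose map is injective; the others have to cancel.

Fix a class `P` of vertices. The items of a tree are its nodes over `P`, its leaves, and its edges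
with no end in `P`. Giving an item a vector of variables and summing a product of linear forms over
all `0`-`1` vectors of length `r` kills, in characteristic 2, every tree with `r` items two of which
coincide: the square of a form is again a form, and fewer than `r` forms sum to zero
(`sum_prod_bitForm_of_not_nodup`). This costs the factor `2 ^ r`.

Distinct items make the map injective on edges (`injOn_lastEdge_of_nodup`), so the tree is a set of
darts of `G` together with a partition of the darts into nodes. If a vertex `v` has several nodes
over it, two darts into `v` at different nodes are joined in the tree without a further copy of `v`.
Exchanging their nodes gives a tree again, with the same edges, items and number of leaves. The
exchange can be chosen so that it is an involution, and it has no fixed point because two leaves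
over one vertex would be a repeated item (`exists_partner`). Hence in characteristic 2 the sum
vanishes when there is no `(k,l)`-tree (`sum_walkTrees_eq_zero`). If there is one, suitable values
of the variables isolate it and the sum becomes `1` (`exists_treeTotal_eq_one`). By Schwartz-Zippel,
random values then give a nonzero sum with probability at least one half, and a zero sum is certain
otherwise, so the error is one-sided.

The exponent comes from the choice of `P`. Take a random `t`-set of colors and let `P` be the
vertices having none of them. A vertex is in `P` with probability `C(a-b,t)/C(a,t)`. Adjacent
vertices have disjoint color sets, so inclusion-exclusion gives the probability that an edge avoids
`P`. The expected number of items of a `(k,l)`-tree is at most the exponent, so some color set does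
as well (`exists_colors`); all `2 ^ a` sets are tried.

On the machine everything is done with natural numbers. Random values are polynomials with `0`-`1`
coefficients, evaluated at a large power of two. The counting markers are powers of a still larger
power of two. No digit that is read receives a carry, so the required coefficients are read off as
digits and reduced modulo 2. All numbers have polynomially many bits, and only the sum over the
sieve takes exponential time. -/

/-! ### Walks in trees -/

section TreeWalk

variable {N V : Type*} {T : SimpleGraph N} (ht : T.IsTree) (r : N) (h : N → V)

/-- The images under `h` of the vertices on the path from `x` to the root `r`. -/
noncomputable def rootWalk (x : N) : List V :=
  ((ht.existsUnique_path x r).choose).support.map h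

theorem rootWalk_eq {x : N} (p : T.Walk x r) (hp : p.IsPath) :
    rootWalk ht r h x = p.support.map h := by
  have := (ht.existsUnique_path x r).choose_spec.2 p hp
  rw [rootWalk, ← this]

theorem rootWalk_root : rootWalk ht r h r = [h r] := by
  rw [rootWalk_eq ht r h SimpleGraph.Walk.nil SimpleGraph.Walk.IsPath.nil]; rfl

theorem rootWalk_head (x : N) : ∃ t, rootWalk ht r h x = h x :: t := by
  obtain ⟨p, hp, -⟩ := ht.existsUnique_path x r
  rw [rootWalk_eq ht r h p hp]
  cases p <;> simp

theorem rootWalk_parent {x : N} (hx : x ≠ r) :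
    ∃ y, T.Adj x y ∧ rootWalk ht r h x = h x :: rootWalk ht r h y := by
  obtain ⟨p, hp, -⟩ := ht.existsUnique_path x r
  rw [rootWalk_eq ht r h p hp]
  cases p with
  | nil => exact absurd rfl hx
  | @cons _ y _ hxy q =>
    refine ⟨y, hxy, ?_⟩
    rw [rootWalk_eq ht r h q (SimpleGraph.Walk.IsPath.of_cons hp)]
    simp

/-- Either `y` lies on the path from `x` to the root, and then uniqueness of paths makes it the
second vertex, or prepending `y` to that path gives a path. -/
theorem rootWalk_adj {x y : N} (hxy : T.Adj x y) :
    (rootWalk ht r h y = h y :: rootWalk ht r h x ∧ y ≠ r) ∨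
      (rootWalk ht r h x = h x :: rootWalk ht r h y ∧ x ≠ r) := by
  obtain ⟨p, hp, -⟩ := ht.existsUnique_path x r
  by_cases hy : y ∈ p.support
  · right
    have hne : x ≠ r := by
      rintro rfl
      have : p = SimpleGraph.Walk.nil :=
        (ht.existsUnique_path x x).unique hp SimpleGraph.Walk.IsPath.nil
      subst this
      simp at hy
      exact hxy.ne hy.symm
    refine ⟨?_, hne⟩
    classical
    have h1 : p.takeUntil y hy = SimpleGraph.Walk.cons hxy SimpleGraph.Walk.nil := by
      refine (ht.existsUnique_path x y).unique (hp.takeUntil hy) ?_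
      simp [hxy.ne]
    have h2 : p = SimpleGraph.Walk.cons hxy (p.dropUntil y hy) := by
      conv_lhs => rw [← p.take_spec hy, h1]
      rfl
    rw [rootWalk_eq ht r h p hp, rootWalk_eq ht r h (p.dropUntil y hy) (hp.dropUntil hy)]
    conv_lhs => rw [h2]
    simp
  · left
    have hc : (SimpleGraph.Walk.cons hxy.symm p).IsPath := by
      rw [SimpleGraph.Walk.cons_isPath_iff]; exact ⟨hp, hy⟩
    refine ⟨?_, ?_⟩
    · rw [rootWalk_eq ht r h _ hc, rootWalk_eq ht r h p hp]; simp
    · rintro rfl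
      exact hy p.end_mem_support

theorem rootWalk_eq_singleton {x : N} {w : V} (hx : rootWalk ht r h x = [w]) : x = r := by
  by_contra hne
  obtain ⟨y, -, h2⟩ := rootWalk_parent ht r h hne
  obtain ⟨t, h3⟩ := rootWalk_head ht r h y
  rw [h2, h3] at hx
  simp at hx

variable (hloc : ∀ x y z, T.Adj x y → T.Adj x z → h y = h z → y = z)
include hloc

/-- Equal walks have equal tails, so by induction the parents coincide, and local injectivity
separates the children of one node. This is why sets of lists can stand for abstract trees mapped to
`V`. -/
theorem rootWalk_injective : Function.Injective (rootWalk ht r h) := by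
  intro x
  induction hl : rootWalk ht r h x generalizing x with
  | nil => obtain ⟨t, h1⟩ := rootWalk_head ht r h x; simp [h1] at hl
  | cons a l ih =>
    intro y hy
    by_cases hx : x = r
    · subst hx
      rw [rootWalk_root] at hl
      rw [← hl] at hy
      exact (rootWalk_eq_singleton ht x h hy.symm).symm
    by_cases hy' : y = r
    · subst hy'
      rw [rootWalk_root] at hy
      rw [hy] at hl
      exact rootWalk_eq_singleton ht y h hl
    obtain ⟨x', hx1, hx2⟩ := rootWalk_parent ht r h hx
    obtain ⟨y', hy1, hy2⟩ := rootWalk_parent ht r h hy'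
    rw [hx2] at hl
    rw [hy2] at hy
    injection hl with h1 h2
    injection hy with h3 h4
    have := ih h2 h4
    subst this
    exact hloc _ _ _ hx1.symm hy1.symm (by rw [h1, h3])

theorem adj_of_rootWalk {x y : N} {w : V} (hy : rootWalk ht r h y = w :: rootWalk ht r h x) :
    T.Adj x y ∧ h y = w := by
  have hne : y ≠ r := by
    rintro rfl
    rw [rootWalk_root] at hy
    obtain ⟨t, h1⟩ := rootWalk_head ht y h x
    rw [h1] at hy; simp at hy
  obtain ⟨x', h1, h2⟩ := rootWalk_parent ht r h hne
  rw [h2] at hy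
  injection hy with h3 h4
  rw [rootWalk_injective ht r h hloc h4] at h1
  exact ⟨h1.symm, h3⟩

theorem rootWalk_nonbacktracking {z : N} {w v u : V} {p : List V}
    (hz : rootWalk ht r h z = w :: v :: u :: p) : w ≠ u := by
  have hne : z ≠ r := by
    rintro rfl; rw [rootWalk_root] at hz; simp at hz
  obtain ⟨y, h1, h2⟩ := rootWalk_parent ht r h hne
  rw [hz] at h2
  injection h2 with h3 h4
  have hne' : y ≠ r := by
    rintro rfl; rw [rootWalk_root] at h4; simp at h4
  obtain ⟨x, h5, h6⟩ := rootWalk_parent ht r h hne'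
  rw [← h4] at h6
  injection h6 with h7 h8
  obtain ⟨t, h9⟩ := rootWalk_head ht r h x
  rintro rfl
  have h10 : h z = h x := by
    rw [← h8] at h9; injection h9 with h9 _; rw [← h3, h9]
  have := hloc _ _ _ h1.symm h5 h10
  subst this
  rw [hz] at h8
  have := congrArg List.length h8
  simp at this

end TreeWalk

/-- `(u, v)` is a dart into the node `p` of the set of walks `S`: `p` ends in `v`, and the walk
before `p` or a walk after `p` ends in `u`. (Walks are written in reverse.) -/
def Into {V : Type*} (S : Finset (List V)) (d : V × V) (p : List V) : Prop :=
  p ∈ S ∧ ∃ t, p = d.2 :: t ∧ ((∃ t', t = d.1 :: t') ∨ d.1 :: p ∈ S)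

/-- The two alternatives in `Into` are the step to the parent and a step to a child. Together they
give all neighbors, so the darts at a node can be read off from the lists alone. -/
theorem into_rootWalk {N V : Type*} [Fintype N] [DecidableEq V] {T : SimpleGraph N}
    (ht : T.IsTree) (r : N) (h : N → V)
    (hloc : ∀ x y z, T.Adj x y → T.Adj x z → h y = h z → y = z) (d : V × V) (x : N) :
    Into (Finset.univ.image (rootWalk ht r h)) d (rootWalk ht r h x) ↔
      h x = d.2 ∧ ∃ y, T.Adj x y ∧ h y = d.1 := by
  obtain ⟨t, h1⟩ := rootWalk_head ht r h x
  constructor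
  · rintro ⟨-, t', h2, h3⟩
    rw [h1] at h2
    injection h2 with h2 h4
    subst h4
    refine ⟨h2, ?_⟩
    rcases h3 with ⟨t', h3⟩ | h3
    · subst h3
      have hne : x ≠ r := by
        rintro rfl; rw [rootWalk_root] at h1; simp at h1
      obtain ⟨y, h5, h6⟩ := rootWalk_parent ht r h hne
      rw [h1] at h6
      injection h6 with h6 h7
      obtain ⟨t2, h8⟩ := rootWalk_head ht r h y
      rw [h8] at h7
      injection h7 with h7
      exact ⟨y, h5, h7.symm⟩
    · simp only [Finset.mem_image, Finset.mem_univ, true_and] at h3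
      obtain ⟨y, h3⟩ := h3
      exact ⟨y, adj_of_rootWalk ht r h hloc h3⟩
  · rintro ⟨h2, y, h3, h4⟩
    refine ⟨by simp, t, by rw [← h2, h1], ?_⟩
    rcases rootWalk_adj ht r h h3 with h5 | h5
    · right
      simp only [Finset.mem_image, Finset.mem_univ, true_and]
      exact ⟨y, by rw [h5.1, h4]⟩
    · left
      obtain ⟨t2, h8⟩ := rootWalk_head ht r h y
      refine ⟨t2, ?_⟩
      rw [← h4, ← h8]
      have := h5.1
      rw [h1] at this
      injection this


/-! ### Trees given by a partition of darts -/

section DartSystem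

variable {N V : Type*}

/-- Two darts are linked if one is the reverse of the other or if they are darts into the same
node, whose image satisfies `P`. -/
def DartLink (D : Finset (V × V)) (node : V × V → N) (P : V → Prop) (d d' : V × V) : Prop :=
  d ∈ D ∧ d' ∈ D ∧ (d' = d.swap ∨ (node d = node d' ∧ P d.2))

/-- A connected graph with nodes `N`, presented by a set `D` of darts in `V` and the node that each
dart leads to. -/
structure DartSystem (D : Finset (V × V)) (node : V × V → N) (h : N → V) : Prop where
  symm : ∀ d ∈ D, d.swap ∈ D
  head : ∀ d ∈ D, h (node d) = d.2
  irrefl : ∀ d ∈ D, d.1 ≠ d.2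
  surj : ∀ x, ∃ d ∈ D, node d = x
  conn : ∀ d ∈ D, ∀ d' ∈ D, Relation.EqvGen (DartLink D node fun _ => True) d d'

namespace DartSystem

variable {D : Finset (V × V)} {node : V × V → N} {h : N → V} (hs : DartSystem D node h)
include hs

/-- The graph on the nodes. -/
def graph : SimpleGraph N where
  Adj x y := ∃ d ∈ D, node d = x ∧ node d.swap = y
  symm := ⟨fun x y ⟨d, h1, h2, h3⟩ => ⟨d.swap, hs.symm d h1, h3, by simpa using h2⟩⟩
  loopless := ⟨fun x ⟨d, h1, h2, h3⟩ => hs.irrefl d h1 (by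
    have h4 := hs.head d h1
    have h5 := hs.head _ (hs.symm d h1)
    rw [h3, ← h2, h4] at h5
    exact h5.symm)⟩

theorem graph_adj {x y : N} : hs.graph.Adj x y ↔ ∃ d ∈ D, node d = x ∧ node d.swap = y := Iff.rfl

theorem connected [Nonempty N] : hs.graph.Connected := by
  have key : ∀ d d', Relation.EqvGen (DartLink D node fun _ => True) d d' →
      hs.graph.Reachable (node d) (node d') := by
    intro d d' hdd
    induction hdd with
    | rel d d' h1 =>
      obtain ⟨h1, h2, h3 | h3⟩ := h1
      · subst h3
        exact SimpleGraph.Adj.reachable ⟨d, h1, rfl, rfl⟩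
      · rw [h3.1]
    | refl d => exact SimpleGraph.Reachable.refl _
    | symm d d' _ ih => exact ih.symm
    | trans d d' d'' _ _ ih1 ih2 => exact ih1.trans ih2
  refine SimpleGraph.Connected.mk ?_
  intro x y
  obtain ⟨d, h1, rfl⟩ := hs.surj x
  obtain ⟨d', h2, rfl⟩ := hs.surj y
  exact key _ _ (hs.conn d h1 d' h2)

/-- A dart and its reverse are distinct by `irrefl` and give the same edge, so the map from darts to
edges is at least two-to-one. -/
theorem card_edgeSet_le : 2 * Nat.card hs.graph.edgeSet ≤ D.card := by
  classical
  let E : Finset (Sym2 N) := D.image fun d => s(node d, node d.swap)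
  have hE : hs.graph.edgeSet = E := by
    ext e
    induction e with
    | _ x y =>
      simp only [SimpleGraph.mem_edgeSet, graph_adj, E, Finset.coe_image, Set.mem_image,
        Finset.mem_coe, Sym2.eq_iff]
      constructor
      · rintro ⟨d, h1, h2, h3⟩; exact ⟨d, h1, Or.inl ⟨h2, h3⟩⟩
      · rintro ⟨d, h1, ⟨h2, h3⟩ | ⟨h2, h3⟩⟩
        · exact ⟨d, h1, h2, h3⟩
        · exact ⟨d.swap, hs.symm d h1, h3, by simpa using h2⟩
  rw [hE]
  simp only [Finset.coe_sort_coe, Nat.card_eq_fintype_card, Fintype.card_coe]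
  refine Finset.mul_card_image_le_card D 2 ?_
  intro b hb
  obtain ⟨d, hd, rfl⟩ := Finset.mem_image.1 hb
  have h1 : d ≠ d.swap := fun h1 => hs.irrefl d hd (congrArg Prod.fst h1)
  rw [← Finset.card_pair h1]
  refine Finset.card_le_card ?_
  intro g hg
  simp only [Finset.mem_insert, Finset.mem_singleton] at hg
  rcases hg with rfl | rfl
  · simp [hd]
  · simp [hs.symm d hd]

theorem card_le [Fintype N] [Nonempty N] : 2 * Fintype.card N ≤ D.card + 2 := by
  have h1 := hs.connected.card_vert_le_card_edgeSet_add_one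
  have h2 := hs.card_edgeSet_le
  have h3 := Nat.card_eq_fintype_card (α := N)
  omega

/-- A connected graph has at least one edge fewer than vertices, and every edge uses two darts.
Being a tree is thus a matter of connectedness and of counting, and the count does not change when
darts are reattached to other nodes. -/
theorem isTree [Fintype N] [Nonempty N] (hc : 2 * Fintype.card N = D.card + 2) :
    hs.graph.IsTree := by
  rw [SimpleGraph.isTree_iff_connected_and_card]
  refine ⟨hs.connected, ?_⟩
  have h1 := hs.connected.card_vert_le_card_edgeSet_add_one
  have h2 := hs.card_edgeSet_le
  have h3 := Nat.card_eq_fintype_card (α := N)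
  omega

theorem graph_adj_iff {x y : N} :
    hs.graph.Adj x y ↔ (h y, h x) ∈ D ∧ node (h y, h x) = x ∧ node (h x, h y) = y := by
  rw [graph_adj]
  constructor
  · rintro ⟨⟨u, v⟩, h1, h2, h3⟩
    have h4 := hs.head _ h1
    have h5 := hs.head _ (hs.symm _ h1)
    simp only [Prod.swap_prod_mk] at h3 h5
    rw [h2] at h4
    rw [h3] at h5
    subst h4 h5
    exact ⟨h1, h2, h3⟩
  · rintro ⟨h1, h2, h3⟩; exact ⟨_, h1, h2, h3⟩

/-- An edge is determined by the images of its ends, since these form the dart. -/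
theorem locallyInjective (x y z : N) (hxy : hs.graph.Adj x y) (hxz : hs.graph.Adj x z)
    (hyz : h y = h z) : y = z := by
  rw [graph_adj_iff] at hxy hxz
  rw [← hxy.2.2, ← hxz.2.2, hyz]

theorem exists_adj_iff (d : V × V) (x : N) :
    (h x = d.2 ∧ ∃ y, hs.graph.Adj x y ∧ h y = d.1) ↔ d ∈ D ∧ node d = x := by
  constructor
  · rintro ⟨h1, y, h2, h3⟩
    rw [graph_adj_iff, h1, h3] at h2
    exact ⟨h2.1, h2.2.1⟩
  · rintro ⟨h1, rfl⟩
    exact ⟨hs.head d h1, node d.swap, ⟨d, h1, rfl, rfl⟩, hs.head _ (hs.symm d h1)⟩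

/-- Two darts into the same node of a tree are not connected in the tree without the copies of their
head. -/
theorem node_ne [Fintype N] (hc : 2 * Fintype.card N = D.card + 2)
    {e f : V × V} (he : e ∈ D) (hf : f ∈ D) (hne : e ≠ f) (h2 : e.2 = f.2)
    (hef : Relation.EqvGen (DartLink D node fun v => v ≠ e.2) e f) : node e ≠ node f := by
  intro hn
  classical
  -- Suppose both darts lead to one node, and split off a new node that receives `e` alone. The
  -- system stays connected, since `e` is still linked to `f` away from the copies of their head. It
  -- then has one node more than the number of darts allows.
  let node' : V × V → Option N := fun d => if d = e then none else some (node d)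
  have hmap : ∀ d d', Relation.EqvGen (DartLink D node fun v => v ≠ e.2) d d' →
      Relation.EqvGen (DartLink D node' fun _ => True) d d' := by
    intro d d' hd
    refine hd.mono ?_
    rintro d d' ⟨h3, h4, h5 | ⟨h5, h6⟩⟩
    · exact ⟨h3, h4, Or.inl h5⟩
    · refine ⟨h3, h4, Or.inr ⟨?_, trivial⟩⟩
      have h7 : d.2 = d'.2 := by rw [← hs.head d h3, ← hs.head d' h4, h5]
      have h8 : d ≠ e := by rintro rfl; exact h6 rfl
      have h9 : d' ≠ e := by rintro rfl; exact h6 h7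
      simp [node', h8, h9, h5]
  have hs' : DartSystem D node' (fun o => o.elim e.2 h) := by
    refine ⟨hs.symm, ?_, hs.irrefl, ?_, ?_⟩
    · intro d hd
      by_cases h3 : d = e
      · simp [node', h3]
      · simp [node', h3, hs.head d hd]
    · intro x
      cases x with
      | none => exact ⟨e, he, by simp [node']⟩
      | some x =>
        obtain ⟨d, hd, h3⟩ := hs.surj x
        by_cases h4 : d = e
        · subst h4
          exact ⟨f, hf, by simp [node', hne.symm, ← hn, h3]⟩
        · exact ⟨d, hd, by simp [node', h4, h3]⟩
    · intro d hd d' hd'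
      have aux : ∀ g ∈ D, node g = node e →
          Relation.EqvGen (DartLink D node' fun _ => True) g e := by
        intro g hg h3
        by_cases h4 : g = e
        · subst h4; exact .refl _
        · refine .trans _ f _ (.rel _ _ ⟨hg, hf, Or.inr ⟨?_, trivial⟩⟩) (.symm _ _ (hmap _ _ hef))
          simp [node', h4, hne.symm, h3, hn]
      have h3 := hs.conn d hd d' hd'
      clear hd hd'
      induction h3 with
      | rel d d' h4 =>
        obtain ⟨h5, h6, h7 | h7⟩ := h4
        · exact .rel _ _ ⟨h5, h6, Or.inl h7⟩
        · by_cases h8 : node d = node e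
          · exact .trans _ _ _ (aux d h5 h8) (.symm _ _ (aux d' h6 (h7.1 ▸ h8)))
          · refine .rel _ _ ⟨h5, h6, Or.inr ⟨?_, trivial⟩⟩
            have h9 : d ≠ e := by rintro rfl; exact h8 rfl
            have h10 : d' ≠ e := by rintro rfl; exact h8 h7.1
            simp [node', h9, h10, h7.1]
      | refl d => exact .refl _
      | symm d d' _ ih => exact .symm _ _ ih
      | trans d d' d'' _ _ ih1 ih2 => exact .trans _ _ _ ih1 ih2
  have := hs'.card_le
  simp at this
  omega

/-- If there are two nodes with the image `v`, then there are two such nodes that are connected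
without further copies of `v`. -/
theorem exists_adjacent_copies {v : V} {d d' : V × V} (hd : d ∈ D) (hd' : d' ∈ D) (h1 : d.2 = v)
    (h2 : d'.2 = v) (hne : node d ≠ node d') :
    ∃ e ∈ D, ∃ f ∈ D, e.2 = v ∧ f.2 = v ∧ e ≠ f ∧
      Relation.EqvGen (DartLink D node fun w => w ≠ v) e f := by
  by_contra hcon
  push Not at hcon
  let K := Relation.EqvGen (DartLink D node fun w => w ≠ v)
  have hK : ∀ a b, K a b → (a = b ∨ (a ∈ D ∧ b ∈ D)) := by
    intro a b hab
    induction hab with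
    | rel a b h => exact Or.inr ⟨h.1, h.2.1⟩
    | refl a => exact Or.inl rfl
    | symm a b _ ih => rcases ih with ih | ih; exacts [Or.inl ih.symm, Or.inr ih.symm]
    | trans a b c _ _ ih1 ih2 =>
      rcases ih1 with rfl | ih1
      · exact ih2
      · rcases ih2 with rfl | ih2
        · exact Or.inr ih1
        · exact Or.inr ⟨ih1.1, ih2.2⟩
  have hu : ∀ a ∈ D, ∀ b ∈ D, a.2 = v → b.2 = v → K a b → a = b := by
    intro a ha b hb h3 h4 h5
    by_contra h6
    exact hcon a ha b hb h3 h4 h6 h5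
  -- If every class of `K` contained at most one dart into `v`, a chain of links could pass through
  -- a single node over `v` only. `R` expresses this and is transitive by the uniqueness `hu`, so
  -- the two given darts would share their node.
  let R : V × V → V × V → Prop := fun a b => K a b ∨
    ∃ a' ∈ D, ∃ b' ∈ D, a'.2 = v ∧ b'.2 = v ∧ node a' = node b' ∧ K a a' ∧ K b' b
  have hR : ∀ a b, Relation.EqvGen (DartLink D node fun _ => True) a b → R a b := by
    intro a b hab
    induction hab with
    | rel a b h =>
      obtain ⟨h3, h4, h5 | ⟨h5, -⟩⟩ := h
      · exact Or.inl (.rel _ _ ⟨h3, h4, Or.inl h5⟩)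
      · by_cases h6 : a.2 = v
        · have h7 : b.2 = v := by rw [← h6, ← hs.head a h3, ← hs.head b h4, h5]
          exact Or.inr ⟨a, h3, b, h4, h6, h7, h5, .refl _, .refl _⟩
        · exact Or.inl (.rel _ _ ⟨h3, h4, Or.inr ⟨h5, h6⟩⟩)
    | refl a => exact Or.inl (.refl _)
    | symm a b _ ih =>
      rcases ih with ih | ⟨a', h3, b', h4, h5, h6, h7, h8, h9⟩
      · exact Or.inl (.symm _ _ ih)
      · exact Or.inr ⟨b', h4, a', h3, h6, h5, h7.symm, .symm _ _ h9, .symm _ _ h8⟩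
    | trans a b c _ _ ih1 ih2 =>
      rcases ih1 with ih1 | ⟨a', h3, b', h4, h5, h6, h7, h8, h9⟩
      · rcases ih2 with ih2 | ⟨a', h3, b', h4, h5, h6, h7, h8, h9⟩
        · exact Or.inl (.trans _ _ _ ih1 ih2)
        · exact Or.inr ⟨a', h3, b', h4, h5, h6, h7, .trans _ _ _ ih1 h8, h9⟩
      · rcases ih2 with ih2 | ⟨a2, g3, b2, g4, g5, g6, g7, g8, g9⟩
        · exact Or.inr ⟨a', h3, b', h4, h5, h6, h7, h8, .trans _ _ _ h9 ih2⟩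
        · have : b' = a2 := hu b' h4 a2 g3 h6 g5 (.trans _ _ _ h9 g8)
          subst this
          exact Or.inr ⟨a', h3, b2, g4, h5, g6, h7.trans g7, h8, g9⟩
  rcases hR d d' (hs.conn d hd d' hd') with h3 | ⟨a', h3, b', h4, h5, h6, h7, h8, h9⟩
  · exact hne (by rw [hu d hd d' hd' h1 h2 h3])
  · have e1 := hu d hd a' h3 h1 h5 h8
    have e2 := hu b' h4 d' hd' h6 h2 h9
    subst e1 e2
    exact hne h7

/-- Exchanging two connected copies. -/
theorem swap [DecidableEq V] {e f : V × V} (he : e ∈ D) (hf : f ∈ D) (h2 : e.2 = f.2)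
    (hef : Relation.EqvGen (DartLink D node fun v => v ≠ e.2) e f) :
    DartSystem D (fun d => node (Equiv.swap e f d)) h := by
  have hmem : ∀ d, Equiv.swap e f d ∈ D ↔ d ∈ D := by
    intro d
    rcases eq_or_ne d e with rfl | h3
    · simp [he, hf]
    rcases eq_or_ne d f with rfl | h4
    · simp [he, hf]
    rw [Equiv.swap_apply_of_ne_of_ne h3 h4]
  have hhead : ∀ d, (Equiv.swap e f d).2 = d.2 := by
    intro d
    rcases eq_or_ne d e with rfl | h3
    · simp [h2]
    rcases eq_or_ne d f with rfl | h4
    · simp [h2]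
    rw [Equiv.swap_apply_of_ne_of_ne h3 h4]
  have hfix : ∀ d, d.2 ≠ e.2 → Equiv.swap e f d = d := by
    intro d hd
    refine Equiv.swap_apply_of_ne_of_ne ?_ ?_
    · rintro rfl; exact hd rfl
    · rintro rfl; exact hd h2.symm
  -- Links that avoid the common head do not involve `e` or `f` in the same-node part, so they
  -- survive the exchange. Hence `e` and `f` remain connected, and every dart is connected to its
  -- image under the exchange.
  have hefK : Relation.EqvGen
      (DartLink D (fun d => node (Equiv.swap e f d)) fun _ => True) e f := by
    refine hef.mono ?_
    rintro d d' ⟨h3, h4, h5 | ⟨h5, h6⟩⟩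
    · exact ⟨h3, h4, Or.inl h5⟩
    · refine ⟨h3, h4, Or.inr ⟨?_, trivial⟩⟩
      have h7 : d.2 = d'.2 := by rw [← hs.head d h3, ← hs.head d' h4, h5]
      simp only [hfix d h6, hfix d' (h7 ▸ h6), h5]
  have hmove : ∀ d, Relation.EqvGen
      (DartLink D (fun d => node (Equiv.swap e f d)) fun _ => True) d (Equiv.swap e f d) := by
    intro d
    rcases eq_or_ne d e with rfl | h3
    · rw [Equiv.swap_apply_left]; exact hefK
    rcases eq_or_ne d f with rfl | h4
    · rw [Equiv.swap_apply_right]; exact .symm _ _ hefK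
    rw [Equiv.swap_apply_of_ne_of_ne h3 h4]; exact .refl _
  refine ⟨hs.symm, ?_, hs.irrefl, ?_, ?_⟩
  · intro d hd
    rw [hs.head _ ((hmem d).2 hd), hhead]
  · intro x
    obtain ⟨d, hd, h3⟩ := hs.surj x
    exact ⟨Equiv.swap e f d, (hmem d).2 hd, by simp [h3]⟩
  · intro d hd d' hd'
    have h3 := hs.conn d hd d' hd'
    clear hd hd'
    induction h3 with
    | rel d d' h4 =>
      obtain ⟨h5, h6, h7 | h7⟩ := h4
      · exact .rel _ _ ⟨h5, h6, Or.inl h7⟩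
      · refine .trans _ _ _ (hmove d) (.trans _ _ _ (.rel _ _ ?_) (.symm _ _ (hmove d')))
        exact ⟨(hmem d).2 h5, (hmem d').2 h6, Or.inr ⟨by simpa using h7.1, trivial⟩⟩
    | refl d => exact .refl _
    | symm d d' _ ih => exact .symm _ _ ih
    | trans d d' d'' _ _ ih1 ih2 => exact .trans _ _ _ ih1 ih2

end DartSystem

end DartSystem


/-! ### Sets of walks that form a tree -/

section WalkTree

set_option linter.unusedSectionVars false

open scoped Classical in
/-- The darts into the nodes of a set of walks. -/
noncomputable def walkDarts {V : Type*} [Fintype V] (S : Finset (List V)) : Finset (V × V) :=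
  Finset.univ.filter fun d => ∃ p, Into S d p

/-- The edge at the end of a walk. -/
def lastEdge {V : Type*} (ρ : V) (p : List V) : Sym2 V := s(p.tail.headD ρ, p.headD ρ)

/-- A set of non-backtracking walks from `ρ`, closed under removing the last step. It forms a tree in
which the root `ρ` is a leaf, whose only neighbor is `σ`. No walk returns to `ρ`. -/
structure IsWalkTree {V : Type*} (G : SimpleGraph V) (ρ σ : V) (S : Finset (List V)) : Prop where
  root : [ρ] ∈ S
  stem : [σ, ρ] ∈ S
  nil : [] ∉ S
  tail : ∀ w v p, w :: v :: p ∈ S → v :: p ∈ S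
  single : ∀ w, [w] ∈ S → w = ρ
  two : ∀ w, [w, ρ] ∈ S → w = σ
  adj : ∀ w v p, w :: v :: p ∈ S → G.Adj v w
  back : ∀ w v u p, w :: v :: u :: p ∈ S → w ≠ u
  ret : ∀ w v p, w :: v :: p ∈ S → w ≠ ρ

variable {V : Type*} [Fintype V] [DecidableEq V] {G : SimpleGraph V} {ρ σ : V}

/-- The edges of a tree of walks. -/
def walkEdges (ρ : V) (S : Finset (List V)) : Multiset (Sym2 V) :=
  (S.erase [ρ]).val.map (lastEdge ρ)

/-- A node with only one dart into it. -/
def LeafNode {V : Type*} (S : Finset (List V)) (p : List V) : Prop :=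
  ∀ d d', Into S d p → Into S d' p → d = d'

/-- Two darts into the same node. -/
def SameNode {V : Type*} (S : Finset (List V)) (d d' : V × V) : Prop :=
  ∃ p, Into S d p ∧ Into S d' p

open scoped Classical in
/-- The vertices that receive a label: those in the class `P` and the leaves. -/
noncomputable def vertexItems {V : Type*} (P : V → Prop) (ρ : V) (S : Finset (List V)) :
    Multiset V :=
  (S.filter fun p => P (p.headD ρ) ∨ LeafNode S p).val.map fun p => p.headD ρ

open scoped Classical in
/-- The objects that receive a label: vertices and edges outside of `P`. -/
noncomputable def items (P : V → Prop) (ρ : V) (S : Finset (List V)) : Multiset (Sym2 V) :=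
  (vertexItems P ρ S).map (fun v => s(v, v)) + (walkEdges ρ S).filter fun e => ∀ v ∈ e, ¬ P v

open scoped Classical in
/-- The number of leaves. -/
noncomputable def leafCount {V : Type*} (S : Finset (List V)) : ℕ := (S.filter (LeafNode S)).card

theorem mem_walkDarts {S : Finset (List V)} {d : V × V} : d ∈ walkDarts S ↔ ∃ p, Into S d p := by
  simp [walkDarts]

theorem SameNode.mem {S : Finset (List V)} {d d' : V × V} (h : SameNode S d d') :
    d ∈ walkDarts S ∧ d' ∈ walkDarts S ∧ d.2 = d'.2 := by
  obtain ⟨p, h1, h2⟩ := h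
  refine ⟨mem_walkDarts.2 ⟨p, h1⟩, mem_walkDarts.2 ⟨p, h2⟩, ?_⟩
  obtain ⟨-, t, h3, -⟩ := h1
  obtain ⟨-, t', h4, -⟩ := h2
  rw [h3] at h4
  injection h4

namespace IsWalkTree

variable {S : Finset (List V)} (hw : IsWalkTree G ρ σ S)
include hw

theorem into_root (d : V × V) : Into S d [ρ] ↔ d = (σ, ρ) := by
  constructor
  · rintro ⟨-, t, h1, h2⟩
    injection h1 with h1 h3
    subst h3
    rcases h2 with ⟨t', h2⟩ | h2
    · cases h2
    · have := hw.two _ h2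
      ext <;> simp_all
  · rintro rfl
    exact ⟨hw.root, [], rfl, Or.inr hw.stem⟩

theorem into_parent {w v : V} {p : List V} (h : w :: v :: p ∈ S) : Into S (v, w) (w :: v :: p) :=
  ⟨h, _, rfl, Or.inl ⟨_, rfl⟩⟩

theorem into_child {w v : V} {p : List V} (h : w :: v :: p ∈ S) : Into S (w, v) (v :: p) :=
  ⟨hw.tail _ _ _ h, _, rfl, Or.inr h⟩

theorem cases_mem {p : List V} (h : p ∈ S) : p = [ρ] ∨ ∃ w v t, p = w :: v :: t := by
  match p, h with
  | [], h => exact absurd h hw.nil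
  | [w], h => exact Or.inl (by rw [hw.single w h])
  | w :: v :: t, _ => exact Or.inr ⟨w, v, t, rfl⟩

theorem mem_erase_root {w v : V} {t : List V} :
    w :: v :: t ∈ S.erase [ρ] ↔ w :: v :: t ∈ S := by
  simp

theorem exists_of_into {d : V × V} {p : List V} (h : Into S d p) :
    (∃ t, p = d.2 :: d.1 :: t ∧ p ∈ S) ∨ (∃ t, p = d.2 :: t ∧ d.1 :: d.2 :: t ∈ S) := by
  obtain ⟨h1, t, rfl, ⟨t', rfl⟩ | h3⟩ := h
  · exact Or.inl ⟨_, rfl, h1⟩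
  · exact Or.inr ⟨_, rfl, h3⟩

/-- A node other than the root always has the dart from its parent. A child would give a second one,
different because the walk does not backtrack. -/
theorem leafNode_iff {p : List V} (hp : p ∈ S) :
    LeafNode S p ↔ (p = [ρ] ∨ ∀ w, w :: p ∉ S) := by
  constructor
  · intro h
    rcases hw.cases_mem hp with rfl | ⟨w, v, t, rfl⟩
    · exact Or.inl rfl
    · right
      intro a ha
      have h1 := h _ _ (hw.into_parent hp) (hw.into_child ha)
      have h2 := hw.back _ _ _ _ ha
      exact h2 (congrArg Prod.fst h1).symm
  · rintro (rfl | h) d d' h1 h2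
    · rw [hw.into_root] at h1 h2; rw [h1, h2]
    · rcases hw.exists_of_into h1 with ⟨t, h3, -⟩ | ⟨t, h3, h4⟩
      · rcases hw.exists_of_into h2 with ⟨t', h5, -⟩ | ⟨t', h5, h6⟩
        · rw [h3] at h5
          injection h5 with h5 h6
          injection h6 with h6 h7
          exact Prod.ext h6 h5
        · exact absurd (h5 ▸ h6) (h d'.1)
      · exact absurd (h3 ▸ h4) (h d.1)

variable (hinj : Set.InjOn (lastEdge ρ) (S.erase [ρ]))
include hinj

/-- Two nodes receiving the same dart lead to two walks with the same last edge, which are equal by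
hypothesis. If they crossed the edge in opposite directions, equality would make the edge a loop. -/
theorem into_unique {d : V × V} {p q : List V} (hp : Into S d p) (hq : Into S d q) : p = q := by
  have key : ∀ t t', d.2 :: d.1 :: t ∈ S → d.1 :: d.2 :: t' ∈ S → False := by
    intro t t' h1 h2
    have := hinj (hw.mem_erase_root.2 h1) (hw.mem_erase_root.2 h2) (by simp [lastEdge, Sym2.eq_swap])
    injection this with h3 h4
    exact (hw.adj _ _ _ h1).ne h3.symm
  rcases hw.exists_of_into hp with ⟨t, h1, h2⟩ | ⟨t, h1, h2⟩ <;>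
  rcases hw.exists_of_into hq with ⟨t', h3, h4⟩ | ⟨t', h3, h4⟩
  · subst h1 h3
    exact hinj (hw.mem_erase_root.2 h2) (hw.mem_erase_root.2 h4) (by simp [lastEdge])
  · subst h1 h3
    exact (key _ _ h2 h4).elim
  · subst h1 h3
    exact (key _ _ h4 h2).elim
  · subst h1 h3
    have := hinj (hw.mem_erase_root.2 h2) (hw.mem_erase_root.2 h4) (by simp [lastEdge])
    injection this

theorem sameNode_iff {d d' : V × V} {p : List V} (hp : Into S d p) :
    SameNode S d d' ↔ Into S d' p := by
  constructor
  · rintro ⟨q, h1, h2⟩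
    rwa [hw.into_unique hinj hp h1]
  · intro h; exact ⟨p, hp, h⟩

/-- The tree can be rebuilt from the root. The darts into a node name its children, and the dart
from the parent determines, through `SameNode`, all darts into the child. -/
theorem subset_of_sameNode {S' : Finset (List V)} (hw' : IsWalkTree G ρ σ S')
    (hinj' : Set.InjOn (lastEdge ρ) (S'.erase [ρ]))
    (h : ∀ d ∈ walkDarts S, ∀ d' ∈ walkDarts S, (SameNode S d d' ↔ SameNode S' d d'))
    (hd : walkDarts S' = walkDarts S) (p : List V) (hp : p ∈ S) :
    p ∈ S' ∧ ∀ d, Into S d p ↔ Into S' d p := by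
  induction p with
  | nil => exact absurd hp hw.nil
  | cons w p ih =>
    cases p with
    | nil =>
      rw [hw.single _ hp]
      exact ⟨hw'.root, fun d => by rw [hw.into_root, hw'.into_root]⟩
    | cons v t =>
      obtain ⟨-, h2⟩ := ih (hw.tail _ _ _ hp)
      have h3 := (h2 _).1 (hw.into_child hp)
      have hp' : w :: v :: t ∈ S' := by
        rcases hw'.exists_of_into h3 with ⟨t', h4, -⟩ | ⟨t', h4, h5⟩
        · injection h4 with _ h4
          subst h4
          exact absurd rfl (hw.back _ _ _ _ hp)
        · injection h4 with _ h4
          subst h4; exact h5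
      refine ⟨hp', fun d => ?_⟩
      have h5 := hw.into_parent hp
      have h6 := hw'.into_parent hp'
      rw [← hw.sameNode_iff hinj h5, ← hw'.sameNode_iff hinj' h6]
      by_cases hdd : d ∈ walkDarts S
      · exact h _ (mem_walkDarts.2 ⟨_, h5⟩) _ hdd
      · constructor
        · intro h7; exact absurd h7.mem.2.1 hdd
        · intro h7; exact absurd (hd ▸ h7.mem.2.1) hdd

theorem eq_of_sameNode {S' : Finset (List V)} (hw' : IsWalkTree G ρ σ S')
    (hinj' : Set.InjOn (lastEdge ρ) (S'.erase [ρ])) (hd : walkDarts S' = walkDarts S)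
    (h : ∀ d ∈ walkDarts S, ∀ d' ∈ walkDarts S, (SameNode S d d' ↔ SameNode S' d d')) : S = S' := by
  apply Finset.Subset.antisymm
  · intro p hp
    exact (hw.subset_of_sameNode hinj hw' hinj' h hd p hp).1
  · intro p hp
    refine (hw'.subset_of_sameNode hinj' hw hinj ?_ hd.symm p hp).1
    rw [hd]
    intro d h1 d' h2
    exact (h d h1 d' h2).symm

open scoped Classical in
/-- The node that a dart leads to. -/
noncomputable def nodeOf (_ : IsWalkTree G ρ σ S) (d : V × V) : S :=
  if h : ∃ p, Into S d p then ⟨h.choose, h.choose_spec.1⟩ else ⟨[ρ], hw.root⟩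

theorem nodeOf_eq_iff {d : V × V} (hd : ∃ p, Into S d p) (x : S) :
    hw.nodeOf hw d = x ↔ Into S d x := by
  have h1 : Into S d (hw.nodeOf hw d) := by
    rw [nodeOf, dif_pos hd]
    exact hd.choose_spec
  constructor
  · rintro rfl; exact h1
  · intro h2
    exact Subtype.ext (hw.into_unique hinj h1 h2)

theorem dartSystem : DartSystem (walkDarts S) (hw.nodeOf hw) (fun x : S => x.1.headD ρ) := by
  have hmem : ∀ d, d ∈ walkDarts S → (∃ t, d.2 :: d.1 :: t ∈ S) ∨ (∃ t, d.1 :: d.2 :: t ∈ S) := by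
    intro d hd
    obtain ⟨p, hp⟩ := mem_walkDarts.1 hd
    rcases hw.exists_of_into hp with ⟨t, rfl, h2⟩ | ⟨t, rfl, h2⟩
    · exact Or.inl ⟨t, h2⟩
    · exact Or.inr ⟨t, h2⟩
  have hpar : ∀ {w v p}, w :: v :: p ∈ S → (v, w) ∈ walkDarts S :=
    fun h => mem_walkDarts.2 ⟨_, hw.into_parent h⟩
  have hchi : ∀ {w v p}, w :: v :: p ∈ S → (w, v) ∈ walkDarts S :=
    fun h => mem_walkDarts.2 ⟨_, hw.into_child h⟩
  have hsw : ∀ d ∈ walkDarts S, d.swap ∈ walkDarts S := by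
    intro d hd
    rcases hmem d hd with ⟨t, h⟩ | ⟨t, h⟩
    · exact hchi h
    · exact hpar h
  -- Following a walk back to the root links its last dart to the dart along the first edge.
  have hroot : ∀ p, ∀ w v t, p = w :: v :: t → p ∈ S →
      Relation.EqvGen (DartLink (walkDarts S) (hw.nodeOf hw) fun _ => True) (v, w) (ρ, σ) := by
    intro p
    induction p with
    | nil => intro w v t h; cases h
    | cons a p ih =>
      rintro w v t h hp
      injection h with h1 h2
      subst h1 h2
      cases t with
      | nil =>
        have h3 := hw.single _ (hw.tail _ _ _ hp)
        subst h3
        have h4 := hw.two _ hp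
        subst h4
        exact .refl _
      | cons u t =>
        have h3 := hw.tail _ _ _ hp
        refine .trans _ _ _ (.rel _ (a, v) ⟨hpar hp, hchi hp, Or.inl rfl⟩)
          (.trans _ _ _ (.rel _ (u, v) ⟨hchi hp, hpar h3, Or.inr ⟨?_, trivial⟩⟩) (ih _ _ _ rfl h3))
        rw [hw.nodeOf_eq_iff hinj ⟨_, hw.into_child hp⟩ _,
          (hw.nodeOf_eq_iff hinj ⟨_, hw.into_parent h3⟩ ⟨_, h3⟩).2 (hw.into_parent h3)]
        exact hw.into_child hp
  refine ⟨hsw, ?_, ?_, ?_, ?_⟩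
  · intro d hd
    have hd' := mem_walkDarts.1 hd
    obtain ⟨-, t, h2, -⟩ := (hw.nodeOf_eq_iff hinj hd' _).1 rfl
    simp [h2]
  · intro d hd
    rcases hmem d hd with ⟨t, h⟩ | ⟨t, h⟩
    · exact (hw.adj _ _ _ h).ne
    · exact (hw.adj _ _ _ h).ne.symm
  · rintro ⟨p, hp⟩
    rcases hw.cases_mem hp with rfl | ⟨w, v, t, rfl⟩
    · have h1 := (hw.into_root _).2 rfl
      exact ⟨_, mem_walkDarts.2 ⟨_, h1⟩, (hw.nodeOf_eq_iff hinj ⟨_, h1⟩ _).2 h1⟩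
    · have h1 := hw.into_parent hp
      exact ⟨_, mem_walkDarts.2 ⟨_, h1⟩, (hw.nodeOf_eq_iff hinj ⟨_, h1⟩ _).2 h1⟩
  · have h1 : ∀ d ∈ walkDarts S, Relation.EqvGen
        (DartLink (walkDarts S) (hw.nodeOf hw) fun _ => True) d (ρ, σ) := by
      intro d hd
      rcases hmem d hd with ⟨t, h⟩ | ⟨t, h⟩
      · exact hroot _ _ _ _ rfl h
      · exact .trans _ _ _ (.rel _ _ ⟨hd, hsw d hd, Or.inl rfl⟩) (hroot _ _ _ _ rfl h)
    intro d hd d' hd'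
    exact .trans _ _ _ (h1 d hd) (.symm _ _ (h1 d' hd'))

/-- Each node except the root contributes the two darts of the edge to its parent. These are all
different because the last edges are. -/
theorem card_walkDarts : 2 * Fintype.card S = (walkDarts S).card + 2 := by
  let f : List V → V × V := fun p => (p.tail.headD ρ, p.headD ρ)
  have h1 : walkDarts S = (S.erase [ρ]).image f ∪ (S.erase [ρ]).image (Prod.swap ∘ f) := by
    ext d
    rw [mem_walkDarts, Finset.mem_union, Finset.mem_image, Finset.mem_image]
    constructor
    · rintro ⟨p, hp⟩
      rcases hw.exists_of_into hp with ⟨t, rfl, h2⟩ | ⟨t, rfl, h2⟩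
      · exact Or.inl ⟨_, hw.mem_erase_root.2 h2, rfl⟩
      · exact Or.inr ⟨_, hw.mem_erase_root.2 h2, rfl⟩
    · rintro (⟨p, h2, rfl⟩ | ⟨p, h2, rfl⟩) <;>
      · obtain ⟨h3, h4⟩ := Finset.mem_erase.1 h2
        rcases hw.cases_mem h4 with rfl | ⟨w, v, t, rfl⟩
        · exact absurd rfl h3
        · first
          | exact ⟨_, hw.into_parent h4⟩
          | exact ⟨_, hw.into_child h4⟩
  have h2 : Disjoint ((S.erase [ρ]).image f) ((S.erase [ρ]).image (Prod.swap ∘ f)) := by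
    rw [Finset.disjoint_left]
    rintro d h3 h4
    obtain ⟨p, h5, rfl⟩ := Finset.mem_image.1 h3
    obtain ⟨q, h6, h7⟩ := Finset.mem_image.1 h4
    have h8 : q = p := hinj h6 h5 (by
      simp only [f, Function.comp, Prod.swap_prod_mk, Prod.mk.injEq] at h7
      rw [lastEdge, lastEdge, h7.1, h7.2, Sym2.eq_swap])
    subst h8
    obtain ⟨h3, h4⟩ := Finset.mem_erase.1 h6
    rcases hw.cases_mem h4 with rfl | ⟨w, v, t, rfl⟩
    · exact absurd rfl h3
    · simp [f] at h7
      exact (hw.adj _ _ _ h4).ne h7.1.symm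
  have h3 : Set.InjOn f (S.erase [ρ]) := by
    intro p hp q hq h4
    refine hinj hp hq ?_
    simp only [f, Prod.mk.injEq] at h4
    rw [lastEdge, lastEdge, h4.1, h4.2]
  have h4 : Set.InjOn (Prod.swap ∘ f) (S.erase [ρ]) := Prod.swap_injective.comp_injOn h3
  rw [h1, Finset.card_union_of_disjoint h2, Finset.card_image_of_injOn h3,
    Finset.card_image_of_injOn h4, Finset.card_erase_of_mem hw.root, Fintype.card_coe]
  have := Finset.card_pos.2 ⟨_, hw.root⟩
  omega

end IsWalkTree

end WalkTree


/-! ### Passing between dart systems and trees of walks, and the cancelling involution -/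

section TreeWalks

set_option linter.unusedSectionVars false

variable {V : Type*} [Fintype V] [DecidableEq V] {G : SimpleGraph V} {ρ σ : V}

/-- A node of a dart system with only one dart into it. -/
def DartLeaf {N V : Type*} (D : Finset (V × V)) (node : V × V → N) (x : N) : Prop :=
  ∀ d ∈ D, ∀ d' ∈ D, node d = x → node d' = x → d = d'

namespace DartSystem

variable {N : Type*} [Fintype N] {D : Finset (V × V)} {node : V × V → N} {h : N → V}
  (hs : DartSystem D node h) (ht : hs.graph.IsTree)
include hs ht

/-- The walks from a root in a tree given by a dart system. -/
noncomputable def walks (r : N) : Finset (List V) := Finset.univ.image (rootWalk ht r h)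

theorem into_walks (r : N) (d : V × V) (x : N) :
    Into (hs.walks ht r) d (rootWalk ht r h x) ↔ d ∈ D ∧ node d = x :=
  (into_rootWalk ht r h hs.locallyInjective d x).trans (hs.exists_adj_iff d x)

theorem mem_walks (r : N) (x : N) : rootWalk ht r h x ∈ hs.walks ht r :=
  Finset.mem_image_of_mem _ (Finset.mem_univ x)

theorem injective (r : N) : Function.Injective (rootWalk ht r h) :=
  rootWalk_injective ht r h hs.locallyInjective

theorem card_walks (r : N) : (hs.walks ht r).card = Fintype.card N :=
  Finset.card_image_of_injective _ (hs.injective ht r)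

theorem walkDarts_walks (r : N) : walkDarts (hs.walks ht r) = D := by
  ext d
  rw [mem_walkDarts]
  constructor
  · rintro ⟨p, hp⟩
    obtain ⟨x, -, rfl⟩ := Finset.mem_image.1 hp.1
    exact ((hs.into_walks ht r d x).1 hp).1
  · intro hd
    exact ⟨_, (hs.into_walks ht r d _).2 ⟨hd, rfl⟩⟩

theorem sameNode_walks (r : N) {d d' : V × V} (hd : d ∈ D) (hd' : d' ∈ D) :
    SameNode (hs.walks ht r) d d' ↔ node d = node d' := by
  constructor
  · rintro ⟨p, hp, hp'⟩
    obtain ⟨x, -, rfl⟩ := Finset.mem_image.1 hp.1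
    rw [((hs.into_walks ht r d x).1 hp).2, ((hs.into_walks ht r d' x).1 hp').2]
  · intro h1
    exact ⟨_, (hs.into_walks ht r d _).2 ⟨hd, rfl⟩, (hs.into_walks ht r d' _).2 ⟨hd', h1.symm⟩⟩

theorem leafNode_walks (r : N) (x : N) :
    LeafNode (hs.walks ht r) (rootWalk ht r h x) ↔ DartLeaf D node x := by
  constructor
  · intro h1 d hd d' hd' h2 h3
    exact h1 d d' ((hs.into_walks ht r _ _).2 ⟨hd, h2⟩) ((hs.into_walks ht r _ _).2 ⟨hd', h3⟩)
  · intro h1 d d' h2 h3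
    have h4 := (hs.into_walks ht r _ _).1 h2
    have h5 := (hs.into_walks ht r _ _).1 h3
    exact h1 d h4.1 d' h5.1 h4.2 h5.2

open scoped Classical in
theorem leafCount_walks (r : N) :
    leafCount (hs.walks ht r) = (Finset.univ.filter fun x => DartLeaf D node x).card := by
  rw [leafCount, walks, Finset.filter_image, Finset.card_image_of_injective _ (hs.injective ht r)]
  congr 1
  ext x
  simp only [Finset.mem_filter, Finset.mem_univ, true_and]
  exact hs.leafNode_walks ht r x

open scoped Classical in
theorem vertexItems_walks (P : V → Prop) (r : N) :
    vertexItems P ρ (hs.walks ht r) =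
      (Finset.univ.filter fun x => P (h x) ∨ DartLeaf D node x).val.map h := by
  rw [vertexItems, walks, Finset.filter_image,
    Finset.image_val_of_injOn (hs.injective ht r).injOn, Multiset.map_map]
  have h1 : ∀ x, (rootWalk ht r h x).headD ρ = h x := by
    intro x
    obtain ⟨t, h1⟩ := rootWalk_head ht r h x
    simp [h1]
  have h2 : (Finset.univ.filter fun x => P ((rootWalk ht r h x).headD ρ) ∨
      LeafNode (Finset.univ.image (rootWalk ht r h)) (rootWalk ht r h x)) =
      Finset.univ.filter fun x => P (h x) ∨ DartLeaf D node x := by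
    ext x
    simp only [Finset.mem_filter, Finset.mem_univ, true_and, h1]
    exact or_congr_right (hs.leafNode_walks ht r x)
  rw [h2]
  exact Multiset.map_congr rfl fun x _ => h1 x

theorem exists_dart_of_walk {r : N} {w v : V} {p : List V} {z : N}
    (hz : rootWalk ht r h z = w :: v :: p) : ∃ y, rootWalk ht r h y = v :: p ∧ h y = v ∧ h z = w ∧
      (v, w) ∈ D ∧ node (v, w) = z ∧ node (w, v) = y := by
  have hne : z ≠ r := by
    rintro rfl; rw [rootWalk_root] at hz; simp at hz
  obtain ⟨y, h1, h2⟩ := rootWalk_parent ht r h hne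
  rw [hz] at h2
  injection h2 with h3 h4
  obtain ⟨t, h5⟩ := rootWalk_head ht r h y
  have h6 := h4
  rw [h5] at h6
  injection h6 with h6 h7
  rw [hs.graph_adj_iff, ← h3, ← h6] at h1
  exact ⟨y, h4.symm, h6.symm, h3.symm, h1⟩

/-- By `hone` there is a single dart into `ρ`, so only the root lies over `ρ`. This gives the
condition that no walk returns and makes the root a leaf. -/
theorem isWalkTree_walks (hadj : ∀ d ∈ D, G.Adj d.1 d.2) (hρ : (σ, ρ) ∈ D)
    (hone : ∀ d ∈ D, d.2 = ρ → d.1 = σ) :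
    IsWalkTree G ρ σ (hs.walks ht (node (σ, ρ))) := by
  set r := node (σ, ρ) with hr
  have hhr : h r = ρ := hs.head _ hρ
  have hroot : rootWalk ht r h r = [ρ] := by rw [rootWalk_root, hhr]
  have hρ' : ∀ x, h x = ρ → x = r := by
    intro x hx
    obtain ⟨d, hd, rfl⟩ := hs.surj x
    rw [hs.head d hd] at hx
    have h1 := hone d hd hx
    rw [hr]
    congr 1
    exact Prod.ext h1 hx
  have hmem : ∀ p, p ∈ hs.walks ht r ↔ ∃ x, rootWalk ht r h x = p := by
    intro p; simp [walks]
  refine ⟨?_, ?_, ?_, ?_, ?_, ?_, ?_, ?_, ?_⟩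
  · exact (hmem _).2 ⟨r, hroot⟩
  · refine (hmem _).2 ⟨node (ρ, σ), ?_⟩
    have h1 : hs.graph.Adj r (node (ρ, σ)) := ⟨_, hρ, rfl, rfl⟩
    have h2 := hs.head _ (hs.symm _ hρ)
    simp only [Prod.swap_prod_mk] at h2
    rcases rootWalk_adj ht r h h1 with h3 | h3
    · rw [h3.1, h2, hroot]
    · exact absurd rfl h3.2
  · rw [hmem]
    rintro ⟨x, hx⟩
    obtain ⟨t, h1⟩ := rootWalk_head ht r h x
    rw [h1] at hx; cases hx
  · intro w v p hp
    obtain ⟨z, hz⟩ := (hmem _).1 hp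
    obtain ⟨y, hy, -⟩ := hs.exists_dart_of_walk ht hz
    exact (hmem _).2 ⟨y, hy⟩
  · intro w hw
    obtain ⟨z, hz⟩ := (hmem _).1 hw
    rw [rootWalk_eq_singleton ht r h hz, hroot] at hz
    injection hz with hz
    exact hz.symm
  · intro w hw
    obtain ⟨z, hz⟩ := (hmem _).1 hw
    obtain ⟨y, hy, h1, h2, h3, h4, h5⟩ := hs.exists_dart_of_walk ht hz
    exact hone _ (hs.symm _ h3) rfl
  · intro w v p hp
    obtain ⟨z, hz⟩ := (hmem _).1 hp
    obtain ⟨y, hy, h1, h2, h3, h4, h5⟩ := hs.exists_dart_of_walk ht hz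
    exact hadj _ h3
  · intro w v u p hp
    obtain ⟨z, hz⟩ := (hmem _).1 hp
    exact rootWalk_nonbacktracking ht r h hs.locallyInjective hz
  · rintro w v p hp rfl
    obtain ⟨z, hz⟩ := (hmem _).1 hp
    obtain ⟨y, hy, h1, h2, h3, h4, h5⟩ := hs.exists_dart_of_walk ht hz
    rw [hρ' z h2, hroot] at hz
    cases hz

theorem injOn_lastEdge_walks {r : N} (hr : h r = ρ) :
    Set.InjOn (lastEdge ρ) ((hs.walks ht r).erase [ρ]) := by
  intro p hp q hq hpq
  obtain ⟨h1, h2⟩ := Finset.mem_erase.1 hp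
  obtain ⟨h3, h4⟩ := Finset.mem_erase.1 hq
  obtain ⟨x, -, rfl⟩ := Finset.mem_image.1 h2
  obtain ⟨y, -, rfl⟩ := Finset.mem_image.1 h4
  have aux : ∀ x, rootWalk ht r h x ≠ [ρ] → ∃ w v t, rootWalk ht r h x = w :: v :: t := by
    intro x hx
    have hne : x ≠ r := by
      rintro rfl; exact hx (by rw [rootWalk_root, hr])
    obtain ⟨y, h1, h2⟩ := rootWalk_parent ht r h hne
    obtain ⟨t, h3⟩ := rootWalk_head ht r h y
    exact ⟨_, _, _, by rw [h2, h3]⟩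
  obtain ⟨w, v, t, h5⟩ := aux x h1
  obtain ⟨w', v', t', h6⟩ := aux y h3
  obtain ⟨x', hx', -, -, h7, h8, h9⟩ := hs.exists_dart_of_walk ht h5
  obtain ⟨y', hy', -, -, h10, h11, h12⟩ := hs.exists_dart_of_walk ht h6
  rw [h5, h6] at hpq
  simp only [lastEdge, List.tail_cons, List.headD_cons, Sym2.eq_iff] at hpq
  rcases hpq with ⟨rfl, rfl⟩ | ⟨rfl, rfl⟩
  · rw [← h8, ← h11]
  · exfalso
    rw [h12] at h8
    rw [h9] at h11
    subst h8 h11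
    rw [h5] at hy'
    rw [h6] at hx'
    have e1 := congrArg List.length hx'
    have e2 := congrArg List.length hy'
    simp at e1 e2
    omega

/-- The edges depend on the set of darts only, and not on how the darts are grouped into nodes. This
is why an exchange preserves them. -/
theorem walkEdges_walks {r : N} (hr : h r = ρ) :
    walkEdges ρ (hs.walks ht r) = (D.image fun d => s(d.1, d.2)).val := by
  have h1 : D.image (fun d => s(d.1, d.2)) = ((hs.walks ht r).erase [ρ]).image (lastEdge ρ) := by
    ext e
    simp only [Finset.mem_image]
    constructor
    · rintro ⟨⟨u, v⟩, hd, rfl⟩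
      have h2 : hs.graph.Adj (node (u, v)) (node (v, u)) := ⟨_, hd, rfl, rfl⟩
      have h3 := hs.head _ hd
      have h4 := hs.head _ (hs.symm _ hd)
      simp only [Prod.swap_prod_mk] at h4
      have aux : ∀ a b : N, rootWalk ht r h a = h a :: rootWalk ht r h b →
          rootWalk ht r h a ∈ (hs.walks ht r).erase [ρ] ∧
            lastEdge ρ (rootWalk ht r h a) = s(h b, h a) := by
        intro a b hab
        obtain ⟨t, h5⟩ := rootWalk_head ht r h b
        constructor
        · refine Finset.mem_erase.2 ⟨?_, hs.mem_walks ht r a⟩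
          rw [hab, h5]; simp
        · rw [hab, h5]; simp [lastEdge]
      rcases rootWalk_adj ht r h h2 with ⟨h5, -⟩ | ⟨h5, -⟩
      · refine ⟨_, (aux _ _ h5).1, ?_⟩
        rw [(aux _ _ h5).2, h3, h4, Sym2.eq_swap]
      · refine ⟨_, (aux _ _ h5).1, ?_⟩
        rw [(aux _ _ h5).2, h3, h4]
    · rintro ⟨p, hp, rfl⟩
      obtain ⟨h2, h3⟩ := Finset.mem_erase.1 hp
      obtain ⟨x, -, rfl⟩ := Finset.mem_image.1 h3
      have hne : x ≠ r := by
        rintro rfl; exact h2 (by rw [rootWalk_root, hr])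
      obtain ⟨y, -, h4⟩ := rootWalk_parent ht r h hne
      obtain ⟨t, h5⟩ := rootWalk_head ht r h y
      rw [h5] at h4
      obtain ⟨y', -, -, -, h6, -⟩ := hs.exists_dart_of_walk ht h4
      exact ⟨_, h6, by rw [h4]; simp [lastEdge]⟩
  rw [h1, walkEdges, Finset.image_val_of_injOn (hs.injOn_lastEdge_walks ht hr)]

end DartSystem

namespace IsWalkTree

variable {S : Finset (List V)} (hw : IsWalkTree G ρ σ S)
  (hinj : Set.InjOn (lastEdge ρ) (S.erase [ρ]))
include hw hinj

theorem isTree : (hw.dartSystem hinj).graph.IsTree :=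
  haveI : Nonempty S := ⟨⟨_, hw.root⟩⟩
  (hw.dartSystem hinj).isTree (hw.card_walkDarts hinj)

/-- The abstract tree built from a set of walks returns these walks, so invariants may be computed
in whichever description is convenient. -/
theorem rootWalk_eq_self (r : S) (hr : r.1 = [ρ]) (p : List V) (hp : p ∈ S) :
    rootWalk (hw.isTree hinj) r (fun x : S => x.1.headD ρ) ⟨p, hp⟩ = p := by
  induction p with
  | nil => exact absurd hp hw.nil
  | cons w p ih =>
    cases p with
    | nil =>
      have h1 : (⟨[w], hp⟩ : S) = r := Subtype.ext (hr.symm ▸ congrArg (fun a => [a]) (hw.single _ hp))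
      rw [h1, rootWalk_root, hr, hw.single _ hp]
      rfl
    | cons v t =>
      have h1 := hw.tail _ _ _ hp
      have h2 : (hw.dartSystem hinj).graph.Adj ⟨_, h1⟩ ⟨_, hp⟩ := by
        refine ⟨(w, v), mem_walkDarts.2 ⟨_, hw.into_child hp⟩, ?_, ?_⟩
        · exact (hw.nodeOf_eq_iff hinj ⟨_, hw.into_child hp⟩ _).2 (hw.into_child hp)
        · exact (hw.nodeOf_eq_iff hinj ⟨_, hw.into_parent hp⟩ _).2 (hw.into_parent hp)
      rcases rootWalk_adj (hw.isTree hinj) r _ h2 with h3 | h3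
      · rw [h3.1, ih h1]
        rfl
      · exfalso
        have h4 := h3.1
        rw [ih h1] at h4
        obtain ⟨t', h5⟩ := rootWalk_head (hw.isTree hinj) r (fun x : S => x.1.headD ρ) ⟨_, hp⟩
        rw [h5] at h4
        injection h4 with _ h4
        exact hw.back w v w t' (h4 ▸ hp) rfl

theorem walks_eq_self (r : S) (hr : r.1 = [ρ]) :
    (hw.dartSystem hinj).walks (hw.isTree hinj) r = S := by
  ext p
  simp only [DartSystem.walks, Finset.mem_image, Finset.mem_univ, true_and]
  constructor
  · rintro ⟨⟨x, hx⟩, rfl⟩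
    rwa [hw.rootWalk_eq_self hinj r hr]
  · intro hp
    exact ⟨⟨p, hp⟩, hw.rootWalk_eq_self hinj r hr p hp⟩

theorem nodeOf_root : (hw.nodeOf hw (σ, ρ)).1 = [ρ] := by
  have h1 := (hw.into_root (σ, ρ)).2 rfl
  rw [(hw.nodeOf_eq_iff hinj ⟨_, h1⟩ ⟨_, hw.root⟩).2 h1]

theorem sameNode_iff_nodeOf {d d' : V × V} (hd : d ∈ walkDarts S) (hd' : d' ∈ walkDarts S) :
    SameNode S d d' ↔ hw.nodeOf hw d = hw.nodeOf hw d' := by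
  have := (hw.dartSystem hinj).sameNode_walks (hw.isTree hinj) (hw.nodeOf hw (σ, ρ)) hd hd'
  rwa [hw.walks_eq_self hinj _ (hw.nodeOf_root hinj)] at this

end IsWalkTree

/-- An edge without an end in `P` is itself an item. An edge with an end in `P` has that end at a
unique node, which fixes the walk when both walks cross the edge in the same direction; opposite
directions would force a walk to backtrack. -/
theorem injOn_lastEdge_of_nodup (P : V → Prop) {S : Finset (List V)} (hw : IsWalkTree G ρ σ S)
    (hn : (items P ρ S).Nodup) : Set.InjOn (lastEdge ρ) (S.erase [ρ]) := by
  classical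
  rw [items, Multiset.nodup_add] at hn
  obtain ⟨hn1, hn2, -⟩ := hn
  have hv : ∀ p ∈ S, ∀ q ∈ S, P (p.headD ρ) → p.headD ρ = q.headD ρ → p = q := by
    intro p hp q hq h1 h2
    have h3 := Multiset.Nodup.of_map _ hn1
    rw [vertexItems] at h3
    refine Multiset.inj_on_of_nodup_map h3 p ?_ q ?_ h2
    · exact Finset.mem_filter.2 ⟨hp, Or.inl h1⟩
    · simp only [Finset.mem_val, Finset.mem_filter]
      exact ⟨hq, Or.inl (h2 ▸ h1)⟩
  have hcase : ∀ p ∈ S.erase [ρ], ∃ w v t, p = w :: v :: t := by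
    intro p hp
    obtain ⟨h1, h2⟩ := Finset.mem_erase.1 hp
    rcases hw.cases_mem h2 with h3 | h3
    · exact absurd h3 h1
    · exact h3
  intro p hp q hq hpq
  obtain ⟨w, v, t, rfl⟩ := hcase p hp
  obtain ⟨w', v', t', rfl⟩ := hcase q hq
  have hp' := Finset.mem_of_mem_erase hp
  have hq' := Finset.mem_of_mem_erase hq
  by_cases hP : ∀ a ∈ lastEdge ρ (w :: v :: t), ¬ P a
  · rw [walkEdges, Multiset.filter_map] at hn2
    refine Multiset.inj_on_of_nodup_map hn2 _ ?_ _ ?_ hpq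
    · exact Multiset.mem_filter.2 ⟨hp, hP⟩
    · exact Multiset.mem_filter.2 ⟨hq, by simpa only [Function.comp, hpq] using hP⟩
  · push Not at hP
    obtain ⟨a, h1, h2⟩ := hP
    simp only [lastEdge, List.tail_cons, List.headD_cons, Sym2.mem_iff] at h1
    simp only [lastEdge, List.tail_cons, List.headD_cons, Sym2.eq_iff] at hpq
    have tp := hw.tail _ _ _ hp'
    have tq := hw.tail _ _ _ hq'
    rcases hpq with ⟨rfl, rfl⟩ | ⟨rfl, rfl⟩
    · rcases h1 with rfl | rfl
      · rw [hv _ tp _ tq (by simpa using h2) (by simp)]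
      · exact hv _ hp' _ hq' (by simpa using h2) (by simp)
    · rcases h1 with rfl | rfl
      · have h3 := hv _ tp _ hq' (by simpa using h2) (by simp)
        injection h3 with _ h3
        subst h3
        exact absurd rfl (hw.back _ _ _ _ hp')
      · have h3 := hv _ hp' _ tq (by simpa using h2) (by simp)
        injection h3 with _ h3
        subst h3
        exact absurd rfl (hw.back _ _ _ _ hq')

/-- The vertex `v` is the image of two nodes. -/
def SplitVertex (S : Finset (List V)) (v : V) : Prop :=
  ∃ d ∈ walkDarts S, ∃ d' ∈ walkDarts S, d.2 = v ∧ d'.2 = v ∧ ¬ SameNode S d d'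

/-- Links between darts that do not pass through copies of `v`. -/
def LinkAvoiding (S : Finset (List V)) (v : V) (d d' : V × V) : Prop :=
  d ∈ walkDarts S ∧ d' ∈ walkDarts S ∧ (d' = d.swap ∨ (SameNode S d d' ∧ d.2 ≠ v))

/-- Two darts into copies of `v` that are connected without passing through copies of `v`. -/
def SwapCandidate (S : Finset (List V)) (v : V) (ef : (V × V) × (V × V)) : Prop :=
  ef.1 ∈ walkDarts S ∧ ef.2 ∈ walkDarts S ∧ ef.1.2 = v ∧ ef.2.2 = v ∧ ef.1 ≠ ef.2 ∧
    Relation.EqvGen (LinkAvoiding S v) ef.1 ef.2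

open scoped Classical in
/-- The chosen exchange of darts at a vertex that is the image of two nodes. -/
noncomputable def chosenSwap (ρ : V) (S : Finset (List V)) : Equiv.Perm (V × V) :=
  haveI : Nonempty V := ⟨ρ⟩
  let ef := Classical.epsilon (SwapCandidate S (Classical.epsilon (SplitVertex S)))
  Equiv.swap ef.1 ef.2

/-- The partner arises by exchanging two darts into a vertex `v` with several nodes, chosen to be
joined without passing through copies of `v`. The exchange keeps the darts, the number of darts at
each node, the set of split vertices and the links avoiding `v`. The choice depends on these data
alone, so the partner chooses the same exchange. -/
theorem exists_partner (P : V → Prop) {S : Finset (List V)} (hw : IsWalkTree G ρ σ S)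
    (hn : (items P ρ S).Nodup) (hsplit : ∃ v, SplitVertex S v) :
    ∃ S', IsWalkTree G ρ σ S' ∧ S'.card = S.card ∧ leafCount S' = leafCount S ∧
      walkEdges ρ S' = walkEdges ρ S ∧ items P ρ S' = items P ρ S ∧ (∃ v, SplitVertex S' v) ∧
      walkDarts S' = walkDarts S ∧ chosenSwap ρ S' = chosenSwap ρ S ∧ S' ≠ S ∧
      (∀ d, d ∈ walkDarts S ↔ chosenSwap ρ S d ∈ walkDarts S) ∧
      ∀ d ∈ walkDarts S, ∀ d' ∈ walkDarts S,
        (SameNode S' d d' ↔ SameNode S (chosenSwap ρ S d) (chosenSwap ρ S d')) := by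
  classical
  have : Nonempty V := ⟨ρ⟩
  have hinj := injOn_lastEdge_of_nodup P hw hn
  have hs := hw.dartSystem hinj
  have hc := hw.card_walkDarts hinj
  have hS := hw.walks_eq_self hinj _ (hw.nodeOf_root hinj)
  set v := Classical.epsilon (SplitVertex S) with hv
  have hsv : SplitVertex S v := Classical.epsilon_spec hsplit
  have hlink : ∀ u, LinkAvoiding S u =
      DartLink (walkDarts S) (hw.nodeOf hw) (fun w => w ≠ u) := by
    intro u
    funext d d'
    refine propext (and_congr_right fun h1 => and_congr_right fun h2 => or_congr_right ?_)
    rw [hw.sameNode_iff_nodeOf hinj h1 h2]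
  have hcand : ∃ ef, SwapCandidate S v ef := by
    obtain ⟨d, hd, d', hd', h1, h2, h3⟩ := hsv
    rw [hw.sameNode_iff_nodeOf hinj hd hd'] at h3
    obtain ⟨e, he, f, hf, h4, h5, h6, h7⟩ := hs.exists_adjacent_copies hd hd' h1 h2 h3
    exact ⟨(e, f), he, hf, h4, h5, h6, by rw [hlink]; exact h7⟩
  obtain ⟨ef, hef⟩ : ∃ ef, ef = Classical.epsilon (SwapCandidate S v) := ⟨_, rfl⟩
  have hch : SwapCandidate S v ef := hef ▸ Classical.epsilon_spec hcand
  have hτ : chosenSwap ρ S = Equiv.swap ef.1 ef.2 := by rw [chosenSwap, ← hv, ← hef]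
  obtain ⟨e, f⟩ := ef
  obtain ⟨he, hf, hev, hfv, hne, hK⟩ := hch
  simp only at he hf hev hfv hne hK hτ
  rw [hlink, ← hev] at hK
  have hs' := hs.swap he hf (hev.trans hfv.symm) hK
  have hnode := hs.node_ne hc he hf hne (hev.trans hfv.symm) hK
  have : Nonempty S := ⟨⟨_, hw.root⟩⟩
  have ht' := hs'.isTree hc
  have hadj : ∀ d ∈ walkDarts S, G.Adj d.1 d.2 := by
    intro d hd
    obtain ⟨p, hp⟩ := mem_walkDarts.1 hd
    rcases hw.exists_of_into hp with ⟨t, rfl, h2⟩ | ⟨t, rfl, h2⟩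
    · exact hw.adj _ _ _ h2
    · exact (hw.adj _ _ _ h2).symm
  have hρ : (σ, ρ) ∈ walkDarts S := mem_walkDarts.2 ⟨_, (hw.into_root _).2 rfl⟩
  have hone : ∀ d ∈ walkDarts S, d.2 = ρ → d.1 = σ := by
    rintro ⟨u, v⟩ hd rfl
    obtain ⟨p, hp⟩ := mem_walkDarts.1 hd
    rcases hw.exists_of_into hp with ⟨t, rfl, h2⟩ | ⟨t, rfl, h2⟩
    · exact absurd rfl (hw.ret _ _ _ h2)
    · simp only at h2
      rcases hw.cases_mem (hw.tail _ _ _ h2) with h3 | ⟨a, b, c, h3⟩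
      · injection h3 with _ h3
        subst h3
        exact hw.two _ h2
      · injection h3 with h4 h3
        subst h3 h4
        exact absurd rfl (hw.ret _ _ _ (hw.tail _ _ _ h2))
  have hmem : ∀ d, d ∈ walkDarts S ↔ Equiv.swap e f d ∈ walkDarts S := by
    intro d
    rcases eq_or_ne d e with rfl | h3
    · simp [he, hf]
    rcases eq_or_ne d f with rfl | h4
    · simp [he, hf]
    rw [Equiv.swap_apply_of_ne_of_ne h3 h4]
  have hhead : ∀ d, (Equiv.swap e f d).2 = d.2 := by
    intro d
    rcases eq_or_ne d e with rfl | h3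
    · simp [hev, hfv]
    rcases eq_or_ne d f with rfl | h4
    · simp [hev, hfv]
    rw [Equiv.swap_apply_of_ne_of_ne h3 h4]
  have hfix : ∀ d, d.2 ≠ v → Equiv.swap e f d = d := by
    intro d hd
    refine Equiv.swap_apply_of_ne_of_ne ?_ ?_
    · rintro rfl; exact hd hev
    · rintro rfl; exact hd hfv
  set S' := hs'.walks ht' (hw.nodeOf hw (Equiv.swap e f (σ, ρ))) with hS'
  have hw' : IsWalkTree G ρ σ S' := hs'.isWalkTree_walks ht' hadj hρ hone
  have hr : (hw.nodeOf hw (σ, ρ)).1.headD ρ = ρ := by rw [hw.nodeOf_root hinj]; rfl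
  have hr' : (hw.nodeOf hw (Equiv.swap e f (σ, ρ))).1.headD ρ = ρ := hs'.head _ hρ
  have hD : walkDarts S' = walkDarts S := hs'.walkDarts_walks ht' _
  have hker : ∀ d ∈ walkDarts S, ∀ d' ∈ walkDarts S,
      (SameNode S' d d' ↔ SameNode S (Equiv.swap e f d) (Equiv.swap e f d')) := by
    intro d hd d' hd'
    rw [hs'.sameNode_walks ht' _ hd hd',
      hw.sameNode_iff_nodeOf hinj ((hmem d).1 hd) ((hmem d').1 hd')]
  -- The exchange permutes the darts, so each node keeps its number of darts.
  have hleaf : ∀ x, DartLeaf (walkDarts S) (fun d => hw.nodeOf hw (Equiv.swap e f d)) x ↔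
      DartLeaf (walkDarts S) (hw.nodeOf hw) x := by
    intro x
    constructor
    · intro h1 d hd d' hd' h2 h3
      have := h1 (Equiv.swap e f d) ((hmem d).1 hd) (Equiv.swap e f d') ((hmem d').1 hd')
        (by simpa using h2) (by simpa using h3)
      simpa using this
    · intro h1 d hd d' hd' h2 h3
      have := h1 _ ((hmem d).1 hd) _ ((hmem d').1 hd') h2 h3
      simpa using this
  have hvi : vertexItems P ρ S' = vertexItems P ρ S := by
    conv_rhs => rw [← hS]
    rw [hS', hs'.vertexItems_walks ht', hs.vertexItems_walks (hw.isTree hinj)]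
    simp only [hleaf]
  have hedge : walkEdges ρ S' = walkEdges ρ S := by
    conv_rhs => rw [← hS]
    rw [hS', hs'.walkEdges_walks ht' hr', hs.walkEdges_walks (hw.isTree hinj) hr]
  have hsplit' : ∀ u, SplitVertex S u → SplitVertex S' u := by
    rintro u ⟨d, hd, d', hd', h1, h2, h3⟩
    refine ⟨Equiv.swap e f d, hD ▸ (hmem d).1 hd, Equiv.swap e f d', hD ▸ (hmem d').1 hd',
      (hhead _).trans h1, (hhead _).trans h2, ?_⟩
    rw [hker _ ((hmem d).1 hd) _ ((hmem d').1 hd')]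
    simpa using h3
  -- The next three facts show that both uses of `Classical.epsilon` in `chosenSwap` are applied to
  -- the same predicates for `S'` as for `S`.
  have hsplit'' : SplitVertex S' = SplitVertex S := by
    funext u
    refine propext ⟨?_, hsplit' u⟩
    rintro ⟨d, hd, d', hd', h1, h2, h3⟩
    rw [hD] at hd hd'
    refine ⟨Equiv.swap e f d, (hmem d).1 hd, Equiv.swap e f d', (hmem d').1 hd',
      (hhead _).trans h1, (hhead _).trans h2, ?_⟩
    rwa [← hker d hd d' hd']
  have hlink' : LinkAvoiding S' v = LinkAvoiding S v := by
    funext d d'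
    rw [LinkAvoiding, LinkAvoiding, hD]
    refine propext (and_congr_right fun h1 => and_congr_right fun h2 => or_congr_right ?_)
    rw [hker d h1 d' h2]
    constructor
    · rintro ⟨h3, h4⟩
      have h5 : d'.2 ≠ v := by
        have := h3.mem.2.2
        rw [hhead, hhead] at this
        exact this ▸ h4
      rw [hfix d h4, hfix d' h5] at h3
      exact ⟨h3, h4⟩
    · rintro ⟨h3, h4⟩
      refine ⟨?_, h4⟩
      have h5 : d'.2 ≠ v := h3.mem.2.2 ▸ h4
      rwa [hfix d h4, hfix d' h5]
  have hchosen : chosenSwap ρ S' = chosenSwap ρ S := by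
    have : SwapCandidate S' v = SwapCandidate S v := by
      funext ef
      rw [SwapCandidate, SwapCandidate, hD, hlink']
    rw [chosenSwap, chosenSwap, hsplit'', ← hv, this]
  refine ⟨S', hw', ?_, ?_, hedge, ?_, ⟨v, hsplit' v hsv⟩, hD, hchosen, ?_, ?_, ?_⟩
  · rw [hS', hs'.card_walks, Fintype.card_coe]
  · conv_rhs => rw [← hS]
    rw [hS', hs'.leafCount_walks ht', hs.leafCount_walks (hw.isTree hinj)]
    simp only [hleaf]
  · rw [items, items, hvi, hedge]
  -- If nothing changed, any other dart at the node of `e` would also be at the node of `f`, and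
  -- vice versa. So `e` and `f` are alone at their nodes, which are then two different leaves over
  -- one vertex and repeat an item.
  · intro heq
    have hk : ∀ d ∈ walkDarts S, ∀ d' ∈ walkDarts S, (hw.nodeOf hw d = hw.nodeOf hw d' ↔
        hw.nodeOf hw (Equiv.swap e f d) = hw.nodeOf hw (Equiv.swap e f d')) := by
      intro d hd d' hd'
      rw [← hw.sameNode_iff_nodeOf hinj hd hd',
        ← hw.sameNode_iff_nodeOf hinj ((hmem d).1 hd) ((hmem d').1 hd'), ← hker d hd d' hd', heq]
    have hsing : ∀ g ∈ walkDarts S,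
        (hw.nodeOf hw g = hw.nodeOf hw e → g = e) ∧ (hw.nodeOf hw g = hw.nodeOf hw f → g = f) := by
      intro g hg
      constructor
      · intro h1
        by_contra h2
        have h3 : g ≠ f := by rintro rfl; exact hnode h1.symm
        have h4 := (hk g hg e he).1 h1
        rw [Equiv.swap_apply_of_ne_of_ne h2 h3, Equiv.swap_apply_left, h1] at h4
        exact hnode h4
      · intro h1
        by_contra h2
        have h3 : g ≠ e := by rintro rfl; exact hnode h1
        have h4 := (hk g hg f hf).1 h1
        rw [Equiv.swap_apply_of_ne_of_ne h3 h2, Equiv.swap_apply_right, h1] at h4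
        exact hnode h4.symm
    have hl1 : DartLeaf (walkDarts S) (hw.nodeOf hw) (hw.nodeOf hw e) := by
      intro d hd d' hd' h1 h2
      rw [(hsing d hd).1 h1, (hsing d' hd').1 h2]
    have hl2 : DartLeaf (walkDarts S) (hw.nodeOf hw) (hw.nodeOf hw f) := by
      intro d hd d' hd' h1 h2
      rw [(hsing d hd).2 h1, (hsing d' hd').2 h2]
    rw [items, Multiset.nodup_add] at hn
    have hn1 := Multiset.Nodup.of_map _ hn.1
    rw [← hS, hs.vertexItems_walks (hw.isTree hinj)] at hn1
    refine hnode (Multiset.inj_on_of_nodup_map hn1 _ ?_ _ ?_ ?_)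
    · exact Finset.mem_filter.2 ⟨Finset.mem_univ _, Or.inr hl1⟩
    · exact Finset.mem_filter.2 ⟨Finset.mem_univ _, Or.inr hl2⟩
    · rw [hs.head e he, hs.head f hf, hev, hfv]
  · rw [hτ]; exact hmem
  · rw [hτ]; exact hker

/-- If no vertex is the image of two nodes, then the walks form a subtree of the graph. -/
theorem hasKLTree_of_not_split {S : Finset (List V)} (hw : IsWalkTree G ρ σ S)
    (hinj : Set.InjOn (lastEdge ρ) (S.erase [ρ])) (hsplit : ¬ ∃ v, SplitVertex S v) :
    HasKLTree G S.card (leafCount S) := by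
  classical
  have hs := hw.dartSystem hinj
  set h : S → V := fun x => x.1.headD ρ with hh
  set D := walkDarts S with hD
  have hadj : ∀ d ∈ D, G.Adj d.1 d.2 := by
    intro d hd
    obtain ⟨p, hp⟩ := mem_walkDarts.1 hd
    rcases hw.exists_of_into hp with ⟨t, rfl, h2⟩ | ⟨t, rfl, h2⟩
    · exact hw.adj _ _ _ h2
    · exact (hw.adj _ _ _ h2).symm
  have hnode : ∀ d ∈ D, ∀ d' ∈ D, d.2 = d'.2 → hw.nodeOf hw d = hw.nodeOf hw d' := by
    intro d hd d' hd' h1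
    rw [← hw.sameNode_iff_nodeOf hinj hd hd']
    by_contra h2
    exact hsplit ⟨_, d, hd, d', hd', rfl, h1.symm, h2⟩
  -- Every node receives a dart, and darts with the same head now share their node, so the nodes may
  -- be identified with vertices of `G`.
  have hhinj : Function.Injective h := by
    intro x y hxy
    obtain ⟨d, hd, rfl⟩ := hs.surj x
    obtain ⟨d', hd', rfl⟩ := hs.surj y
    refine hnode d hd d' hd' ?_
    rw [← hs.head d hd, ← hs.head d' hd']
    exact hxy
  have hinto : ∀ d (x : S), Into S d x ↔ d ∈ D ∧ d.2 = h x := by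
    intro d x
    constructor
    · intro h1
      have h2 := mem_walkDarts.2 ⟨_, h1⟩
      refine ⟨h2, ?_⟩
      rw [← hs.head d h2, (hw.nodeOf_eq_iff hinj ⟨_, h1⟩ x).2 h1]
    · rintro ⟨h1, h2⟩
      rw [← hw.nodeOf_eq_iff hinj (mem_walkDarts.1 h1)]
      exact hhinj ((hs.head d h1).trans h2)
  let T : G.Subgraph :=
    { verts := Set.range h
      Adj := fun u v => (u, v) ∈ D
      adj_sub := fun h1 => hadj _ h1
      edge_vert := fun {u v} h1 => ⟨hw.nodeOf hw (v, u), hs.head _ (hs.symm _ h1)⟩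
      symm := ⟨fun u v h1 => hs.symm _ h1⟩ }
  have hiso : hs.graph ≃g T.coe :=
    { toEquiv := Equiv.ofInjective h hhinj
      map_rel_iff' := by
        intro x y
        rw [hs.graph_adj_iff]
        change (h x, h y) ∈ D ↔ _
        constructor
        · intro h1
          exact ⟨hs.symm _ h1, hhinj (hs.head _ (hs.symm _ h1)), hhinj (hs.head _ h1)⟩
        · intro h1
          exact hs.symm _ h1.1 }
  refine ⟨T, ?_, ?_, ?_⟩
  · exact (SimpleGraph.Iso.isTree_iff hiso).1 (hw.isTree hinj)
  · change (Set.range h).ncard = _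
    rw [← Set.image_univ, Set.ncard_image_of_injective _ hhinj, Set.ncard_univ,
      Nat.card_eq_fintype_card, Fintype.card_coe]
  · have h1 : {v ∈ T.verts | (T.neighborSet v).ncard = 1} = h '' {x : S | LeafNode S x.1} := by
      ext v
      constructor
      · rintro ⟨⟨x, rfl⟩, h2⟩
        refine ⟨x, ?_, rfl⟩
        obtain ⟨u, hu⟩ := Set.ncard_eq_one.1 h2
        have key : ∀ d, Into S d x → d = (u, h x) := by
          intro d hd
          obtain ⟨h3, h4⟩ := (hinto d x).1 hd
          have h5 : d.1 ∈ T.neighborSet (h x) := by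
            have := hs.symm _ h3
            rw [← h4]
            exact this
          rw [hu] at h5
          exact Prod.ext h5 h4
        intro d d' hd hd'
        rw [key d hd, key d' hd']
      · rintro ⟨x, hx, rfl⟩
        refine ⟨⟨x, rfl⟩, ?_⟩
        obtain ⟨d, hd, hdx⟩ := hs.surj x
        have hd2 : d.2 = h x := by rw [← hdx]; exact (hs.head d hd).symm
        rw [Set.ncard_eq_one]
        refine ⟨d.1, ?_⟩
        ext u
        simp only [Set.mem_singleton_iff]
        constructor
        · intro hu
          have h3 : (u, h x) ∈ D := hs.symm _ hu
          exact congrArg Prod.fst (hx _ _ ((hinto _ x).2 ⟨h3, rfl⟩) ((hinto d x).2 ⟨hd, hd2⟩))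
        · rintro rfl
          change (h x, d.1) ∈ D
          rw [← hd2]
          exact hs.symm _ hd
    rw [h1, Set.ncard_image_of_injective _ hhinj, leafCount]
    rw [← Set.ncard_coe_finset, ← Set.ncard_image_of_injective _ Subtype.val_injective]
    congr 1
    ext p
    simp [and_comm]

/-- The function `φ` disposes of trees with a repeated item. In the absence of a `(k,l)`-tree each
remaining tree has a split vertex, hence a different partner with the same edges and items, and the
two terms cancel in characteristic 2. -/
theorem sum_walkTrees_eq_zero {A : Type*} [CommRing A] [CharP A 2] (P : V → Prop) {k l r : ℕ}
    (hno : ¬ HasKLTree G k l) (O : Finset (Finset (List V)))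
    (hO : ∀ S, S ∈ O ↔ IsWalkTree G ρ σ S ∧ S.card = k ∧ leafCount S = l ∧
      (items P ρ S).card = r)
    (x : Sym2 V → A) (φ : Multiset (Sym2 V) → A) (hφ : ∀ m, m.card = r → ¬ m.Nodup → φ m = 0) :
    ∑ S ∈ O, ((walkEdges ρ S).map x).prod * φ (items P ρ S) = 0 := by
  classical
  rw [← Finset.sum_filter_add_sum_filter_not O fun S => (items P ρ S).Nodup]
  rw [Finset.sum_eq_zero (s := O.filter fun S => ¬ (items P ρ S).Nodup), add_zero]
  swap
  · intro S hS
    obtain ⟨h1, h2⟩ := Finset.mem_filter.1 hS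
    rw [hφ _ ((hO S).1 h1).2.2.2 h2, mul_zero]
  have hsp : ∀ S ∈ O.filter (fun S => (items P ρ S).Nodup), ∃ v, SplitVertex S v := by
    intro S hS
    obtain ⟨h1, h2⟩ := Finset.mem_filter.1 hS
    obtain ⟨hw, h3, h4, -⟩ := (hO S).1 h1
    by_contra h5
    have := hasKLTree_of_not_split hw (injOn_lastEdge_of_nodup P hw h2) h5
    rw [h3, h4] at this
    exact hno this
  have hex : ∀ S (hS : S ∈ O.filter (fun S => (items P ρ S).Nodup)), _ := fun S hS =>
    exists_partner P ((hO S).1 (Finset.mem_filter.1 hS).1).1 (Finset.mem_filter.1 hS).2 (hsp S hS)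
  have hmem : ∀ S (hS : S ∈ O.filter (fun S => (items P ρ S).Nodup)),
      (hex S hS).choose ∈ O.filter (fun S => (items P ρ S).Nodup) := by
    intro S hS
    obtain ⟨h1, h2, h3, h4, h5, h6, h7, h8, h9, h10, h11⟩ := (hex S hS).choose_spec
    have hS' := Finset.mem_filter.1 hS
    have h12 := (hO S).1 hS'.1
    refine Finset.mem_filter.2 ⟨(hO _).2 ⟨h1, ?_, ?_, ?_⟩, ?_⟩
    · rw [h2, h12.2.1]
    · rw [h3, h12.2.2.1]
    · rw [h5, h12.2.2.2]
    · rw [h5]; exact hS'.2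
  refine Finset.sum_involution (fun S hS => (hex S hS).choose) ?_ ?_ hmem ?_
  · intro S hS
    obtain ⟨h1, h2, h3, h4, h5, h6, h7, h8, h9, h10, h11⟩ := (hex S hS).choose_spec
    rw [h4, h5]
    exact CharTwo.add_self_eq_zero _
  · intro S hS _
    obtain ⟨h1, h2, h3, h4, h5, h6, h7, h8, h9, h10, h11⟩ := (hex S hS).choose_spec
    exact h9
  · intro S hS
    obtain ⟨h1, h2, h3, h4, h5, h6, h7, h8, h9, h10, h11⟩ := (hex S hS).choose_spec
    have hS1 := hmem S hS
    set S1 := (hex S hS).choose with hS1def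
    obtain ⟨g1, g2, g3, g4, g5, g6, g7, g8, g9, g10, g11⟩ := (hex S1 hS1).choose_spec
    set S2 := (hex S1 hS1).choose with hS2def
    have hwS := ((hO S).1 (Finset.mem_filter.1 hS).1).1
    have hnS := (Finset.mem_filter.1 hS).2
    -- Both exchanges are the same transposition. Applied twice it restores which darts share a
    -- node, and this determines the tree.
    refine g1.eq_of_sameNode (injOn_lastEdge_of_nodup P g1 ?_) hwS
      (injOn_lastEdge_of_nodup P hwS hnS) ?_ ?_
    · rw [g5, h5]; exact hnS
    · rw [g7, h7]
    · intro d hd d' hd'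
      rw [g7] at hd hd'
      rw [g11 d hd d' hd', h8]
      rw [h7] at hd hd'
      rw [h11 _ ((h10 d).1 hd) _ ((h10 d').1 hd')]
      have hinv : ∀ d, chosenSwap ρ S (chosenSwap ρ S d) = d := by
        intro d; simp [chosenSwap]
      rw [hinv, hinv]

end TreeWalks


/-! ### The tree of walks of a subtree -/

section SubtreeWalks

variable {V : Type*} [Fintype V] [DecidableEq V] {G : SimpleGraph V}

/-- In an honest subtree a step along an edge leads to the parent or to a child. Backtracking is
forbidden, so every step leads away from the root and the walk is the path to a node. -/
theorem subset_walks_of_injective {N : Type*} [Fintype N] {D : Finset (V × V)}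
    {node : V × V → N} {h : N → V} (hs : DartSystem D node h) (ht : hs.graph.IsTree)
    (hh : Function.Injective h) {ρ σ : V} {r : N} (hr : h r = ρ) {S : Finset (List V)}
    (hw : IsWalkTree G ρ σ S) (hE : ∀ e ∈ walkEdges ρ S, e ∈ D.image fun d => s(d.1, d.2)) :
    S ⊆ hs.walks ht r := by
  intro p
  induction p with
  | nil => intro hp; exact absurd hp hw.nil
  | cons w p ih =>
    intro hp
    cases p with
    | nil =>
      rw [hw.single w hp, ← hr, ← rootWalk_root ht r h]
      exact hs.mem_walks ht r r
    | cons v t =>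
      obtain ⟨x, -, hx⟩ := Finset.mem_image.1 (ih (hw.tail _ _ _ hp))
      have hxv : h x = v := by
        obtain ⟨t', h1⟩ := rootWalk_head ht r h x
        rw [hx] at h1; injection h1 with h1 _; exact h1.symm
      have h1 : s(v, w) ∈ D.image fun d => s(d.1, d.2) :=
        hE _ (Multiset.mem_map.2 ⟨_, hw.mem_erase_root.2 hp, rfl⟩)
      have h2 : (w, v) ∈ D := by
        obtain ⟨⟨a, b⟩, hd, h3⟩ := Finset.mem_image.1 h1
        simp only [Sym2.eq_iff] at h3
        rcases h3 with ⟨rfl, rfl⟩ | ⟨rfl, rfl⟩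
        · exact hs.symm _ hd
        · exact hd
      have h3 : hs.graph.Adj x (node (v, w)) :=
        ⟨_, h2, hh ((hs.head _ h2).trans hxv.symm), rfl⟩
      have h4 : h (node (v, w)) = w := hs.head _ (hs.symm _ h2)
      rcases rootWalk_adj ht r h h3 with h5 | h5
      · rw [h4, hx] at h5
        rw [← h5.1]
        exact hs.mem_walks ht r _
      · exfalso
        obtain ⟨t', h6⟩ := rootWalk_head ht r h (node (v, w))
        have h7 := h5.1
        rw [hx, h6, h4] at h7
        injection h7 with _ h7
        exact hw.back w v w t' (h7 ▸ hp) rfl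

-- A tree with at least two vertices has a leaf, which serves as root. The last clause says that the
-- edge set singles out this tree among all trees of walks with the same root, stem and size; it is
-- what later isolates one term of the sum.
open scoped Classical in
theorem exists_walkTree {k l : ℕ} (hk : 2 ≤ k) (h : HasKLTree G k l) :
    ∃ (ρ σ : V) (S : Finset (List V)) (vs ls : Finset V) (E : Finset (Sym2 V)),
      IsWalkTree G ρ σ S ∧ S.card = k ∧ leafCount S = l ∧ vs.card = k ∧ ls ⊆ vs ∧ ls.card = l ∧
      E.card + 1 = k ∧ (∀ e ∈ E, e ∈ G.edgeSet) ∧ walkEdges ρ S = E.val ∧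
      (∀ P : V → Prop, vertexItems P ρ S = (vs.filter fun v => P v ∨ v ∈ ls).val) ∧
      ∀ S', IsWalkTree G ρ σ S' → S'.card = k → (∀ e ∈ walkEdges ρ S', e ∈ E) → S' = S := by
  obtain ⟨T, hT, hTk, hTl⟩ := h
  have hNk : Fintype.card T.verts = k := by
    rw [← hTk, ← Nat.card_coe_set_eq, Nat.card_eq_fintype_card]
  have : Nontrivial T.verts := Fintype.one_lt_card_iff_nontrivial.1 (by omega)
  obtain ⟨r, s, hrs, hs1⟩ : ∃ r, ∃! w, T.coe.Adj r w := by
    obtain ⟨r, hr⟩ := hT.exists_vert_degree_one_of_nontrivial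
    refine ⟨r, (@SimpleGraph.degree_eq_one_iff_existsUnique_adj _ T.coe r (_)).1 hr⟩
  let D : Finset (V × V) := Finset.univ.filter fun d => T.Adj d.1 d.2
  have hD : ∀ d, d ∈ D ↔ T.Adj d.1 d.2 := by simp [D]
  -- The default value `r` is irrelevant: darts of the subtree have their heads in it.
  let node : V × V → T.verts := fun d => if h : d.2 ∈ T.verts then ⟨d.2, h⟩ else r
  have hnode : ∀ d ∈ D, (node d).1 = d.2 := by
    intro d hd
    have := T.edge_vert ((hD d).1 hd).symm
    simp [node, this]
  have hnode' : ∀ {u v : T.verts}, (u.1, v.1) ∈ D → node (u.1, v.1) = v :=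
    fun h1 => Subtype.ext (hnode _ h1)
  have hswap : ∀ d ∈ D, d.swap ∈ D := fun d hd => (hD _).2 ((hD d).1 hd).symm
  have hex : ∀ x : T.verts, ∃ y : T.verts, T.Adj x y := by
    intro x
    obtain ⟨y, hy⟩ := hT.connected.preconnected.exists_adj_of_nontrivial x
    exact ⟨y, hy⟩
  have hs : DartSystem D node Subtype.val := by
    refine ⟨hswap, hnode, ?_, ?_, ?_⟩
    · intro d hd; exact ((hD d).1 hd).ne
    · intro x
      obtain ⟨y, hy⟩ := hex x
      exact ⟨(y, x), (hD _).2 hy.symm, hnode' ((hD _).2 hy.symm)⟩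
    · have key : ∀ {x y : T.verts} (_ : T.coe.Walk x y), ∀ d ∈ D, ∀ d' ∈ D, node d = x →
          node d' = y → Relation.EqvGen (DartLink D node fun _ => True) d d' := by
        intro x y p
        induction p with
        | nil =>
          intro d hd d' hd' h1 h2
          exact .rel _ _ ⟨hd, hd', Or.inr ⟨h1.trans h2.symm, trivial⟩⟩
        | @cons x z y hxz p ih =>
          intro d hd d' hd' h1 h2
          have h3 : (z.1, x.1) ∈ D := (hD _).2 (T.symm.symm _ _ hxz)
          have h4 := hswap _ h3
          refine .trans _ _ _ (.rel _ (z.1, x.1) ⟨hd, h3, Or.inr ⟨?_, trivial⟩⟩)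
            (.trans _ _ _ (.rel _ (x.1, z.1) ⟨h3, h4, Or.inl rfl⟩) (ih _ h4 d' hd' ?_ h2))
          · rw [h1, hnode' h3]
          · exact hnode' h4
      intro d hd d' hd'
      obtain ⟨p⟩ := hT.connected.preconnected (node d) (node d')
      exact key p d hd d' hd' rfl rfl
  have hgraph : hs.graph = T.coe := by
    ext x y
    rw [hs.graph_adj_iff]
    constructor
    · rintro ⟨h1, -⟩
      exact ((hD _).1 h1).symm
    · intro h1
      have h2 : (y.1, x.1) ∈ D := (hD _).2 (T.symm.symm _ _ h1)
      exact ⟨h2, hnode' h2, hnode' (hswap _ h2)⟩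
  have ht : hs.graph.IsTree := hgraph ▸ hT
  have hρ : (s.1, r.1) ∈ D := (hD _).2 (T.symm.symm _ _ hrs)
  have hone : ∀ d ∈ D, d.2 = r.1 → d.1 = s.1 := by
    rintro ⟨u, v⟩ hd rfl
    have h1 := (hD _).1 hd
    exact congrArg Subtype.val (hs1 ⟨u, T.edge_vert h1⟩ h1.symm)
  have hw := hs.isWalkTree_walks (G := G) ht (fun d hd => ((hD d).1 hd).adj_sub) hρ hone
  rw [hnode' hρ] at hw
  have hcard : (hs.walks ht r).card = k := by rw [hs.card_walks, hNk]
  have hleaf : ∀ x : T.verts, DartLeaf D node x ↔ (T.neighborSet x.1).ncard = 1 := by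
    intro x
    obtain ⟨y, hy⟩ := hex x
    have hyD : (y.1, x.1) ∈ D := (hD _).2 hy.symm
    rw [Set.ncard_eq_one]
    constructor
    · intro h1
      refine ⟨y.1, ?_⟩
      ext u
      simp only [Set.mem_singleton_iff, SimpleGraph.Subgraph.mem_neighborSet]
      constructor
      · intro hu
        have h2 : (u, x.1) ∈ D := (hD _).2 hu.symm
        exact congrArg Prod.fst (h1 _ h2 _ hyD (Subtype.ext (hnode _ h2)) (hnode' hyD))
      · rintro rfl; exact hy
    · rintro ⟨u, hu⟩ d hd d' hd' h1 h2
      have aux : ∀ d ∈ D, node d = x → d = (u, x.1) := by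
        intro d hd h1
        have h3 : d.2 = x.1 := by rw [← h1, hnode d hd]
        have h4 : d.1 ∈ T.neighborSet x.1 := by
          rw [SimpleGraph.Subgraph.mem_neighborSet, ← h3]
          exact ((hD d).1 hd).symm
        rw [hu] at h4
        exact Prod.ext h4 h3
      rw [aux d hd h1, aux d' hd' h2]
  have hlc : (Finset.univ.filter fun x => DartLeaf D node x).card = l := by
    rw [← hTl, ← Set.ncard_coe_finset, ← Set.ncard_image_of_injective _ Subtype.val_injective]
    congr 1
    ext v
    simp [hleaf, and_comm]
  refine ⟨r.1, s.1, hs.walks ht r, (Finset.univ : Finset T.verts).image Subtype.val,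
    (Finset.univ.filter fun x => DartLeaf D node x).image Subtype.val,
    D.image fun d => s(d.1, d.2), hw, hcard, ?_, ?_, ?_, ?_, ?_, ?_, ?_, ?_, ?_⟩
  · rw [hs.leafCount_walks ht, hlc]
  · rw [Finset.card_image_of_injective _ Subtype.val_injective, Finset.card_univ, hNk]
  · exact Finset.image_subset_image (Finset.filter_subset _ _)
  · rw [Finset.card_image_of_injective _ Subtype.val_injective, hlc]
  · rw [Finset.card_def, ← hs.walkEdges_walks ht rfl, walkEdges, Multiset.card_map,
      ← Finset.card_def, Finset.card_erase_of_mem hw.root, hcard]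
    omega
  · intro e he
    obtain ⟨d, hd, rfl⟩ := Finset.mem_image.1 he
    exact ((hD d).1 hd).adj_sub
  · exact hs.walkEdges_walks ht rfl
  · intro P
    rw [hs.vertexItems_walks ht, ← Finset.image_val_of_injOn Subtype.val_injective.injOn]
    congr 1
    ext v
    simp only [Finset.mem_image, Finset.mem_filter, Finset.mem_univ, true_and]
    constructor
    · rintro ⟨x, h1, rfl⟩
      refine ⟨⟨x, rfl⟩, h1.imp_right fun h2 => ⟨x, h2, rfl⟩⟩
    · rintro ⟨⟨x, rfl⟩, h1⟩
      refine ⟨x, h1.imp_right ?_, rfl⟩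
      rintro ⟨y, h2, h3⟩
      rwa [← Subtype.ext h3]
  · intro S' hS' hk' hE
    refine Finset.eq_of_subset_of_card_le
      (subset_walks_of_injective hs ht Subtype.val_injective rfl hS' hE) ?_
    rw [hcard, hk']

end SubtreeWalks


/-! ### Sums over families of walks -/

section WalkFamily

set_option linter.unusedSectionVars false

variable {V : Type*} [Fintype V] [DecidableEq V]

/-- The sets of walks extending `p` by less than `d` steps that are closed under removing steps down
to `p`. -/
def walkFamily : ℕ → List V → Finset (Finset (List V))
  | 0, _ => ∅
  | d + 1, p => (Fintype.piFinset fun w => insert ∅ (walkFamily d (w :: p))).image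
      fun g => insert p (Finset.univ.biUnion g)

theorem mem_walkFamily_succ {d : ℕ} {p : List V} {S : Finset (List V)} :
    S ∈ walkFamily (d + 1) p ↔ ∃ g : V → Finset (List V),
      (∀ w, g w = ∅ ∨ g w ∈ walkFamily d (w :: p)) ∧ insert p (Finset.univ.biUnion g) = S := by
  simp [walkFamily]

theorem self_mem_of_mem_walkFamily {d : ℕ} {p : List V} {S : Finset (List V)}
    (h : S ∈ walkFamily d p) : p ∈ S := by
  cases d with
  | zero => simp [walkFamily] at h
  | succ d =>
    obtain ⟨g, -, rfl⟩ := mem_walkFamily_succ.1 h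
    exact Finset.mem_insert_self _ _

theorem suffix_of_mem_walkFamily {d : ℕ} {p : List V} {S : Finset (List V)}
    (h : S ∈ walkFamily d p) : ∀ q ∈ S, p <:+ q := by
  induction d generalizing p S with
  | zero => simp [walkFamily] at h
  | succ d ih =>
    obtain ⟨g, hg, rfl⟩ := mem_walkFamily_succ.1 h
    intro q hq
    rcases Finset.mem_insert.1 hq with rfl | hq
    · exact List.suffix_rfl
    · obtain ⟨w, -, hq⟩ := Finset.mem_biUnion.1 hq
      rcases hg w with h1 | h1
      · simp [h1] at hq
      · exact (List.suffix_cons w p).trans (ih h1 q hq)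

theorem eq_of_cons_suffix {w w' : V} {p q : List V} (h : w :: p <:+ q) (h' : w' :: p <:+ q) :
    w = w' := by
  have h1 := List.suffix_of_suffix_length_le h h' (by simp)
  have h2 := h1.eq_of_length (by simp)
  injection h2

theorem closed_of_mem_walkFamily {d : ℕ} {p : List V} {S : Finset (List V)}
    (h : S ∈ walkFamily d p) : ∀ w q, w :: q ∈ S → w :: q ≠ p → q ∈ S := by
  induction d generalizing p S with
  | zero => simp [walkFamily] at h
  | succ d ih =>
    obtain ⟨g, hg, rfl⟩ := mem_walkFamily_succ.1 h
    intro a q hq hne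
    rcases Finset.mem_insert.1 hq with h1 | hq
    · exact absurd h1 hne
    · obtain ⟨w, -, hq⟩ := Finset.mem_biUnion.1 hq
      rcases hg w with h1 | h1
      · simp [h1] at hq
      · by_cases h2 : a :: q = w :: p
        · injection h2 with _ h2
          subst h2
          exact Finset.mem_insert_self _ _
        · exact Finset.mem_insert_of_mem
            (Finset.mem_biUnion.2 ⟨w, Finset.mem_univ _, ih h1 a q hq h2⟩)

/-- Group the elements by their first step beyond `p`. Each nonempty group is again closed under
removing steps and has one step less to go. -/
theorem mem_walkFamily {d : ℕ} {p : List V} {S : Finset (List V)} (h0 : p ∈ S)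
    (h1 : ∀ q ∈ S, p <:+ q ∧ q.length < p.length + d)
    (h2 : ∀ w q, w :: q ∈ S → w :: q ≠ p → q ∈ S) : S ∈ walkFamily d p := by
  induction d generalizing p S with
  | zero => exact absurd (h1 p h0).2 (by simp)
  | succ d ih =>
    have hdrop : ∀ (t q : List V), t ++ q ∈ S → p <:+ q → q ∈ S := by
      intro t
      induction t with
      | nil => intro q h _; exact h
      | cons a t iht =>
        intro q h3 h4
        refine iht q (h2 a _ h3 ?_) h4
        intro h5
        have h6 := h4.length_le
        have h7 := congrArg List.length h5
        simp at h7
        omega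
    refine mem_walkFamily_succ.2 ⟨fun w => S.filter fun q => w :: p <:+ q, ?_, ?_⟩
    · intro w
      by_cases hw : w :: p ∈ S
      · right
        refine ih (Finset.mem_filter.2 ⟨hw, List.suffix_rfl⟩) ?_ ?_
        · intro q hq
          obtain ⟨hq, hs⟩ := Finset.mem_filter.1 hq
          refine ⟨hs, ?_⟩
          have := (h1 q hq).2
          simp only [List.length_cons]
          omega
        · intro a q hq hne
          obtain ⟨hq, hs⟩ := Finset.mem_filter.1 hq
          have hs' : w :: p <:+ q := by
            rcases List.suffix_cons_iff.1 hs with h3 | h3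
            · exact absurd h3.symm hne
            · exact h3
          refine Finset.mem_filter.2 ⟨h2 a q hq ?_, hs'⟩
          intro h3
          have := hs'.length_le
          rw [← h3] at this
          simp at this
      · left
        refine Finset.filter_eq_empty_iff.2 ?_
        rintro q hq ⟨t, ht⟩
        exact hw (hdrop t _ (ht ▸ hq) (List.suffix_cons w p))
    · ext q
      simp only [Finset.mem_insert, Finset.mem_biUnion, Finset.mem_univ, true_and,
        Finset.mem_filter]
      constructor
      · rintro (rfl | ⟨w, hq, -⟩)
        · exact h0
        · exact hq
      · intro hq
        obtain ⟨t, ht⟩ := (h1 q hq).1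
        rcases List.eq_nil_or_concat t with rfl | ⟨t', w, rfl⟩
        · left; simpa using ht.symm
        · right
          refine ⟨w, hq, t', ?_⟩
          rw [← ht]; simp

variable {A : Type*} [CommSemiring A]

open scoped Classical in
/-- The weight of a set of walks: a product over its elements of weights that depend on whether the
element is a leaf. -/
noncomputable def walkWeight (φ : Bool → List V → A) (S : Finset (List V)) : A :=
  ∏ q ∈ S, φ (decide (∀ w, w :: q ∉ S)) q

-- A member consists of `p` and, independently for each `w`, of nothing or a member above `w :: p`,
-- so the sum factors. Choosing nothing for every `w` is the case where `p` is a leaf; the other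
-- choices add up to `acc`. The form `1 + acc` avoids subtraction in a semiring.
open scoped Classical in
theorem sum_walkFamily_succ (φ : Bool → List V → A) (d : ℕ) (p : List V) :
    ∃ acc, 1 + acc = ∏ w, (1 + ∑ S ∈ walkFamily d (w :: p), walkWeight φ S) ∧
      ∑ S ∈ walkFamily (d + 1) p, walkWeight φ S = φ true p + φ false p * acc := by
  have hne : ∀ w, (∅ : Finset (List V)) ∉ walkFamily d (w :: p) := by
    intro w h
    exact absurd (self_mem_of_mem_walkFamily h) (Finset.notMem_empty _)
  let 𝒢 := Fintype.piFinset fun w => insert ∅ (walkFamily d (w :: p))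
  have hmem𝒢 : ∀ g, g ∈ 𝒢 ↔ ∀ w, g w = ∅ ∨ g w ∈ walkFamily d (w :: p) := by
    intro g; simp [𝒢]
  have hg0 : (fun _ => ∅ : V → Finset (List V)) ∈ 𝒢 := by simp [hmem𝒢]
  have hsuf : ∀ g ∈ 𝒢, ∀ w, ∀ q ∈ g w, w :: p <:+ q := by
    intro g hg w q hq
    rcases (hmem𝒢 g).1 hg w with h1 | h1
    · simp [h1] at hq
    · exact suffix_of_mem_walkFamily h1 q hq
  have hp : ∀ g ∈ 𝒢, p ∉ Finset.univ.biUnion g := by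
    intro g hg h
    obtain ⟨w, -, hq⟩ := Finset.mem_biUnion.1 h
    have := (hsuf g hg w p hq).length_le
    simp at this
  have hmem : ∀ g ∈ 𝒢, ∀ w, ∀ q, w :: p <:+ q → (q ∈ insert p (Finset.univ.biUnion g) ↔ q ∈ g w) := by
    intro g hg w q hq
    simp only [Finset.mem_insert, Finset.mem_biUnion, Finset.mem_univ, true_and]
    constructor
    · rintro (rfl | ⟨w', h1⟩)
      · have := hq.length_le
        simp at this
      · rwa [eq_of_cons_suffix hq (hsuf g hg w' q h1)]
    · intro h1; exact Or.inr ⟨w, h1⟩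
  have hinj : Set.InjOn (fun g : V → Finset (List V) => insert p (Finset.univ.biUnion g)) 𝒢 := by
    intro g hg g' hg' h
    have h' : insert p (Finset.univ.biUnion g) = insert p (Finset.univ.biUnion g') := h
    funext w
    ext q
    constructor
    · intro hq
      have h1 := hsuf g hg w q hq
      rw [← hmem g' hg' w q h1, ← h']
      exact (hmem g hg w q h1).2 hq
    · intro hq
      have h1 := hsuf g' hg' w q hq
      rw [← hmem g hg w q h1, h']
      exact (hmem g' hg' w q h1).2 hq
  -- Whether a walk in a branch is a leaf is decided within that branch, because different branches
  -- extend different walks.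
  have hwt : ∀ g ∈ 𝒢, walkWeight φ (insert p (Finset.univ.biUnion g)) =
      φ (decide (g = fun _ => ∅)) p * ∏ w, walkWeight φ (g w) := by
    intro g hg
    rw [walkWeight, Finset.prod_insert (hp g hg)]
    congr 1
    · congr 1
      rw [decide_eq_decide]
      constructor
      · intro h
        funext w
        rw [Finset.eq_empty_iff_forall_notMem]
        intro q hq
        rcases (hmem𝒢 g).1 hg w with h1 | h1
        · simp [h1] at hq
        · exact h w ((hmem g hg w _ List.suffix_rfl).2 (self_mem_of_mem_walkFamily h1))
      · intro h w
        rw [hmem g hg w _ List.suffix_rfl, h]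
        simp
    · rw [Finset.prod_biUnion]
      · refine Finset.prod_congr rfl fun w _ => Finset.prod_congr rfl fun q hq => ?_
        congr 1
        rw [decide_eq_decide]
        refine forall_congr' fun a => not_congr ?_
        exact hmem g hg w _ ((hsuf g hg w q hq).trans (List.suffix_cons a q))
      · intro w _ w' _ hww
        rw [Function.onFun, Finset.disjoint_left]
        intro q hq hq'
        exact hww (eq_of_cons_suffix (hsuf g hg w q hq) (hsuf g hg w' q hq'))
  refine ⟨∑ g ∈ 𝒢.erase (fun _ => ∅), ∏ w, walkWeight φ (g w), ?_, ?_⟩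
  · have h1 : ∀ w, (1 + ∑ S ∈ walkFamily d (w :: p), walkWeight φ S) =
        ∑ S ∈ insert ∅ (walkFamily d (w :: p)), walkWeight φ S := by
      intro w
      rw [Finset.sum_insert (hne w)]
      simp [walkWeight]
    simp only [h1]
    rw [Finset.prod_univ_sum, ← Finset.add_sum_erase _ _ hg0]
    simp [walkWeight, 𝒢]
  · have h2 : walkFamily (d + 1) p = 𝒢.image fun g => insert p (Finset.univ.biUnion g) := rfl
    rw [h2, Finset.sum_image hinj, Finset.sum_congr rfl hwt, ← Finset.add_sum_erase _ _ hg0,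
      Finset.mul_sum]
    congr 1
    · simp [walkWeight]
    · refine Finset.sum_congr rfl fun g hg => ?_
      have := (Finset.mem_erase.1 hg).1
      simp [this]

end WalkFamily


/-! ### The generating function of trees of walks -/

section TreeSum

set_option linter.unusedSectionVars false

variable {V : Type*} [Fintype V] [DecidableEq V]

/-- The walk family with the root added. -/
def rootedFamily (ρ σ : V) (d : ℕ) : Finset (Finset (List V)) :=
  (walkFamily d [σ, ρ]).image (insert [ρ])

open scoped Classical in
/-- The trees of walks of bounded depth. -/
noncomputable def walkTrees (G : SimpleGraph V) (ρ σ : V) (d : ℕ) : Finset (Finset (List V)) :=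
  (rootedFamily ρ σ d).filter (IsWalkTree G ρ σ)

/-- The nonempty suffixes of a walk are nodes too, and they have different lengths. -/
theorem IsWalkTree.length_le {G : SimpleGraph V} {ρ σ : V} {S : Finset (List V)}
    (hw : IsWalkTree G ρ σ S) {p : List V} (hp : p ∈ S) : p.length ≤ S.card := by
  have h1 : ∀ t q : List V, t ++ q ∈ S → q ≠ [] → q ∈ S := by
    intro t
    induction t with
    | nil => intro q h _; exact h
    | cons a t ih =>
      intro q h hq
      obtain ⟨b, s, hs⟩ := List.exists_cons_of_ne_nil (show t ++ q ≠ [] by simp [hq])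
      refine ih q ?_ hq
      rw [hs]
      exact hw.tail a _ _ (hs ▸ h)
  have h2 : (Finset.range p.length).image (fun i => p.drop i) ⊆ S := by
    intro q hq
    obtain ⟨i, hi, rfl⟩ := Finset.mem_image.1 hq
    refine h1 (p.take i) _ (by simpa using hp) ?_
    have := Finset.mem_range.1 hi
    intro h
    have := List.drop_eq_nil_iff.1 h
    omega
  have h3 := Finset.card_le_card h2
  rwa [Finset.card_image_of_injOn, Finset.card_range] at h3
  intro i hi j hj hij
  have e := congrArg List.length hij
  simp only [List.length_drop, Finset.coe_range, Set.mem_Iio] at e hi hj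
  omega

theorem mem_walkTrees {G : SimpleGraph V} {ρ σ : V} {d : ℕ} {S : Finset (List V)}
    (hw : IsWalkTree G ρ σ S) (hd : S.card < 2 + d) : S ∈ walkTrees G ρ σ d := by
  classical
  have hsuf : ∀ n, ∀ q : List V, q.length = n → q ∈ S.erase [ρ] → [σ, ρ] <:+ q := by
    intro n
    induction n with
    | zero =>
      intro q h1 h2
      rw [List.length_eq_zero_iff.1 h1] at h2
      exact absurd (Finset.mem_of_mem_erase h2) hw.nil
    | succ n ih =>
      intro q h1 h2
      obtain ⟨h3, h4⟩ := Finset.mem_erase.1 h2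
      rcases hw.cases_mem h4 with rfl | ⟨w, v, t, rfl⟩
      · exact absurd rfl h3
      · have h5 := hw.tail _ _ _ h4
        cases t with
        | nil =>
          have e1 := hw.single _ h5
          subst e1
          rw [hw.two _ h4]
        | cons u t =>
          refine (ih (v :: u :: t) ?_ ?_).trans (List.suffix_cons _ _)
          · simpa using h1
          · exact Finset.mem_erase.2 ⟨by simp, h5⟩
  refine Finset.mem_filter.2 ⟨Finset.mem_image.2 ⟨S.erase [ρ], ?_, Finset.insert_erase hw.root⟩, hw⟩
  refine mem_walkFamily ?_ ?_ ?_
  · exact Finset.mem_erase.2 ⟨by simp, hw.stem⟩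
  · intro q hq
    refine ⟨hsuf _ q rfl hq, ?_⟩
    have := hw.length_le (Finset.mem_of_mem_erase hq)
    simp
    omega
  · intro w q hq hne
    obtain ⟨h3, h4⟩ := Finset.mem_erase.1 hq
    have h5 := (hsuf _ _ rfl hq)
    rcases hw.cases_mem h4 with h6 | ⟨w', v, t, h6⟩
    · exact absurd h6 h3
    · injection h6 with h6 h7
      subst h6 h7
      refine Finset.mem_erase.2 ⟨?_, hw.tail _ _ _ h4⟩
      intro h8
      rw [h8] at h5 hne
      exact hne (h5.eq_of_length (by simp)).symm

/-- Whether the last step of a walk is allowed. -/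
def StepOk (G : SimpleGraph V) (ρ : V) : List V → Prop
  | v :: u :: t => G.Adj u v ∧ v ≠ ρ ∧ ∀ w ∈ t.head?, v ≠ w
  | _ => False

/-- The conditions are local: each concerns the last two steps of one walk. A product of weights
that vanish on forbidden steps therefore selects exactly the trees of walks. -/
theorem isWalkTree_insert_iff {G : SimpleGraph V} {ρ σ : V} {d : ℕ} {S : Finset (List V)}
    (hS : S ∈ walkFamily d [σ, ρ]) : IsWalkTree G ρ σ (insert [ρ] S) ↔ ∀ q ∈ S, StepOk G ρ q := by
  have hsuf := suffix_of_mem_walkFamily hS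
  have hcl := closed_of_mem_walkFamily hS
  have hself := self_mem_of_mem_walkFamily hS
  have hlen : ∀ q ∈ S, 2 ≤ q.length := fun q hq => by simpa using (hsuf q hq).length_le
  have hmem : ∀ w v p, w :: v :: p ∈ insert [ρ] S ↔ w :: v :: p ∈ S := by
    intro w v p; simp
  have hone : ∀ w, [w] ∈ insert [ρ] S → w = ρ := by
    intro w hw
    rcases Finset.mem_insert.1 hw with h | h
    · injection h
    · have := hlen _ h; simp at this
  constructor
  · intro hw q hq
    have h1 := hlen q hq
    match q, hq, h1 with
    | v :: u :: t, hq, _ =>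
      have hq' := (hmem _ _ _).2 hq
      refine ⟨hw.adj _ _ _ hq', hw.ret _ _ _ hq', ?_⟩
      intro w ht
      cases t with
      | nil => simp at ht
      | cons x t =>
        simp only [List.head?_cons, Option.mem_def, Option.some.injEq] at ht
        subst ht
        exact hw.back _ _ _ _ hq'
  · intro h
    refine ⟨Finset.mem_insert_self _ _, Finset.mem_insert_of_mem hself, ?_, ?_, hone, ?_, ?_, ?_, ?_⟩
    · intro h1
      rcases Finset.mem_insert.1 h1 with h1 | h1
      · cases h1
      · have := hlen _ h1; simp at this
    · intro w v p hp
      have hp' := (hmem _ _ _).1 hp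
      by_cases h1 : w :: v :: p = [σ, ρ]
      · injection h1 with _ h1
        rw [h1]
        exact Finset.mem_insert_self _ _
      · exact Finset.mem_insert_of_mem (hcl _ _ hp' h1)
    · intro w hw
      have := hsuf _ ((hmem _ _ _).1 hw)
      have := this.eq_of_length (by simp)
      injection this with h1 _
      exact h1.symm
    · intro w v p hp
      exact (h _ ((hmem _ _ _).1 hp)).1
    · intro w v u p hp
      exact (h _ ((hmem _ _ _).1 hp)).2.2 u (by simp)
    · intro w v p hp
      exact (h _ ((hmem _ _ _).1 hp)).2.1

variable {A : Type*} [CommSemiring A]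

open scoped Classical in
/-- The weight of the edge between `u` and `v` together with the node at `v`. -/
noncomputable def edgeWeight (G : SimpleGraph V) (P : V → Prop) (ρ : V) (z y q : A)
    (x a : Sym2 V → A) (leaf : Bool) (u v : V) : A :=
  (if G.Adj u v ∧ v ≠ ρ then 1 else 0) * z * x s(u, v) *
    (if ¬ P u ∧ ¬ P v then q * a s(u, v) else 1) * (if P v ∨ leaf then q * a s(v, v) else 1) *
    (if leaf then y else 1)

open scoped Classical in
/-- The weight of a walk as an element of a tree of walks. -/
noncomputable def stepWeight (G : SimpleGraph V) (P : V → Prop) (ρ : V) (z y q : A)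
    (x a : Sym2 V → A) (leaf : Bool) : List V → A
  | v :: u :: t => (if ∀ w ∈ t.head?, v ≠ w then 1 else 0) * edgeWeight G P ρ z y q x a leaf u v
  | _ => 0

/-- The monomial of a tree of walks. -/
noncomputable def treeMonomial (P : V → Prop) (ρ : V) (z y q : A) (x a : Sym2 V → A)
    (S : Finset (List V)) : A :=
  z ^ S.card * y ^ leafCount S * q ^ (items P ρ S).card *
    (((walkEdges ρ S).map x).prod * ((items P ρ S).map a).prod)

/-- Each node other than the root accounts for itself and for the edge to its parent. The factor in
front is the contribution of the root, which is a leaf and hence an item whether or not it lies in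
`P`. -/
theorem rooted_walkWeight {G : SimpleGraph V} {P : V → Prop} {ρ σ : V} {z y q : A}
    {x a : Sym2 V → A} {d : ℕ} {S : Finset (List V)} (hS : S ∈ walkFamily d [σ, ρ])
    (hw : IsWalkTree G ρ σ (insert [ρ] S)) :
    z * y * (q * a s(ρ, ρ)) * walkWeight (stepWeight G P ρ z y q x a) S =
      treeMonomial P ρ z y q x a (insert [ρ] S) := by
  classical
  have hok := (isWalkTree_insert_iff hS).1 hw
  have hlen : ∀ q ∈ S, 2 ≤ q.length := fun q hq => by
    simpa using (suffix_of_mem_walkFamily hS q hq).length_le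
  have hroot : [ρ] ∉ S := fun h => by have := hlen _ h; simp at this
  let leaf : List V → Prop := fun p => ∀ w, w :: p ∉ S
  have hleaf : ∀ p ∈ S, LeafNode (insert [ρ] S) p ↔ leaf p := by
    intro p hp
    rw [hw.leafNode_iff (Finset.mem_insert_of_mem hp)]
    constructor
    · rintro (rfl | h) w hwp
      · exact hroot hp
      · exact h w (Finset.mem_insert_of_mem hwp)
    · intro h
      right
      intro w hwp
      rcases Finset.mem_insert.1 hwp with h1 | h1
      · injection h1 with _ h1
        have := hlen p hp
        simp [h1] at this
      · exact h w h1
  have hleafρ : LeafNode (insert [ρ] S) [ρ] := (hw.leafNode_iff hw.root).2 (Or.inl rfl)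
  -- the items, node by node
  have hlc : leafCount (insert [ρ] S) = 1 + (S.filter leaf).card := by
    rw [leafCount, Finset.filter_insert, if_pos hleafρ, Finset.card_insert_of_notMem, add_comm]
    · congr 2
      exact Finset.filter_congr hleaf
    · simp [hroot]
  have hvi : vertexItems P ρ (insert [ρ] S) =
      ρ ::ₘ (S.filter fun p => P (p.headD ρ) ∨ leaf p).val.map fun p => p.headD ρ := by
    rw [vertexItems, Finset.filter_insert, if_pos (Or.inr hleafρ),
      Finset.insert_val_of_notMem (by simp [hroot]), Multiset.map_cons]
    congr 3
    exact Finset.filter_congr fun p hp => or_congr_right (hleaf p hp)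
  have hedges : walkEdges ρ (insert [ρ] S) = S.val.map (lastEdge ρ) := by
    rw [walkEdges, Finset.erase_insert hroot]
  have key : ∀ f : Sym2 V → A, ((items P ρ (insert [ρ] S)).map f).prod =
      f s(ρ, ρ) * ∏ p ∈ S, ((if P (p.headD ρ) ∨ leaf p then f s(p.headD ρ, p.headD ρ) else 1) *
        (if ∀ v ∈ lastEdge ρ p, ¬ P v then f (lastEdge ρ p) else 1)) := by
    intro f
    rw [items, hvi, hedges, Multiset.map_add, Multiset.prod_add, Finset.prod_mul_distrib, ← mul_assoc]
    congr 1
    · simp only [Multiset.map_cons, Multiset.map_map, Multiset.prod_cons]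
      congr 1
      rw [← Finset.prod_filter]
      rfl
    · rw [Multiset.filter_map, Multiset.map_map, ← Finset.prod_filter]
      rfl
  have hq : q ^ (items P ρ (insert [ρ] S)).card = ((items P ρ (insert [ρ] S)).map fun _ => q).prod := by
    simp
  have hx : ((walkEdges ρ (insert [ρ] S)).map x).prod = ∏ p ∈ S, x (lastEdge ρ p) := by
    rw [hedges, Multiset.map_map]; rfl
  have hy : y ^ leafCount (insert [ρ] S) = y * ∏ p ∈ S, if leaf p then y else 1 := by
    rw [hlc, pow_add, pow_one, ← Finset.prod_filter, Finset.prod_const]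
  have hz : z ^ (insert [ρ] S).card = z * ∏ _p ∈ S, z := by
    rw [Finset.card_insert_of_notMem hroot, Finset.prod_const, pow_succ']
  rw [treeMonomial, hq, hx, hy, hz, key, key, walkWeight]
  have hstep : ∏ p ∈ S, stepWeight G P ρ z y q x a (decide (∀ w, w :: p ∉ S)) p = ∏ p ∈ S,
      (z * (if leaf p then y else 1) *
        ((if P (p.headD ρ) ∨ leaf p then q else 1) * (if ∀ v ∈ lastEdge ρ p, ¬ P v then q else 1)) *
        (x (lastEdge ρ p) *
        ((if P (p.headD ρ) ∨ leaf p then a s(p.headD ρ, p.headD ρ) else 1) *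
          (if ∀ v ∈ lastEdge ρ p, ¬ P v then a (lastEdge ρ p) else 1)))) := by
    refine Finset.prod_congr rfl fun p hp => ?_
    have h1 := hok p hp
    match p, hp, h1 with
    | v :: u :: t, hp, h1 =>
      have h2 : (∀ w ∈ lastEdge ρ (v :: u :: t), ¬ P w) ↔ (¬ P u ∧ ¬ P v) := by
        simp [lastEdge]
      have h3 : (decide (∀ w, w :: v :: u :: t ∉ S) = true) ↔ leaf (v :: u :: t) := by
        simp [leaf]
      simp only [stepWeight, edgeWeight, if_pos h1.2.2, if_pos (And.intro h1.1 h1.2.1), h2, h3,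
        List.headD_cons]
      simp only [lastEdge, List.tail_cons, List.headD_cons]
      by_cases e1 : leaf (v :: u :: t) <;> by_cases e2 : P v <;> by_cases e3 : P u <;>
        simp only [e1, e2, e3, or_true, or_false, if_true, if_false, not_true,
          not_false_eq_true, and_true, and_false, and_self, or_self] <;> ring
  rw [hstep]
  simp only [Finset.prod_mul_distrib]
  ring

theorem sum_walkTrees (G : SimpleGraph V) (P : V → Prop) (ρ σ : V) (z y q : A)
    (x a : Sym2 V → A) (d : ℕ) :
    z * y * (q * a s(ρ, ρ)) *
        ∑ S ∈ walkFamily d [σ, ρ], walkWeight (stepWeight G P ρ z y q x a) S =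
      ∑ S ∈ walkTrees G ρ σ d, treeMonomial P ρ z y q x a S := by
  classical
  rw [walkTrees, Finset.sum_filter, rootedFamily, Finset.sum_image, Finset.mul_sum]
  · refine Finset.sum_congr rfl fun S hS => ?_
    split_ifs with hw
    · exact rooted_walkWeight hS hw
    · rw [isWalkTree_insert_iff hS] at hw
      push Not at hw
      obtain ⟨p, hp, h1⟩ := hw
      rw [walkWeight, Finset.prod_eq_zero hp, mul_zero]
      match p, h1 with
      | [], _ => rfl
      | [_], _ => rfl
      | v :: u :: t, h1 =>
        rw [StepOk, not_and_or, not_and_or] at h1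
        rw [stepWeight, edgeWeight]
        rcases h1 with h1 | h1 | h1
        · simp [show ¬ (G.Adj u v ∧ v ≠ ρ) from fun h => h1 h.1]
        · simp [show ¬ (G.Adj u v ∧ v ≠ ρ) from fun h => h1 h.2]
        · rw [if_neg h1, zero_mul]
  · intro S hS S' hS' h
    have h1 : ∀ S ∈ walkFamily d [σ, ρ], [ρ] ∉ S := by
      intro S hS h
      have := (suffix_of_mem_walkFamily hS _ h).length_le
      simp at this
    rw [← Finset.erase_insert (h1 S hS), h, Finset.erase_insert (h1 S' hS')]

/-- The generating function satisfies the recursion of a table indexed by pairs of vertices. -/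
theorem sum_walkFamily_eq_table [IsLeftCancelAdd A] (G : SimpleGraph V) (P : V → Prop) (ρ : V)
    (z y q : A) (x a : Sym2 V → A) (D : ℕ) (f : ℕ → V → V → A) (h0 : ∀ u v, f 0 u v = 0)
    (hf : ∀ d < D, ∀ u v, ∃ acc, 1 + acc = ∏ w, (1 + if w = u then 0 else f d v w) ∧
      f (d + 1) u v = edgeWeight G P ρ z y q x a true u v + edgeWeight G P ρ z y q x a false u v * acc)
    (d : ℕ) (hd : d ≤ D) (v u : V) (t : List V) :
    ∑ S ∈ walkFamily d (v :: u :: t), walkWeight (stepWeight G P ρ z y q x a) S =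
      (open scoped Classical in if ∀ w ∈ t.head?, v ≠ w then 1 else 0) * f d u v := by
  classical
  induction d generalizing v u t with
  | zero => simp [walkFamily, h0]
  | succ d ih =>
    obtain ⟨acc, h1, h2⟩ := sum_walkFamily_succ (stepWeight G P ρ z y q x a) d (v :: u :: t)
    obtain ⟨acc', h3, h4⟩ := hf d (by omega) u v
    -- The inductive hypothesis carries the factor that forbids stepping back to `u`, which turns
    -- the product over all `w` into the one for the table.
    have h5 : acc = acc' := by
      refine add_left_cancel (a := 1) ?_
      rw [h1, h3]
      refine Finset.prod_congr rfl fun w _ => ?_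
      rw [ih (by omega)]
      simp only [List.head?_cons, Option.mem_def, Option.some.injEq]
      by_cases hwu : w = u
      · simp [hwu]
      · simp [hwu]
    rw [h2, h4, h5]
    simp only [stepWeight]
    ring

end TreeSum


/-! ### Sieving for trees whose labels are distinct -/

section Sieve

theorem bit_add_two_pow {r X : ℕ} (hX : X < 2 ^ r) (i : ℕ) :
    (X + 2 ^ r) / 2 ^ i % 2 = if i = r then 1 else X / 2 ^ i % 2 := by
  have h : ∀ Y : ℕ, Y / 2 ^ i % 2 = (Y.testBit i).toNat := fun Y => (Nat.toNat_testBit Y i).symm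
  rw [h, h, add_comm]
  rcases lt_trichotomy i r with hi | rfl | hi
  · rw [if_neg hi.ne, Nat.testBit_two_pow_add_gt hi]
  · rw [if_pos rfl, Nat.testBit_two_pow_add_eq, Nat.testBit_lt_two_pow hX]; rfl
  · rw [if_neg hi.ne', Nat.testBit_lt_two_pow, Nat.testBit_lt_two_pow]
    · exact hX.trans (Nat.pow_lt_pow_right one_lt_two hi)
    · calc 2 ^ r + X < 2 ^ r + 2 ^ r := by omega
        _ = 2 ^ (r + 1) := by ring
        _ ≤ 2 ^ i := Nat.pow_le_pow_right two_pos hi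

theorem bit_eq_zero {r X i : ℕ} (hX : X < 2 ^ r) (hi : r ≤ i) : X / 2 ^ i % 2 = 0 := by
  rw [Nat.div_eq_of_lt (hX.trans_le (Nat.pow_le_pow_right two_pos hi))]

theorem sum_range_two_pow_succ {A : Type*} [AddCommMonoid A] (r : ℕ) (f : ℕ → A) :
    ∑ X ∈ Finset.range (2 ^ (r + 1)), f X =
      ∑ X ∈ Finset.range (2 ^ r), f X + ∑ X ∈ Finset.range (2 ^ r), f (X + 2 ^ r) := by
  rw [pow_succ, mul_two, Finset.sum_range_add]
  simp only [add_comm]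

/-- The linear form with coefficients `c` evaluated at the bits of `X`. -/
def bitForm {A : Type*} [CommSemiring A] (m : ℕ) (c : ℕ → A) (X : ℕ) : A :=
  ∑ i ∈ Finset.range m, ((X / 2 ^ i % 2 : ℕ) : A) * c i

/-- A polynomial of degree less than `r` sums to zero over the cube of dimension `r` in
characteristic 2. In the induction, setting the top bit adds constants to the forms. Each change
this makes is a multiple of a product of fewer forms, so the two halves have equal sums and cancel.
-/
theorem sum_prod_bitForm {A : Type*} [CommRing A] [CharP A 2] (m r : ℕ) (M : Multiset (ℕ → A))
    (hM : M.card < r) :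
    ∑ X ∈ Finset.range (2 ^ r), (M.map fun c => bitForm m c X).prod = 0 := by
  induction r generalizing M with
  | zero => omega
  | succ r ih =>
    let γ : (ℕ → A) → A := fun c => if r < m then c r else 0
    have hγ : ∀ c, ∀ X < 2 ^ r, bitForm m c (X + 2 ^ r) = bitForm m c X + γ c := by
      intro c X hX
      simp only [bitForm, bit_add_two_pow hX]
      have : γ c = ∑ i ∈ Finset.range m, if i = r then c i else 0 := by
        rw [Finset.sum_ite_eq']; simp [γ]
      rw [this, ← Finset.sum_add_distrib]
      refine Finset.sum_congr rfl fun i _ => ?_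
      split_ifs with h
      · subst h; simp [bit_eq_zero hX le_rfl]
      · simp
    -- The added constants are removed one form at a time. Each error term is `γ c` times a sum that
    -- vanishes by the inductive hypothesis.
    have key : ∀ M₁ M₂ : Multiset (ℕ → A), M₁.card + M₂.card ≤ r →
        ∑ X ∈ Finset.range (2 ^ r), (M₁.map fun c => bitForm m c X + γ c).prod *
            (M₂.map fun c => bitForm m c X).prod =
          ∑ X ∈ Finset.range (2 ^ r), ((M₁ + M₂).map fun c => bitForm m c X).prod := by
      intro M₁
      induction M₁ using Multiset.induction_on with
      | empty => intro M₂ _; simp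
      | cons c M₁ ih₁ =>
        intro M₂ h
        rw [Multiset.card_cons] at h
        have h1 := ih₁ (c ::ₘ M₂) (by rw [Multiset.card_cons]; omega)
        have h2 := ih₁ M₂ (by omega)
        rw [ih (M₁ + M₂) (by rw [Multiset.card_add]; omega)] at h2
        rw [Multiset.cons_add, ← Multiset.add_cons, ← h1,
          ← add_zero (∑ X ∈ _, (Multiset.map _ M₁).prod * (Multiset.map _ (c ::ₘ M₂)).prod),
          ← mul_zero (γ c), ← h2, Finset.mul_sum, ← Finset.sum_add_distrib]
        refine Finset.sum_congr rfl fun X _ => ?_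
        simp only [Multiset.map_cons, Multiset.prod_cons]
        ring
    rw [sum_range_two_pow_succ]
    have h3 : ∑ X ∈ Finset.range (2 ^ r), (M.map fun c => bitForm m c (X + 2 ^ r)).prod =
        ∑ X ∈ Finset.range (2 ^ r), (M.map fun c => bitForm m c X).prod := by
      rw [← add_zero M, ← key M 0 (by simpa using Nat.lt_succ_iff.1 hM)]
      refine Finset.sum_congr rfl fun X hX => ?_
      simp only [Multiset.map_zero, Multiset.prod_zero, mul_one, add_zero]
      congr 1
      exact Multiset.map_congr rfl fun c _ => hγ c X (Finset.mem_range.1 hX)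
    rw [h3]
    exact CharTwo.add_self_eq_zero _

/-- Squaring is additive in characteristic 2 and bits are idempotent, so a repeated form counts as a
single one. -/
theorem bitForm_mul_self {A : Type*} [CommRing A] [CharP A 2] (m : ℕ) (c : ℕ → A) (X : ℕ) :
    bitForm m c X * bitForm m c X = bitForm m (fun i => c i * c i) X := by
  rw [bitForm, CharTwo.sum_mul_self]
  refine Finset.sum_congr rfl fun i _ => ?_
  rcases Nat.mod_two_eq_zero_or_one (X / 2 ^ i) with h | h <;> simp [h]

theorem sum_prod_bitForm_of_not_nodup {A E : Type*} [CommRing A] [CharP A 2] (m r : ℕ)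
    (ξ : E → ℕ → A) (M : Multiset E) (hM : M.card = r) (hd : ¬ M.Nodup) :
    ∑ X ∈ Finset.range (2 ^ r), (M.map fun e => bitForm m (ξ e) X).prod = 0 := by
  classical
  rw [Multiset.nodup_iff_ne_cons_cons] at hd
  push Not at hd
  obtain ⟨e, M', rfl⟩ := hd
  have h := sum_prod_bitForm m r ((fun i => ξ e i * ξ e i) ::ₘ M'.map ξ) (by
    rw [Multiset.card_cons, Multiset.card_cons] at hM
    rw [Multiset.card_cons, Multiset.card_map]; omega)
  rw [← h]
  refine Finset.sum_congr rfl fun X _ => ?_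
  simp only [Multiset.map_cons, Multiset.prod_cons, Multiset.map_map, Function.comp_def,
    ← mul_assoc, bitForm_mul_self]

theorem sum_prod_bits (A : Type*) [CommSemiring A] (r : ℕ) :
    ∑ X ∈ Finset.range (2 ^ r), ∏ j ∈ Finset.range r, ((X / 2 ^ j % 2 : ℕ) : A) = 1 := by
  induction r with
  | zero => simp
  | succ r ih =>
    rw [sum_range_two_pow_succ]
    have h1 : ∑ X ∈ Finset.range (2 ^ r), ∏ j ∈ Finset.range (r + 1), ((X / 2 ^ j % 2 : ℕ) : A) = 0 := by
      refine Finset.sum_eq_zero fun X hX => ?_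
      rw [Finset.prod_range_succ, bit_eq_zero (Finset.mem_range.1 hX) le_rfl]
      simp
    rw [h1, zero_add, ← ih]
    refine Finset.sum_congr rfl fun X hX => ?_
    rw [Finset.prod_range_succ, bit_add_two_pow (Finset.mem_range.1 hX), if_pos rfl, Nat.cast_one,
      mul_one]
    refine Finset.prod_congr rfl fun j hj => ?_
    rw [bit_add_two_pow (Finset.mem_range.1 hX), if_neg (Finset.mem_range.1 hj).ne]

end Sieve

/-! ### The sieved sum over trees of walks -/

section TreeTotal

set_option linter.unusedSectionVars false

variable {V : Type*} [Fintype V] [DecidableEq V]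

open scoped Classical in
/-- The trees of walks with `k` nodes, `l` leaves and `r` items. -/
noncomputable def sizedTrees (G : SimpleGraph V) (P : V → Prop) (ρ σ : V) (d k l r : ℕ) :
    Finset (Finset (List V)) :=
  (walkTrees G ρ σ d).filter fun S => S.card = k ∧ leafCount S = l ∧ (items P ρ S).card = r

/-- The sum of the monomials of trees of walks with `k` nodes, `l` leaves and `r` items, sieved for
trees with distinct items. -/
noncomputable def treeTotal {A : Type*} [CommSemiring A] (G : SimpleGraph V) (P : V → Prop) (ρ σ : V)
    (d k l r m : ℕ) (ξ : Sym2 V → ℕ → A) : A :=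
  ∑ X ∈ Finset.range (2 ^ r), ∑ S ∈ sizedTrees G P ρ σ d k l r,
    ((walkEdges ρ S).map fun e => ξ e m).prod *
      ((items P ρ S).map fun e => bitForm (m + 1) (ξ e) X).prod

variable {G : SimpleGraph V} {P : V → Prop} {ρ σ : V} {d k l r m : ℕ}

/-- One expression serves over several semirings: the polynomials over `ℕ` with random coefficients,
their reductions modulo 2, their values at a natural number, and the generic version with
independent variables. -/
theorem map_treeTotal {A B : Type*} [CommSemiring A] [CommSemiring B] (f : A →+* B)
    (ξ : Sym2 V → ℕ → A) :
    f (treeTotal G P ρ σ d k l r m ξ) = treeTotal G P ρ σ d k l r m fun e i => f (ξ e i) := by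
  simp only [treeTotal, bitForm, map_sum, map_mul, map_multiset_prod, Multiset.map_map,
    Function.comp_def, map_natCast]

theorem treeTotal_eq_zero {A : Type*} [CommRing A] [CharP A 2] (hkd : k < 2 + d)
    (hno : ¬ HasKLTree G k l) (ξ : Sym2 V → ℕ → A) : treeTotal G P ρ σ d k l r m ξ = 0 := by
  classical
  rw [treeTotal, Finset.sum_comm]
  simp only [← Finset.mul_sum]
  refine sum_walkTrees_eq_zero (σ := σ) P hno (r := r) _ ?_ (fun e => ξ e m)
    (fun M => ∑ X ∈ Finset.range (2 ^ r), (M.map fun e => bitForm (m + 1) (ξ e) X).prod) ?_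
  · intro S
    simp only [sizedTrees, Finset.mem_filter]
    constructor
    · rintro ⟨h1, h2⟩
      exact ⟨(Finset.mem_filter.1 h1).2, h2⟩
    · rintro ⟨h1, h2⟩
      exact ⟨mem_walkTrees h1 (by omega), h2⟩
  · intro M hM hd
    exact sum_prod_bitForm_of_not_nodup _ _ _ _ hM hd

theorem exists_treeTotal_eq_one (A : Type*) [CommSemiring A] (hk : 2 ≤ k) (hkd : k < 2 + d)
    (h : HasKLTree G k l) : ∃ (ρ σ : V) (vs ls : Finset V) (E : Finset (Sym2 V)),
      vs.card = k ∧ ls ⊆ vs ∧ ls.card = l ∧ E.card + 1 = k ∧ (∀ e ∈ E, e ∈ G.edgeSet) ∧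
      ∀ (P : V → Prop) (m r : ℕ), (open scoped Classical in
        (vs.filter fun v => P v ∨ v ∈ ls).card + (E.filter fun e => ∀ v ∈ e, ¬ P v).card = r) →
        r ≤ m → ∃ ξ : Sym2 V → ℕ → A, treeTotal G P ρ σ d k l r m ξ = 1 := by
  classical
  obtain ⟨ρ, σ, S, vs, ls, E, hw, hSk, hSl, hvs, hls, hlsl, hE, hEG, hSE, hvi, huniq⟩ :=
    exists_walkTree hk h
  refine ⟨ρ, σ, vs, ls, E, hvs, hls, hlsl, hE, hEG, ?_⟩
  intro P m r hr hrm
  have hitems : items P ρ S = (vs.filter fun v => P v ∨ v ∈ ls).val.map (fun v => s(v, v)) +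
      (E.filter fun e => ∀ v ∈ e, ¬ P v).val := by
    rw [items, hvi, hSE]; rfl
  have hnodup : (items P ρ S).Nodup := by
    rw [hitems, Multiset.nodup_add]
    refine ⟨Multiset.Nodup.map ?_ (Finset.nodup _), Finset.nodup _, ?_⟩
    · intro v w hvw
      simpa using hvw
    · rw [Multiset.disjoint_left]
      intro e he he'
      obtain ⟨v, -, rfl⟩ := Multiset.mem_map.1 he
      have := hEG _ (Finset.mem_filter.1 he').1
      exact G.loopless.irrefl _ this
  have hcard : (items P ρ S).card = r := by
    rw [hitems, Multiset.card_add, Multiset.card_map]; exact hr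
  obtain ⟨L, hL⟩ : ∃ L : List (Sym2 V), (L : Multiset (Sym2 V)) = items P ρ S :=
    ⟨(items P ρ S).toList, Multiset.coe_toList _⟩
  have hLn : L.Nodup := by rw [← Multiset.coe_nodup, hL]; exact hnodup
  have hLr : L.length = r := by rw [← Multiset.coe_card, hL, hcard]
  -- The edge variables are the indicator of `E`, which leaves only the tree `S`. The `j`-th item
  -- receives the `j`-th unit vector, so its form is the `j`-th bit and the sum is `sum_prod_bits`.
  -- Coordinate `m` is free for the edge variable because `X < 2 ^ r` and `r ≤ m` make bit `m` zero.
  let ξ : Sym2 V → ℕ → A := fun e i =>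
    if i = m then (if e ∈ E then 1 else 0) else if L[i]? = some e then 1 else 0
  refine ⟨ξ, ?_⟩
  have hSm : S ∈ sizedTrees G P ρ σ d k l r :=
    Finset.mem_filter.2 ⟨mem_walkTrees hw (by omega), hSk, hSl, hcard⟩
  rw [treeTotal, ← sum_prod_bits A r]
  refine Finset.sum_congr rfl fun X hX => ?_
  rw [Finset.mem_range] at hX
  rw [Finset.sum_eq_single_of_mem S hSm]
  · have h1 : ((walkEdges ρ S).map fun e => ξ e m).prod = 1 := by
      refine Multiset.prod_eq_one fun x hx => ?_
      obtain ⟨e, he, rfl⟩ := Multiset.mem_map.1 hx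
      rw [hSE] at he
      simp only [ξ, if_pos]
      rw [if_pos (Finset.mem_def.2 he)]
    rw [h1, one_mul, ← hL, Multiset.map_coe, Multiset.prod_coe]
    have h2 : ∀ j (hj : j < L.length), bitForm (m + 1) (ξ L[j]) X = ((X / 2 ^ j % 2 : ℕ) : A) := by
      intro j hj
      rw [bitForm, Finset.sum_eq_single_of_mem j (Finset.mem_range.2 (by omega))]
      · by_cases hjm : j = m
        · omega
        · simp [ξ, hjm]
      · intro i _ hij
        by_cases him : i = m
        · rw [bit_eq_zero hX (by omega)]; simp
        · have : L[i]? ≠ some L[j] := by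
            intro h3
            obtain ⟨h4, h5⟩ := List.getElem?_eq_some_iff.1 h3
            exact hij ((List.Nodup.getElem_inj_iff hLn).1 h5)
          simp [ξ, him, this]
    rw [← List.ofFn_getElem (xs := L), List.map_ofFn, List.prod_ofFn, ← hLr,
      Finset.prod_range]
    exact Finset.prod_congr rfl fun j _ => h2 j j.2
  · intro S' hS' hne
    obtain ⟨h3, h4, -, -⟩ := Finset.mem_filter.1 hS'
    have h5 : ¬ ∀ e ∈ walkEdges ρ S', e ∈ E := fun h => hne (huniq S' (Finset.mem_filter.1 h3).2 h4 h)
    push Not at h5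
    obtain ⟨e, he, heE⟩ := h5
    rw [Multiset.prod_eq_zero, zero_mul]
    refine Multiset.mem_map.2 ⟨e, he, ?_⟩
    simp [ξ, heE]

end TreeTotal


/-! ### Random evaluation -/

section Coins

open Polynomial

/-- The polynomial whose coefficients are given by the `q`-th block of `w` coins. -/
noncomputable def coinPoly (w : ℕ) (ω : ℕ → Bool) (q : ℕ) : ℕ[X] :=
  ∑ j ∈ Finset.range w, C (ω (q * w + j)).toNat * X ^ (w - 1 - j)

theorem coinMeasure_cylinder (s : Finset ℕ) (b : ℕ → Bool) :
    RAM.coinMeasure {ω | ∀ i ∈ s, ω i = b i} = (1 / 2 : ENNReal) ^ s.card := by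
  have h : {ω : ℕ → Bool | ∀ i ∈ s, ω i = b i} = Set.pi s fun i => {b i} := by
    ext ω; simp
  rw [h, RAM.coinMeasure, Measure.infinitePi_pi]
  · rw [← Finset.prod_const]
    refine Finset.prod_congr rfl fun i _ => ?_
    rw [PMF.toMeasure_apply_singleton _ _ (MeasurableSet.singleton _)]
    simp
  · intro i _
    exact MeasurableSet.singleton _

theorem coinMeasure_blocks_le (M w : ℕ) (B : Finset (Fin M → Fin w → Bool)) :
    RAM.coinMeasure {ω | (fun (q : Fin M) (j : Fin w) => ω (q * w + j)) ∈ B} ≤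
      (B.card : ENNReal) * (1 / 2) ^ (M * w) := by
  classical
  have h : {ω : ℕ → Bool | (fun (q : Fin M) (j : Fin w) => ω (q * w + j)) ∈ B} ⊆
      ⋃ b ∈ B, {ω | ∀ i ∈ Finset.range (M * w), ω i =
        if h : i < M * w then b (finProdFinEquiv.symm ⟨i, h⟩).1 (finProdFinEquiv.symm ⟨i, h⟩).2
        else false} := by
    intro ω hω
    simp only [Set.mem_iUnion]
    refine ⟨_, hω, ?_⟩
    intro i hi
    rw [Finset.mem_range] at hi
    rw [dif_pos hi]
    congr 1
    have h1 := congrArg Fin.val (finProdFinEquiv.apply_symm_apply (⟨i, hi⟩ : Fin (M * w)))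
    rw [finProdFinEquiv_apply_val] at h1
    rw [mul_comm, add_comm]
    exact h1.symm
  refine (measure_mono h).trans ((measure_biUnion_finset_le _ _).trans ?_)
  simp only [coinMeasure_cylinder]
  simp

/-- Schwartz-Zippel holds over any integral domain. Here the `2 ^ w` polynomials over `ZMod 2` of
degree less than `w` take the place of a large finite field, so no irreducible polynomial has to be
found. -/
theorem coinMeasure_eval_eq_zero_le (M w : ℕ) (p : MvPolynomial (Fin M) (ZMod 2)[X]) (hp : p ≠ 0)
    (hd : p.totalDegree * 2 ≤ 2 ^ w) :
    RAM.coinMeasure {ω | MvPolynomial.eval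
      (fun q : Fin M => (coinPoly w ω q).map (Nat.castRingHom (ZMod 2))) p = 0} ≤ 1 / 2 := by
  classical
  let F : (Fin w → Bool) → (ZMod 2)[X] := fun b =>
    ∑ j : Fin w, C ((b j).toNat : ZMod 2) * X ^ (w - 1 - (j : ℕ))
  have hF : ∀ ω (q : Fin M), (coinPoly w ω q).map (Nat.castRingHom (ZMod 2)) =
      F fun j => ω (q * w + j) := by
    intro ω q
    rw [coinPoly, Polynomial.map_sum, Finset.sum_range]
    simp [F]
  have hFinj : Function.Injective F := by
    intro b b' h
    funext j
    have hc : ∀ b : Fin w → Bool, (F b).coeff (w - 1 - j) = ((b j).toNat : ZMod 2) := by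
      intro b
      simp only [F]
      rw [finsetSum_coeff, Finset.sum_eq_single_of_mem j (Finset.mem_univ _)]
      · rw [coeff_C_mul, coeff_X_pow, if_pos rfl, mul_one]
      · intro i _ hij
        have : (i : ℕ) ≠ j := fun h => hij (Fin.ext h)
        rw [coeff_C_mul, coeff_X_pow, if_neg (by omega), mul_zero]
    have h1 := hc b
    rw [h, hc b'] at h1
    revert h1
    cases b j <;> cases b' j <;> simp
  let S : Finset (ZMod 2)[X] := Finset.univ.image F
  have hS : S.card = 2 ^ w := by
    rw [Finset.card_image_of_injective _ hFinj]; simp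
  let B : Finset (Fin M → Fin w → Bool) :=
    Finset.univ.filter fun b => MvPolynomial.eval (fun q => F (b q)) p = 0
  have hset : {ω | MvPolynomial.eval
      (fun q : Fin M => (coinPoly w ω q).map (Nat.castRingHom (ZMod 2))) p = 0} =
      {ω | (fun (q : Fin M) (j : Fin w) => ω (q * w + j)) ∈ B} := by
    ext ω
    simp [B, hF]
  have hB : B.card ≤ ((Fintype.piFinset fun _ => S).filter fun f => MvPolynomial.eval f p = 0).card := by
    refine Finset.card_le_card_of_injOn (fun b q => F (b q)) ?_ ?_
    · intro b hb
      have hb' := (Finset.mem_filter.1 hb).2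
      simp only [Finset.coe_filter, Set.mem_ofPred_eq, Fintype.mem_piFinset]
      exact ⟨fun q => Finset.mem_image_of_mem _ (Finset.mem_univ _), hb'⟩
    · intro b _ b' _ h
      funext q
      exact hFinj (congrFun h q)
  have hsz := MvPolynomial.schwartz_zippel_totalDegree hp S
  rw [hS] at hsz
  have h2 : B.card * 2 ≤ 2 ^ (M * w) := by
    have h3 : (B.card : ℚ≥0) / ((2 ^ w : ℕ) : ℚ≥0) ^ M ≤ 1 / 2 := by
      refine (div_le_div_of_nonneg_right (Nat.cast_le.2 hB) (by positivity)).trans (hsz.trans ?_)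
      rw [div_le_div_iff₀ (by positivity) (by positivity), one_mul]
      exact_mod_cast hd
    rw [div_le_div_iff₀ (by positivity) (by positivity), one_mul] at h3
    rw [mul_comm M w, pow_mul]
    exact_mod_cast h3
  rw [hset]
  refine (coinMeasure_blocks_le M w B).trans ?_
  rw [one_div, ← ENNReal.inv_pow, ← div_eq_mul_inv]
  refine ENNReal.div_le_of_le_mul ?_
  rw [← ENNReal.div_eq_inv_mul, ENNReal.le_div_iff_mul_le (by simp) (by simp)]
  exact_mod_cast h2

instance : IsProbabilityMeasure RAM.coinMeasure := by
  unfold RAM.coinMeasure; infer_instance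

theorem half_le_coinMeasure_of_compl {s t : Set (ℕ → Bool)} (h : ∀ ω, ω ∉ t → ω ∈ s)
    (ht : RAM.coinMeasure t ≤ 1 / 2) : 1 / 2 ≤ RAM.coinMeasure s := by
  have h1 : (1 : ENNReal) ≤ RAM.coinMeasure s + RAM.coinMeasure t := by
    rw [← measure_univ (μ := RAM.coinMeasure)]
    refine le_trans (measure_mono ?_) (measure_union_le s t)
    intro ω _
    by_cases hω : ω ∈ t
    · exact Or.inr hω
    · exact Or.inl (h ω hω)
  have h2 : (1 : ENNReal) ≤ RAM.coinMeasure s + 1 / 2 := h1.trans (by gcongr)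
  have h3 : (1 / 2 : ENNReal) + 1 / 2 = 1 := ENNReal.add_halves 1
  exact (ENNReal.add_le_add_iff_right (a := 1 / 2) (by simp)).1 (h3.le.trans h2)

end Coins

/-! ### The sieved sum at random polynomials -/

section RandomTotal

open Polynomial

variable {n : ℕ} {G : SimpleGraph (Fin n)} {P : Fin n → Prop} {ρ σ : Fin n} {d k l r m : ℕ}

/-- The number of an unordered pair. -/
def pairIndex (e : Sym2 (Fin n)) : ℕ := (e.inf : ℕ) * n + (e.sup : ℕ)

theorem pairIndex_mk (u v : Fin n) : pairIndex s(u, v) = (min u v : ℕ) * n + (max u v : ℕ) := by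
  simp [pairIndex]

theorem pairIndex_lt (e : Sym2 (Fin n)) : pairIndex e < n * n := by
  have h1 := e.inf.2
  have h2 := e.sup.2
  calc pairIndex e < e.inf * n + n := by unfold pairIndex; omega
    _ = (e.inf + 1) * n := by ring
    _ ≤ n * n := Nat.mul_le_mul_right _ h1

theorem pairIndex_injective : Function.Injective (pairIndex (n := n)) := by
  intro e e' h
  have key : ∀ e : Sym2 (Fin n), pairIndex e / n = e.inf ∧ pairIndex e % n = e.sup := by
    intro e
    have h2 := e.sup.2
    rw [pairIndex, mul_comm]
    constructor
    · rw [Nat.mul_add_div (by omega), Nat.div_eq_of_lt h2, add_zero]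
    · rw [Nat.mul_add_mod, Nat.mod_eq_of_lt h2]
  have h1 := key e
  rw [h, (key e').1, (key e').2] at h1
  refine Sym2.inf_eq_inf_and_sup_eq_sup.1 ⟨Fin.ext h1.1.symm, Fin.ext h1.2.symm⟩

theorem treeTotal_congr {A V : Type*} [CommSemiring A] [Fintype V] [DecidableEq V] {G : SimpleGraph V}
    {P : V → Prop} {ρ σ : V} {d k l r m : ℕ} {ξ ξ' : Sym2 V → ℕ → A}
    (h : ∀ e, ∀ i ≤ m, ξ e i = ξ' e i) :
    treeTotal G P ρ σ d k l r m ξ = treeTotal G P ρ σ d k l r m ξ' := by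
  have h1 : ∀ e X, bitForm (m + 1) (ξ e) X = bitForm (m + 1) (ξ' e) X := fun e X =>
    Finset.sum_congr rfl fun i hi => by rw [h e i (Nat.lt_succ_iff.1 (Finset.mem_range.1 hi))]
  have h2 : ∀ e, ξ e m = ξ' e m := fun e => h e m le_rfl
  simp only [treeTotal, h1, h2]

theorem walkEdges_card_le {V : Type*} [DecidableEq V] (ρ : V) (S : Finset (List V)) :
    (walkEdges ρ S).card ≤ S.card := by
  rw [walkEdges, Multiset.card_map]
  exact Finset.card_erase_le

theorem totalDegree_treeTotal_le {M : ℕ} (g : Sym2 (Fin n) → ℕ → Fin M) :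
    (treeTotal G P ρ σ d k l r m
      fun e i => (MvPolynomial.X (g e i) : MvPolynomial (Fin M) (ZMod 2)[X])).totalDegree ≤ k + r := by
  classical
  refine MvPolynomial.totalDegree_finsetSum_le fun X _ => ?_
  refine MvPolynomial.totalDegree_finsetSum_le fun S hS => ?_
  obtain ⟨-, h1, -, h2⟩ := Finset.mem_filter.1 hS
  refine (MvPolynomial.totalDegree_mul _ _).trans (add_le_add ?_ ?_)
  · refine (MvPolynomial.totalDegree_multiset_prod _).trans ?_
    rw [← h1]
    refine le_trans ?_ (walkEdges_card_le ρ S)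
    rw [Multiset.map_map]
    refine (Multiset.sum_le_card_nsmul _ 1 ?_).trans (by simp)
    intro x hx
    obtain ⟨e, -, rfl⟩ := Multiset.mem_map.1 hx
    simp
  · refine (MvPolynomial.totalDegree_multiset_prod _).trans ?_
    rw [← h2, Multiset.map_map]
    refine (Multiset.sum_le_card_nsmul _ 1 ?_).trans (by simp)
    intro x hx
    obtain ⟨e, -, rfl⟩ := Multiset.mem_map.1 hx
    refine MvPolynomial.totalDegree_finsetSum_le fun i _ => ?_
    refine (MvPolynomial.totalDegree_mul _ _).trans ?_
    rw [MvPolynomial.totalDegree_X]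
    have : ((X / 2 ^ i % 2 : ℕ) : MvPolynomial (Fin M) (ZMod 2)[X]) =
        MvPolynomial.C ((X / 2 ^ i % 2 : ℕ) : (ZMod 2)[X]) := by simp
    rw [this, MvPolynomial.totalDegree_C, zero_add]

/-- The sieved sum over trees of walks, evaluated at random polynomials. -/
noncomputable def randomTotal (G : SimpleGraph (Fin n)) (P : Fin n → Prop) (ρ σ : Fin n)
    (d k l r m w : ℕ) (ω : ℕ → Bool) : ℕ[X] :=
  treeTotal G P ρ σ d k l r m fun e i => coinPoly w ω (pairIndex e * (m + 1) + i)

/-- Reduction modulo 2 gives the sieved sum over a ring of characteristic 2, which vanishes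
identically. -/
theorem randomTotal_coeff_even {w : ℕ} (hkd : k < 2 + d) (hno : ¬ HasKLTree G k l) (ω : ℕ → Bool)
    (i : ℕ) : (randomTotal G P ρ σ d k l r m w ω).coeff i % 2 = 0 := by
  have h : (randomTotal G P ρ σ d k l r m w ω).map (Nat.castRingHom (ZMod 2)) = 0 := by
    have := map_treeTotal (Polynomial.mapRingHom (Nat.castRingHom (ZMod 2))) (G := G) (P := P)
      (ρ := ρ) (σ := σ) (d := d) (k := k) (l := l) (r := r) (m := m)
      (fun e i => coinPoly w ω (pairIndex e * (m + 1) + i))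
    rw [Polynomial.coe_mapRingHom] at this
    rw [randomTotal, this, treeTotal_eq_zero hkd hno]
  have h1 := congrArg (fun p => p.coeff i) h
  simp only [coeff_map, coeff_zero, eq_natCast] at h1
  exact Nat.mod_eq_zero_of_dvd ((ZMod.natCast_eq_zero_iff _ _).1 h1)

theorem randomTotal_coeff_odd {w : ℕ} (hw : (k + r) * 2 ≤ 2 ^ w)
    (ξ : Sym2 (Fin n) → ℕ → (ZMod 2)[X]) (hξ : treeTotal G P ρ σ d k l r m ξ = 1) :
    RAM.coinMeasure {ω | ∀ i, (randomTotal G P ρ σ d k l r m w ω).coeff i % 2 = 0} ≤ 1 / 2 := by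
  have hlt : ∀ (e : Sym2 (Fin n)) i, i ≤ m → pairIndex e * (m + 1) + i < n * n * (m + 1) := by
    intro e i hi
    calc pairIndex e * (m + 1) + i < (pairIndex e + 1) * (m + 1) := by rw [add_mul]; omega
      _ ≤ n * n * (m + 1) := Nat.mul_le_mul_right _ (pairIndex_lt e)
  let g : Sym2 (Fin n) × Fin (m + 1) → Fin (n * n * (m + 1)) := fun x =>
    ⟨pairIndex x.1 * (m + 1) + x.2, hlt _ _ (Nat.lt_succ_iff.1 x.2.2)⟩
  have hg : Function.Injective g := by
    rintro ⟨e, i⟩ ⟨e', i'⟩ h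
    have h1 : pairIndex e * (m + 1) + i = pairIndex e' * (m + 1) + i' := congrArg Fin.val h
    have key : ∀ (e : Sym2 (Fin n)) (i : Fin (m + 1)), (pairIndex e * (m + 1) + i) / (m + 1) =
        pairIndex e ∧ (pairIndex e * (m + 1) + i) % (m + 1) = i := by
      intro e i
      rw [mul_comm]
      constructor
      · rw [Nat.mul_add_div (by omega), Nat.div_eq_of_lt i.2, add_zero]
      · rw [Nat.mul_add_mod, Nat.mod_eq_of_lt i.2]
    have h2 := key e i
    rw [h1, (key e' i').1, (key e' i').2] at h2
    rw [pairIndex_injective h2.1, Fin.ext h2.2]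
  let p : MvPolynomial (Fin (n * n * (m + 1))) (ZMod 2)[X] :=
    treeTotal G P ρ σ d k l r m fun e i => MvPolynomial.X (g (e, Fin.ofNat (m + 1) i))
  have hof : ∀ i, i ≤ m → ((Fin.ofNat (m + 1) i : Fin (m + 1)) : ℕ) = i := by
    intro i hi
    simp [Fin.ofNat, Nat.mod_eq_of_lt (Nat.lt_succ_of_le hi)]
  -- The generic sum does not vanish because it takes the value `1` at the assignment `ξ`, which
  -- extends to all variables as their numbering is injective.
  have hp : p ≠ 0 := by
    intro h0
    have h1 := map_treeTotal (MvPolynomial.eval (Function.extend g (fun x => ξ x.1 x.2) 0))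
      (G := G) (P := P) (ρ := ρ) (σ := σ) (d := d) (k := k) (l := l) (r := r) (m := m)
      (fun e i => (MvPolynomial.X (g (e, Fin.ofNat (m + 1) i)) :
        MvPolynomial (Fin (n * n * (m + 1))) (ZMod 2)[X]))
    rw [show treeTotal G P ρ σ d k l r m _ = p from rfl, h0, map_zero,
      treeTotal_congr (ξ' := ξ), hξ] at h1
    · exact zero_ne_one h1
    · intro e i hi
      rw [MvPolynomial.eval_X, hg.extend_apply, hof i hi]
  refine (measure_mono ?_).trans (coinMeasure_eval_eq_zero_le _ w p hp
    ((Nat.mul_le_mul_right _ (totalDegree_treeTotal_le _)).trans hw))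
  intro ω hω
  simp only [Set.mem_ofPred_eq] at hω ⊢
  rw [show p = treeTotal G P ρ σ d k l r m _ from rfl, map_treeTotal]
  have h2 : treeTotal G P ρ σ d k l r m (fun e i => MvPolynomial.eval
      (fun q : Fin (n * n * (m + 1)) => (coinPoly w ω q).map (Nat.castRingHom (ZMod 2)))
      (MvPolynomial.X (g (e, Fin.ofNat (m + 1) i)))) =
      (randomTotal G P ρ σ d k l r m w ω).map (Nat.castRingHom (ZMod 2)) := by
    rw [randomTotal, ← Polynomial.coe_mapRingHom, map_treeTotal]
    refine treeTotal_congr fun e i hi => ?_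
    rw [MvPolynomial.eval_X, Polynomial.coe_mapRingHom]
    simp only [g, hof i hi]
  rw [h2]
  ext i
  rw [coeff_map, eq_natCast, coeff_zero, ZMod.natCast_eq_zero_iff]
  exact Nat.dvd_of_mod_eq_zero (hω i)

end RandomTotal


/-! ### Packing the sums into natural numbers -/

section Digits

theorem sum_pow_mul_lt {C : ℕ} (a : ℕ → ℕ) (j : ℕ) (h : ∀ i < j, a i < C) :
    ∑ i ∈ Finset.range j, C ^ i * a i < C ^ j := by
  induction j with
  | zero => simp
  | succ j ih =>
    rw [Finset.sum_range_succ]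
    have h1 := ih fun i hi => h i (by omega)
    have h2 : C ^ j * (a j + 1) ≤ C ^ j * C := Nat.mul_le_mul_left _ (h j (by omega))
    rw [pow_succ]
    linarith

/-- Only the digits up to the `j`-th have to be small, so that no carry arrives from below. Terms of
higher exponent may be arbitrarily large: they are multiples of `C ^ (j + 1)`. -/
theorem sum_pow_mul_div_mod {ι : Type*} (s : Finset ι) (m ψ : ι → ℕ) {C : ℕ} (j : ℕ)
    (h : ∀ i ≤ j, ∑ x ∈ s with m x = i, ψ x < C) :
    (∑ x ∈ s, C ^ m x * ψ x) / C ^ j % C = ∑ x ∈ s with m x = j, ψ x := by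
  have hC : 0 < C := (Nat.zero_le _).trans_lt (h j le_rfl)
  have h1 : ∀ i, ∑ x ∈ s with m x = i, C ^ m x * ψ x = C ^ i * ∑ x ∈ s with m x = i, ψ x := by
    intro i
    rw [Finset.mul_sum]
    exact Finset.sum_congr rfl fun x hx => by rw [(Finset.mem_filter.1 hx).2]
  have hlow : ∑ x ∈ s with m x < j, C ^ m x * ψ x < C ^ j := by
    have : ∑ x ∈ s with m x < j, C ^ m x * ψ x =
        ∑ i ∈ Finset.range j, C ^ i * ∑ x ∈ s with m x = i, ψ x := by
      rw [← Finset.sum_fiberwise_of_maps_to (g := m) (t := Finset.range j)]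
      · refine Finset.sum_congr rfl fun i hi => ?_
        rw [← h1, Finset.filter_filter]
        refine Finset.sum_congr (Finset.filter_congr fun x _ => ?_) fun _ _ => rfl
        have := Finset.mem_range.1 hi
        omega
      · intro x hx
        exact Finset.mem_range.2 (Finset.mem_filter.1 hx).2
    rw [this]
    exact sum_pow_mul_lt _ _ fun i hi => h i hi.le
  obtain ⟨c, hc⟩ : C ^ (j + 1) ∣ ∑ x ∈ s with j < m x, C ^ m x * ψ x :=
    Finset.dvd_sum fun x hx => ((pow_dvd_pow C (Finset.mem_filter.1 hx).2).mul_right _)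
  have hsplit : ∑ x ∈ s, C ^ m x * ψ x = ∑ x ∈ s with m x < j, C ^ m x * ψ x +
      C ^ j * (∑ x ∈ s with m x = j, ψ x + C * c) := by
    rw [mul_add, ← h1, ← mul_assoc, ← pow_succ, ← hc,
      ← Finset.sum_filter_add_sum_filter_not s (fun x => m x < j)]
    congr 1
    rw [← Finset.sum_filter_add_sum_filter_not (s.filter fun x => ¬ m x < j) (fun x => m x = j),
      Finset.filter_filter, Finset.filter_filter]
    congr 1
    · exact Finset.sum_congr (Finset.filter_congr fun x _ => by omega) fun _ _ => rfl
    · exact Finset.sum_congr (Finset.filter_congr fun x _ => by omega) fun _ _ => rfl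
  rw [hsplit, Nat.add_mul_div_left _ _ (by positivity), Nat.div_eq_of_lt hlow, zero_add,
    Nat.add_mul_mod_self_left, Nat.mod_eq_of_lt (h j le_rfl)]

theorem eval_div_mod (p : Polynomial ℕ) {B : ℕ} (h : ∀ i, p.coeff i < B) (i : ℕ) :
    p.eval B / B ^ i % B = p.coeff i := by
  classical
  have h1 : p.eval B = ∑ x ∈ Finset.range (max (p.natDegree + 1) (i + 1)), B ^ x * p.coeff x := by
    rw [Polynomial.eval_eq_sum_range' (n := max (p.natDegree + 1) (i + 1)) (by omega)]
    exact Finset.sum_congr rfl fun _ _ => mul_comm _ _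
  have key : ∀ j, (∑ x ∈ Finset.range (max (p.natDegree + 1) (i + 1)) with id x = j, p.coeff x) =
      if j < max (p.natDegree + 1) (i + 1) then p.coeff j else 0 := by
    intro j
    simp only [id, Finset.sum_filter, Finset.sum_ite_eq', Finset.mem_range]
  have h2 := sum_pow_mul_div_mod (Finset.range (max (p.natDegree + 1) (i + 1))) id p.coeff (C := B) i
    (fun j _ => by
      rw [key]
      split_ifs
      · exact h j
      · exact (Nat.zero_le _).trans_lt (h 0))
  rw [key, if_pos (by omega)] at h2
  rw [h1]
  exact h2

theorem coeff_le_eval_one (p : Polynomial ℕ) (i : ℕ) : p.coeff i ≤ p.eval 1 := by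
  rw [Polynomial.eval_eq_sum_range]
  simp only [one_pow, mul_one]
  by_cases h : i < p.natDegree + 1
  · exact Finset.single_le_sum (f := fun i => p.coeff i) (fun _ _ => Nat.zero_le _)
      (Finset.mem_range.2 h)
  · rw [Polynomial.coeff_eq_zero_of_natDegree_lt (by omega)]
    exact Nat.zero_le _

theorem pow_le_eval (p : Polynomial ℕ) (B i : ℕ) (h : p.coeff i ≠ 0) : B ^ i ≤ p.eval B := by
  rw [Polynomial.eval_eq_sum_range]
  have h1 : p.coeff i * B ^ i ≤ ∑ i ∈ Finset.range (p.natDegree + 1), p.coeff i * B ^ i :=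
    Finset.single_le_sum (f := fun i => p.coeff i * B ^ i) (fun _ _ => Nat.zero_le _)
      (Finset.mem_range.2 (Nat.lt_succ_of_le (Polynomial.le_natDegree_of_ne_zero h)))
  exact (Nat.le_mul_of_pos_left _ (Nat.pos_of_ne_zero h)).trans h1

theorem prod_map_le_pow {ι : Type*} (M : Multiset ι) (x : ι → ℕ) (α : ℕ) (h : ∀ e, x e ≤ α) :
    (M.map x).prod ≤ α ^ M.card := by
  induction M using Multiset.induction_on with
  | empty => simp
  | cons e M ih =>
    rw [Multiset.map_cons, Multiset.prod_cons, Multiset.card_cons, pow_succ']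
    exact Nat.mul_le_mul (h e) ih

end Digits

/-! ### Reading the number of nodes, leaves and items from one digit -/

section Packing

set_option linter.unusedSectionVars false

variable {V : Type*} [Fintype V] [DecidableEq V] {G : SimpleGraph V} {P : V → Prop} {ρ σ : V}
  {d k l r m N n : ℕ}

theorem leafCount_le (S : Finset (List V)) : leafCount S ≤ S.card := by
  classical
  rw [leafCount]
  exact Finset.card_filter_le _ _

theorem items_card_le (P : V → Prop) (ρ : V) (S : Finset (List V)) :
    (items P ρ S).card ≤ 2 * S.card := by
  classical
  have h1 : (vertexItems P ρ S).card ≤ S.card := by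
    rw [vertexItems, Multiset.card_map]
    exact Finset.card_filter_le _ _
  have h2 := walkEdges_card_le ρ S
  rw [items, Multiset.card_add, Multiset.card_map]
  have h3 := Multiset.card_le_card (Multiset.filter_le (fun e => ∀ v ∈ e, ¬ P v) (walkEdges ρ S))
  convert (Nat.add_le_add h1 (h3.trans h2)) using 1
  ring

/-- A crude count: such a tree is a set of at most `n` lists of length at most `n`, and such a list
is coded by a function from `Fin n` to `Option V`. -/
theorem card_walkTrees_le (hn : Fintype.card V = n) :
    ((walkTrees G ρ σ d).filter fun S => S.card ≤ n).card ≤ (n + 1) * ((n + 1) ^ n) ^ n := by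
  classical
  let U : Finset (List V) := Finset.univ.image fun f : Fin n → Option V => (List.ofFn f).reduceOption
  have hU : U.card ≤ (n + 1) ^ n := by
    refine Finset.card_image_le.trans ?_
    simp [hn]
  have hmem : ∀ p : List V, p.length ≤ n → p ∈ U := by
    intro p hp
    refine Finset.mem_image.2 ⟨fun i => p[i]?, Finset.mem_univ _, ?_⟩
    have : List.ofFn (fun i : Fin n => p[i]?) = p.map some ++ List.replicate (n - p.length) none := by
      refine List.ext_getElem (by simp; omega) fun i h1 h2 => ?_
      by_cases hi : i < p.length
      · rw [List.getElem_append_left (by simpa using hi)]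
        simp [hi]
      · rw [List.getElem_append_right (by simpa using hi)]
        simp at hi
        simp [hi]
    rw [this, List.reduceOption_append]
    have h3 : (p.map some).reduceOption = p := by
      induction p with
      | nil => rfl
      | cons a p ih => simp [List.reduceOption] 
    have h4 : ∀ j, (List.replicate j (none : Option V)).reduceOption = [] := by
      intro j
      simp [List.reduceOption]
    rw [h3, h4, List.append_nil]
  have hsub : (walkTrees G ρ σ d).filter (fun S => S.card ≤ n) ⊆
      (Finset.range (n + 1)).biUnion fun c => U.powersetCard c := by
    intro S hS
    obtain ⟨h1, h2⟩ := Finset.mem_filter.1 hS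
    refine Finset.mem_biUnion.2 ⟨S.card, Finset.mem_range.2 (by omega),
      Finset.mem_powersetCard.2 ⟨?_, rfl⟩⟩
    intro p hp
    exact hmem p (((Finset.mem_filter.1 h1).2.length_le hp).trans h2)
  refine (Finset.card_le_card hsub).trans ((Finset.card_biUnion_le_card_mul _ _ _ ?_).trans
    (by rw [Finset.card_range]))
  intro c hc
  rw [Finset.card_powersetCard]
  refine (Nat.choose_le_pow _ _).trans ((Nat.pow_le_pow_left hU _).trans ?_)
  exact Nat.pow_le_pow_right (by positivity) (Nat.lt_succ_iff.1 (Finset.mem_range.1 hc))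

/-- The monomial of a tree of walks without the variables that count. -/
noncomputable def treeLabel (P : V → Prop) (ρ : V) (x a : Sym2 V → ℕ) (S : Finset (List V)) : ℕ :=
  ((walkEdges ρ S).map x).prod * ((items P ρ S).map a).prod

theorem sum_treeLabel_le (hn : Fintype.card V = n) {x a : Sym2 V → ℕ} {α β : ℕ} (hx : ∀ e, x e ≤ α)
    (ha : ∀ e, a e ≤ β) (hα : 1 ≤ α) (hβ : 1 ≤ β) (O : Finset (Finset (List V)))
    (hO : ∀ S ∈ O, S ∈ walkTrees G ρ σ d ∧ S.card ≤ n) :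
    ∑ S ∈ O, treeLabel P ρ x a S ≤ (n + 1) * ((n + 1) ^ n) ^ n * (α ^ n * β ^ (2 * n)) := by
  classical
  have hsub : O ⊆ (walkTrees G ρ σ d).filter fun S => S.card ≤ n := fun S hS =>
    Finset.mem_filter.2 (hO S hS)
  refine (Finset.sum_le_card_nsmul _ _ (α ^ n * β ^ (2 * n)) ?_).trans ?_
  · intro S hS
    have hc := (hO S hS).2
    refine Nat.mul_le_mul ((prod_map_le_pow _ _ _ hx).trans (Nat.pow_le_pow_right hα ?_))
      ((prod_map_le_pow _ _ _ ha).trans (Nat.pow_le_pow_right hβ ?_))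
    · exact (walkEdges_card_le _ _).trans hc
    · exact (items_card_le _ _ _).trans (by omega)
  · rw [smul_eq_mul]
    exact Nat.mul_le_mul_right _ ((Finset.card_le_card hsub).trans (card_walkTrees_le hn))

theorem walkSum_div_mod (hn : Fintype.card V = n) (hN : 2 * n < N) (hk : k ≤ n) (hl : l ≤ n)
    (hr : r < N) {x a : Sym2 V → ℕ} {α β C : ℕ} (hx : ∀ e, x e ≤ α)
    (ha : ∀ e, a e ≤ β) (hα : 1 ≤ α) (hβ : 1 ≤ β)
    (hC : (n + 1) * ((n + 1) ^ n) ^ n * (α ^ n * β ^ (2 * n)) < C) :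
    (∑ S ∈ walkTrees G ρ σ d, treeMonomial P ρ (C ^ (N * N)) (C ^ N) C x a S) /
        C ^ ((k * N + l) * N + r) % C = ∑ S ∈ sizedTrees G P ρ σ d k l r, treeLabel P ρ x a S := by
  classical
  -- With the markers `C ^ (N * N)`, `C ^ N` and `C`, the exponent has the numbers of nodes, leaves
  -- and items as its digits in base `N`. For at most `n` nodes all three are at most `2 * n < N`,
  -- so the exponent determines them.
  let wt : Finset (List V) → ℕ := fun S => (S.card * N + leafCount S) * N + (items P ρ S).card
  have h1 : ∀ S, treeMonomial P ρ (C ^ (N * N)) (C ^ N) C x a S = C ^ wt S * treeLabel P ρ x a S := by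
    intro S
    rw [treeMonomial, treeLabel, ← pow_mul, ← pow_mul, ← pow_add, ← pow_add]
    congr 2
    simp only [wt]
    ring
  -- Trees with more than `n` nodes exist in `walkTrees`, but they contribute only above the digit
  -- that is read, so their size needs no bound.
  have h2 : ∀ S : Finset (List V), ∀ i ≤ (k * N + l) * N + r, wt S = i → S.card ≤ n := by
    intro S i hi hS
    by_contra hc
    have h3 : (k + 1) * N * N ≤ S.card * N * N := by gcongr; omega
    have h4 : (k * N + l) * N + r < (k + 1) * N * N := by
      have : k * N + l + 1 ≤ (k + 1) * N := by nlinarith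
      calc (k * N + l) * N + r < (k * N + l + 1) * N := by nlinarith
        _ ≤ _ := Nat.mul_le_mul_right _ this
    have h5 : S.card * N * N ≤ wt S := by
      calc S.card * N * N ≤ (S.card * N + leafCount S) * N := Nat.mul_le_mul_right _ (by omega)
        _ ≤ _ := Nat.le_add_right _ _
    omega
  simp only [h1]
  rw [sum_pow_mul_div_mod _ wt]
  · refine Finset.sum_congr (Finset.filter_congr fun S hS => ?_) fun _ _ => rfl
    constructor
    · intro h
      have hc := h2 S _ le_rfl h
      have h3 := leafCount_le S
      have h4 := items_card_le P ρ S
      have e1 : (S.card * N + leafCount S) * N + (items P ρ S).card = (k * N + l) * N + r := h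
      have e2 : S.card * N + leafCount S = k * N + l ∧ (items P ρ S).card = r := by
        have := congrArg (· % N) e1
        have h5 := congrArg (· / N) e1
        simp only [Nat.mul_add_mod_self_right, Nat.mod_eq_of_lt hr,
          Nat.mod_eq_of_lt (show (items P ρ S).card < N by omega)] at this
        refine ⟨?_, this⟩
        rw [this] at e1
        exact Nat.eq_of_mul_eq_mul_right (by omega) (Nat.add_right_cancel e1)
      have e3 := congrArg (· % N) e2.1
      simp only [Nat.mul_add_mod_self_right, Nat.mod_eq_of_lt (show l < N by omega),
        Nat.mod_eq_of_lt (show leafCount S < N by omega)] at e3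
      have e4 := e2.1
      rw [e3] at e4
      exact ⟨Nat.eq_of_mul_eq_mul_right (show 0 < N by omega) (Nat.add_right_cancel e4), e3, e2.2⟩
    · rintro ⟨e1, e2, e3⟩
      simp only [wt, e1, e2, e3]
  · intro i hi
    refine (sum_treeLabel_le (G := G) (σ := σ) (d := d) hn hx ha hα hβ _ ?_).trans_lt hC
    intro S hS
    obtain ⟨h3, h4⟩ := Finset.mem_filter.1 hS
    exact ⟨h3, h2 S i hi h4⟩

end Packing

/-! ### Bounds for the digits of the random sums -/

section RandomPacking

open Polynomial

variable {n : ℕ} {G : SimpleGraph (Fin n)} {P : Fin n → Prop} {ρ σ : Fin n} {d k l r m N : ℕ}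

theorem eval_coinPoly_le (w : ℕ) (ω : ℕ → Bool) (q B : ℕ) (hB : 1 ≤ B) :
    (coinPoly w ω q).eval B ≤ w * B ^ w := by
  rw [coinPoly, eval_finsetSum]
  refine (Finset.sum_le_card_nsmul _ _ (B ^ w) ?_).trans (by simp)
  intro j hj
  rw [eval_mul, eval_C, eval_pow, eval_X]
  calc (ω (q * w + j)).toNat * B ^ (w - 1 - j) ≤ 1 * B ^ w :=
      Nat.mul_le_mul (Bool.toNat_le _) (Nat.pow_le_pow_right hB (by omega))
    _ = _ := one_mul _

theorem bitForm_le (m X : ℕ) (c : ℕ → ℕ) (α : ℕ) (h : ∀ i, c i ≤ α) : bitForm m c X ≤ m * α := by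
  refine (Finset.sum_le_card_nsmul _ _ α ?_).trans (by simp)
  intro i _
  have : X / 2 ^ i % 2 ≤ 1 := by omega
  calc ((X / 2 ^ i % 2 : ℕ) : ℕ) * c i ≤ 1 * α := Nat.mul_le_mul this (h i)
    _ = α := one_mul _

/-- The value of a random variable. -/
noncomputable def coinValue (w B : ℕ) (ω : ℕ → Bool) (m : ℕ) (e : Sym2 (Fin n)) (i : ℕ) : ℕ :=
  (coinPoly w ω (pairIndex e * (m + 1) + i)).eval B

theorem randomTotal_eval (w B : ℕ) (ω : ℕ → Bool) :
    (randomTotal G P ρ σ d k l r m w ω).eval B = ∑ X ∈ Finset.range (2 ^ r),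
      ∑ S ∈ sizedTrees G P ρ σ d k l r, treeLabel P ρ (fun e => coinValue w B ω m e m)
        (fun e => bitForm (m + 1) (coinValue w B ω m e) X) S := by
  have := map_treeTotal (Polynomial.evalRingHom B) (G := G) (P := P)
      (ρ := ρ) (σ := σ) (d := d) (k := k) (l := l) (r := r) (m := m)
      (fun e i => coinPoly w ω (pairIndex e * (m + 1) + i))
  rw [Polynomial.coe_evalRingHom] at this
  rw [randomTotal, this]
  rfl

theorem randomTotal_eval_le {w B : ℕ} (hw : 1 ≤ w) (hB : 1 ≤ B) (hk : k ≤ n) (ω : ℕ → Bool) :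
    (randomTotal G P ρ σ d k l r m w ω).eval B ≤ 2 ^ r * ((n + 1) * ((n + 1) ^ n) ^ n *
      ((w * B ^ w) ^ n * ((m + 1) * (w * B ^ w)) ^ (2 * n))) := by
  rw [randomTotal_eval]
  refine (Finset.sum_le_card_nsmul _ _ _ ?_).trans (by rw [Finset.card_range, smul_eq_mul])
  intro X _
  have h1 : 1 ≤ w * B ^ w := Nat.one_le_iff_ne_zero.2 (by positivity)
  have h0 : ∀ e i, coinValue (n := n) w B ω m e i ≤ w * B ^ w := fun e i => eval_coinPoly_le _ _ _ _ hB
  refine sum_treeLabel_le (G := G) (σ := σ) (d := d) (Fintype.card_fin n) (fun e => h0 e m)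
    (fun e => bitForm_le _ _ _ _ (h0 e)) h1 (Nat.one_le_iff_ne_zero.2 (by positivity)) _ ?_
  intro S hS
  obtain ⟨h2, h3, -⟩ := Finset.mem_filter.1 hS
  exact ⟨h2, h3.le.trans hk⟩

/-- Used twice. With `E = 0`, evaluation at `1`, it bounds the coefficients of the random total, so
that `2 ^ N ^ 5` can serve as the base. With `E = N ^ 5` it bounds the values at that base, so that
`2 ^ N ^ 11` can serve as the counting marker. -/
theorem label_bound {E : ℕ} (hn : n < N) (hm : m < N) (hr : r ≤ N) (hN : 10 ≤ N) :
    2 ^ r * ((n + 1) * ((n + 1) ^ n) ^ n *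
      ((N * (2 ^ E) ^ N) ^ n * ((m + 1) * (N * (2 ^ E) ^ N)) ^ (2 * n))) <
      2 ^ (2 * N ^ 3 + 3 * N ^ 2 * E) := by
  have h2 : N ≤ 2 ^ N := Nat.lt_two_pow_self.le
  have h1 : n + 1 ≤ 2 ^ N := (Nat.succ_le_of_lt hn).trans h2
  have h3 : m + 1 ≤ 2 ^ N := (Nat.succ_le_of_lt hm).trans h2
  have key : 2 ^ r * ((n + 1) * ((n + 1) ^ n) ^ n *
      ((N * (2 ^ E) ^ N) ^ n * ((m + 1) * (N * (2 ^ E) ^ N)) ^ (2 * n))) ≤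
      2 ^ N * (2 ^ N * ((2 ^ N) ^ N) ^ n *
      ((2 ^ N * (2 ^ E) ^ N) ^ N * (2 ^ N * (2 ^ N * (2 ^ E) ^ N)) ^ (2 * N))) := by
    have hp : ∀ e, 1 ≤ 2 ^ e := fun e => Nat.one_le_two_pow
    gcongr
    all_goals first
      | omega
      | exact Nat.one_le_iff_ne_zero.2 (by positivity)
  refine key.trans_lt ?_
  simp only [← pow_mul, ← pow_add]
  refine Nat.pow_lt_pow_right one_lt_two ?_
  have h4 : N * N * n ≤ N * N * (N - 1) := Nat.mul_le_mul_left _ (by omega)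
  obtain ⟨M, rfl⟩ : ∃ M, N = M + 10 := ⟨N - 10, by omega⟩
  simp only [show M + 10 - 1 = M + 9 by omega] at h4
  nlinarith [Nat.zero_le (M ^ 3), Nat.zero_le (M ^ 2)]

/-- The coefficients are bounded by the value at `1`, hence are the digits in base `2 ^ N ^ 5`. The
base is even, so parities survive. -/
theorem randomTotal_digits (hn : 2 * n < N) (hm : m < N) (hr : r ≤ m) (hN : 10 ≤ N) (hk : k ≤ n)
    (ω : ℕ → Bool) (i : ℕ) :
    (randomTotal G P ρ σ d k l r m N ω).eval (2 ^ N ^ 5) / (2 ^ N ^ 5) ^ i % 2 =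
      (randomTotal G P ρ σ d k l r m N ω).coeff i % 2 := by
  have h1 : ∀ i, (randomTotal G P ρ σ d k l r m N ω).coeff i < 2 ^ N ^ 5 := by
    intro i
    refine (coeff_le_eval_one _ i).trans_lt
      ((randomTotal_eval_le (by omega) le_rfl hk ω).trans_lt ?_)
    have := label_bound (n := n) (m := m) (r := r) (N := N) (E := 0) (by omega) hm (by omega) hN
    rw [pow_zero] at this
    refine this.trans_le (Nat.pow_le_pow_right two_pos ?_)
    have h2 : 2 ≤ N ^ 2 := by nlinarith
    calc 2 * N ^ 3 + 3 * N ^ 2 * 0 ≤ N ^ 2 * N ^ 3 := by simpa using Nat.mul_le_mul_right _ h2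
      _ = N ^ 5 := by ring
  conv_rhs => rw [← eval_div_mod _ h1 i]
  rw [Nat.mod_mod_of_dvd]
  exact dvd_pow_self 2 (by positivity)

theorem exp_bound (hN : 10 ≤ N) : 2 * N ^ 3 + 3 * N ^ 2 * N ^ 5 < N ^ 11 := by
  have h3 : 0 < N ^ 3 := by positivity
  have h7 : N ^ 3 ≤ N ^ 7 := Nat.pow_le_pow_right (by omega) (by norm_num)
  have h4 : 10 ^ 4 ≤ N ^ 4 := Nat.pow_le_pow_left hN 4
  have e1 : N ^ 11 = N ^ 4 * N ^ 7 := by ring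
  have e2 : N ^ 2 * N ^ 5 = N ^ 7 := by ring
  rw [mul_assoc, e2, e1]
  nlinarith

/-- The value at the base is below `2 ^ N ^ 11`, so no coefficient of higher index can be nonzero.
This bounds the number of digits to inspect. -/
theorem randomTotal_digit_index (hn : 2 * n < N) (hm : m < N) (hr : r ≤ m) (hN : 10 ≤ N) (hk : k ≤ n)
    (ω : ℕ → Bool) (i : ℕ) (hi : (randomTotal G P ρ σ d k l r m N ω).coeff i % 2 ≠ 0) :
    i < N ^ 11 := by
  have h1 : (2 ^ N ^ 5) ^ i < 2 ^ N ^ 11 := by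
    refine (pow_le_eval _ _ _ (fun h => hi (by rw [h]))).trans_lt
      ((randomTotal_eval_le (by omega) Nat.one_le_two_pow hk ω).trans_lt ?_)
    refine (label_bound (by omega) hm (by omega) hN).trans_le ?_
    exact Nat.pow_le_pow_right two_pos (exp_bound hN).le
  rw [← pow_mul] at h1
  have h2 := (Nat.pow_lt_pow_iff_right one_lt_two).1 h1
  have h3 : 1 ≤ N ^ 5 := Nat.one_le_iff_ne_zero.2 (by positivity)
  nlinarith

theorem randomTotal_eval_eq (hn : 2 * n < N) (hm : m < N) (hr : r ≤ m) (hN : 10 ≤ N) (hk : k ≤ n)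
    (hl : l ≤ n) (ω : ℕ → Bool) :
    (randomTotal G P ρ σ d k l r m N ω).eval (2 ^ N ^ 5) = ∑ X ∈ Finset.range (2 ^ r),
      (∑ S ∈ walkTrees G ρ σ d, treeMonomial P ρ ((2 ^ N ^ 11) ^ (N * N)) ((2 ^ N ^ 11) ^ N)
        (2 ^ N ^ 11) (fun e => coinValue N (2 ^ N ^ 5) ω m e m)
        (fun e => bitForm (m + 1) (coinValue N (2 ^ N ^ 5) ω m e) X) S) /
        (2 ^ N ^ 11) ^ ((k * N + l) * N + r) % 2 ^ N ^ 11 := by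
  rw [randomTotal_eval]
  refine Finset.sum_congr rfl fun X _ => ?_
  have h0 : ∀ e i, coinValue (n := n) N (2 ^ N ^ 5) ω m e i ≤ N * (2 ^ N ^ 5) ^ N := fun e i =>
    eval_coinPoly_le _ _ _ _ Nat.one_le_two_pow
  have hN0 : 0 < N := by omega
  rw [walkSum_div_mod (Fintype.card_fin n) hn hk hl (by omega) (fun e => h0 e m)
    (fun e => bitForm_le _ _ _ _ (h0 e)) (Nat.one_le_iff_ne_zero.2 (by positivity))
    (Nat.one_le_iff_ne_zero.2 (by positivity))]
  refine lt_of_le_of_lt ?_ ((label_bound (n := n) (m := m) (r := 0) (E := N ^ 5) (by omega) hm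
    (by omega) hN).trans_le (Nat.pow_le_pow_right two_pos (exp_bound hN).le))
  rw [pow_zero, one_mul]

end RandomPacking


/-! ### Resource bounds for the random access machine -/

namespace RAM

instance : Add Expr := ⟨.op .add⟩
instance : Sub Expr := ⟨.op .sub⟩
instance : Mul Expr := ⟨.op .mul⟩
instance : Div Expr := ⟨.op .div⟩
instance : Mod Expr := ⟨.op .mod⟩

/-- The comparison of two expressions. -/
def Expr.lt (e f : Expr) : Expr := .op .lt e f

/-- The test for equality of two expressions. -/
def Expr.eq (e f : Expr) : Expr := .op .eq e f

/-- The power of an expression with constant exponent. -/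
def Expr.pow (e : Expr) : ℕ → Expr
  | 0 => .const 1
  | n + 1 => e.pow n * e

section Eval

variable (s : State) (e f : Expr)

@[simp] theorem eval_const (c : ℕ) : (Expr.const c).eval s = c := rfl
@[simp] theorem eval_read (x : ℕ) : (Expr.read x e).eval s = s.mem (x, e.eval s) := rfl
@[simp] theorem eval_add : (e + f).eval s = e.eval s + f.eval s := rfl
@[simp] theorem eval_sub : (e - f).eval s = e.eval s - f.eval s := rfl
@[simp] theorem eval_mul : (e * f).eval s = e.eval s * f.eval s := rfl
@[simp] theorem eval_div : (e / f).eval s = e.eval s / f.eval s := rfl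
@[simp] theorem eval_mod : (e % f).eval s = e.eval s % f.eval s := rfl
@[simp] theorem eval_lt : (e.lt f).eval s = if e.eval s < f.eval s then 1 else 0 := rfl
@[simp] theorem eval_eq : (e.eq f).eval s = if e.eval s = f.eval s then 1 else 0 := rfl
@[simp] theorem eval_pow (n : ℕ) : (e.pow n).eval s = e.eval s ^ n := by
  induction n with
  | zero => rfl
  | succ n ih => rw [Expr.pow, eval_mul, ih, pow_succ]

end Eval

/-- A constant that bounds the size and the cost of an expression. -/
def Expr.weight : Expr → ℕ
  | .const c => 1 + Nat.size c
  | .read _ i => 2 * i.weight + 2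
  | .op _ e₁ e₂ => e₁.weight + e₂.weight + (e₁.weight + 1) * (e₂.weight + 1)

/-- All cells in use belong to the first `12` arrays, their indices are less than `Q` and their
contents have at most `Q` bits. -/
def State.Bounded (Q : ℕ) (s : State) : Prop :=
  ∀ x i, s.mem (x, i) ≠ 0 → x < 12 ∧ i < Q ∧ s.mem (x, i) < 2 ^ Q

theorem Op.size_eval_le (o : Op) (x y : ℕ) : Nat.size (o.eval x y) ≤ Nat.size x + Nat.size y + 1 := by
  have hx := Nat.lt_size_self x
  have hy := Nat.lt_size_self y
  have hx' : x < 2 ^ (x.size + y.size) := hx.trans_le (Nat.pow_le_pow_right two_pos (by omega))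
  have hy' : y < 2 ^ (x.size + y.size) := hy.trans_le (Nat.pow_le_pow_right two_pos (by omega))
  have h2 : 2 ^ (x.size + y.size) < 2 ^ (x.size + y.size + 1) :=
    Nat.pow_lt_pow_right one_lt_two (by omega)
  rw [Nat.size_le]
  cases o with
  | add => simp only [Op.eval]; rw [pow_succ]; omega
  | sub => simp only [Op.eval]; omega
  | mul =>
    simp only [Op.eval]
    refine lt_of_le_of_lt (Nat.mul_le_mul hx.le hy.le) ?_
    rw [← pow_add]; exact h2
  | div => simp only [Op.eval]; exact (Nat.div_le_self _ _).trans_lt (hx'.trans h2)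
  | mod => simp only [Op.eval]; exact (Nat.mod_le _ _).trans_lt (hx'.trans h2)
  | xor => simp only [Op.eval]; exact (Nat.xor_lt_two_pow hx' hy').trans h2
  | eq =>
    have h1 : 1 < 2 ^ (x.size + y.size + 1) := Nat.one_lt_two_pow (by omega)
    simp only [Op.eval]
    split_ifs <;> omega
  | lt =>
    have h1 : 1 < 2 ^ (x.size + y.size + 1) := Nat.one_lt_two_pow (by omega)
    simp only [Op.eval]
    split_ifs <;> omega

/-- An expression of fixed shape has values of length linear in `Q`, and the product in the cost of
an instruction makes its cost quadratic. -/
theorem Expr.cost_le {Q : ℕ} {s : State} (hs : s.Bounded Q) (e : Expr) :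
    Nat.size (e.eval s) ≤ e.weight * (Q + 1) ∧ e.cost s ≤ e.weight * (Q + 1) ^ 2 := by
  induction e with
  | const c =>
    simp only [Expr.eval, Expr.weight, Expr.cost]
    constructor
    · nlinarith [Nat.zero_le (Nat.size c), Nat.zero_le Q]
    · exact Nat.le_mul_of_pos_right _ (by positivity)
  | read x i ih =>
    have h : Nat.size (s.mem (x, i.eval s)) ≤ Q := by
      by_cases h : s.mem (x, i.eval s) = 0
      · rw [h]; simp
      · exact Nat.size_le.2 (hs _ _ h).2.2
    simp only [Expr.eval, Expr.weight, Expr.cost]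
    constructor
    · nlinarith
    · nlinarith
  | op o e₁ e₂ ih₁ ih₂ =>
    have h := o.size_eval_le (e₁.eval s) (e₂.eval s)
    simp only [Expr.eval, Expr.weight, Expr.cost]
    constructor
    · nlinarith
    · have : (Nat.size (e₁.eval s) + 1) * (Nat.size (e₂.eval s) + 1) ≤
          ((e₁.weight + 1) * (Q + 1)) * ((e₂.weight + 1) * (Q + 1)) :=
        Nat.mul_le_mul (by nlinarith) (by nlinarith)
      nlinarith

theorem State.Bounded.space_le {Q : ℕ} {s : State} (hs : s.Bounded Q) :
    s.space ≤ 12 * Q * (2 * Q + 4) := by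
  have h1 : s.mem.support ⊆ Finset.range 12 ×ˢ Finset.range Q := by
    rintro ⟨x, i⟩ h
    have := hs x i (Finsupp.mem_support_iff.1 h)
    exact Finset.mem_product.2 ⟨Finset.mem_range.2 this.1, Finset.mem_range.2 this.2.1⟩
  refine (Finset.sum_le_card_nsmul _ _ (2 * Q + 4) ?_).trans ?_
  · rintro ⟨x, i⟩ h
    have h2 := hs x i (Finsupp.mem_support_iff.1 h)
    have e1 : Nat.size x ≤ 4 := Nat.size_le.2 (by have := h2.1; norm_num; omega)
    have e2 : Nat.size i ≤ Q := Nat.size_le.2 (h2.2.1.trans Nat.lt_two_pow_self)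
    have e3 : Nat.size (s.mem (x, i)) ≤ Q := Nat.size_le.2 h2.2.2
    simp only
    omega
  · rw [smul_eq_mul]
    refine Nat.mul_le_mul_right _ ((Finset.card_le_card h1).trans ?_)
    simp

theorem write_mem (s : State) (x i v y j : ℕ) :
    (s.write x i v).mem (y, j) = if y = x ∧ j = i then v else s.mem (y, j) := by
  classical
  simp [State.write, Function.update_apply]

@[simp] theorem write_mem_self (s : State) (x i v : ℕ) : (s.write x i v).mem (x, i) = v := by
  rw [write_mem, if_pos ⟨rfl, rfl⟩]

theorem write_mem_of_ne (s : State) {x y : ℕ} (h : y ≠ x) (i v j : ℕ) :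
    (s.write x i v).mem (y, j) = s.mem (y, j) := by
  rw [write_mem, if_neg fun h' => h h'.1]

@[simp] theorem write_coins (s : State) (x i v : ℕ) : (s.write x i v).coins = s.coins := rfl

theorem toss_mem (s : State) (ω : ℕ → Bool) (x i : ℕ) (p : ℕ × ℕ) :
    (s.toss ω x i).mem p = (s.write x i (ω s.coins).toNat).mem p := rfl

@[simp] theorem toss_coins (s : State) (ω : ℕ → Bool) (x i : ℕ) :
    (s.toss ω x i).coins = s.coins + 1 := rfl

theorem State.Bounded.write {Q : ℕ} {s : State} (hs : s.Bounded Q) {x i v : ℕ} (hx : x < 12)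
    (hi : i < Q) (hv : v < 2 ^ Q) : (s.write x i v).Bounded Q := by
  intro y j h
  rw [write_mem] at h ⊢
  split_ifs at h ⊢ with h1
  · exact ⟨h1.1 ▸ hx, h1.2 ▸ hi, hv⟩
  · exact hs y j h

/-- `Steps Q ω P s s' t`: the program `P` started in state `s` halts in state `s'` after at most `t`
steps, and writes only numbers with at most `Q` bits to cells with indices less than `Q`. -/
inductive Steps (Q : ℕ) (ω : ℕ → Bool) : Program → State → State → ℕ → Prop
  | store {x i v : ℕ} {ie e : Expr} {s : State} : x < 12 → ie.eval s = i → i < Q → e.eval s = v →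
      v < 2 ^ Q → Steps Q ω (.store x ie e) s (s.write x i v) 1
  | toss {x i : ℕ} {ie : Expr} {s : State} : x < 12 → ie.eval s = i → i < Q →
      Steps Q ω (.toss x ie) s (s.toss ω x i) 1
  | seq {P P' : Program} {s s₁ s₂ : State} {t₁ t₂ : ℕ} : Steps Q ω P s s₁ t₁ →
      Steps Q ω P' s₁ s₂ t₂ → Steps Q ω (.seq P P') s s₂ (t₁ + t₂)
  | cond_true {e : Expr} {P P' : Program} {s s₁ : State} {t : ℕ} : e.eval s ≠ 0 →
      Steps Q ω P s s₁ t → Steps Q ω (.cond e P P') s s₁ (t + 1)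
  | cond_false {e : Expr} {P P' : Program} {s s₁ : State} {t : ℕ} : e.eval s = 0 →
      Steps Q ω P' s s₁ t → Steps Q ω (.cond e P P') s s₁ (t + 1)
  | loop_true {e : Expr} {P : Program} {s s₁ s₂ : State} {t₁ t₂ : ℕ} : e.eval s ≠ 0 →
      Steps Q ω P s s₁ t₁ → Steps Q ω (.loop e P) s₁ s₂ t₂ →
      Steps Q ω (.loop e P) s s₂ (t₁ + t₂ + 1)
  | loop_false {e : Expr} {P : Program} {s : State} : e.eval s = 0 → Steps Q ω (.loop e P) s s 1
  | mono {P : Program} {s s₁ : State} {t t' : ℕ} : Steps Q ω P s s₁ t → t ≤ t' →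
      Steps Q ω P s s₁ t'

/-- A constant that bounds the cost of a single step of a program. -/
def Program.weight : Program → ℕ
  | .skip => 1
  | .store _ i e => 2 * i.weight + 2 * e.weight + 1
  | .toss _ i => 2 * i.weight + 2
  | .seq P P' => P.weight + P'.weight
  | .cond e P P' => e.weight + 1 + P.weight + P'.weight
  | .loop e P => e.weight + 1 + P.weight

/-- As long as all memory stays bounded, one step costs at most a constant times `(Q + 1) ^ 2` and
the space is polynomial in `Q`. From here on only steps and the sizes of written numbers have to be
counted. -/
theorem Steps.run {Q : ℕ} {ω : ℕ → Bool} {P : Program} {s s' : State} {τ : ℕ}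
    (h : Steps Q ω P s s' τ) (hs : s.Bounded Q) : s'.Bounded Q ∧ ∃ t m, Run ω P s s' t m ∧
      t ≤ τ * (P.weight * (Q + 1) ^ 2) ∧ m ≤ 12 * Q * (2 * Q + 4) := by
  have hQ : Q + 1 ≤ (Q + 1) ^ 2 := by nlinarith
  have hQ1 : 1 ≤ (Q + 1) ^ 2 := by nlinarith
  induction h with
  | @store x i v ie e s hx hi hiQ he hv =>
    have h1 := hs.write hx hiQ hv
    have h2 := ie.cost_le hs
    have h3 := e.cost_le hs
    subst hi he
    refine ⟨h1, _, _, Run.store x ie e s, ?_, max_le hs.space_le h1.space_le⟩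
    simp only [Program.weight]
    nlinarith
  | @toss x i ie s hx hi hiQ =>
    have h1 : (s.toss ω x i).Bounded Q :=
      hs.write hx hiQ (lt_of_le_of_lt (Bool.toNat_le _) (Nat.one_lt_two_pow (by omega)))
    have h2 := ie.cost_le hs
    subst hi
    refine ⟨h1, _, _, Run.toss x ie s, ?_, max_le hs.space_le h1.space_le⟩
    simp only [Program.weight]
    nlinarith
  | seq _ _ ih₁ ih₂ =>
    obtain ⟨hs₁, t₁, m₁, r₁, e₁, f₁⟩ := ih₁ hs
    obtain ⟨hs₂, t₂, m₂, r₂, e₂, f₂⟩ := ih₂ hs₁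
    refine ⟨hs₂, _, _, Run.seq r₁ r₂, ?_, max_le f₁ f₂⟩
    rw [add_mul]
    refine Nat.add_le_add (e₁.trans ?_) (e₂.trans ?_) <;> gcongr <;> simp only [Program.weight] <;> omega
  | @cond_true e P P' s s₁ t he _ ih =>
    obtain ⟨hs₁, t₁, m₁, r₁, e₁, f₁⟩ := ih hs
    refine ⟨hs₁, _, _, Run.cond_true he r₁, ?_, f₁⟩
    have h2 := (e.cost_le hs).2
    simp only [Program.weight]
    have h3 : t * (P.weight * (Q + 1) ^ 2) ≤
        t * ((e.weight + 1 + P.weight + P'.weight) * (Q + 1) ^ 2) := by gcongr; omega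
    nlinarith
  | @cond_false e P P' s s₁ t he _ ih =>
    obtain ⟨hs₁, t₁, m₁, r₁, e₁, f₁⟩ := ih hs
    refine ⟨hs₁, _, _, Run.cond_false he r₁, ?_, f₁⟩
    have h2 := (e.cost_le hs).2
    simp only [Program.weight]
    have h3 : t * (P'.weight * (Q + 1) ^ 2) ≤
        t * ((e.weight + 1 + P.weight + P'.weight) * (Q + 1) ^ 2) := by gcongr; omega
    nlinarith
  | @loop_true e P s s₁ s₂ t t' he _ _ ih₁ ih₂ =>
    obtain ⟨hs₁, t₁, m₁, r₁, e₁, f₁⟩ := ih₁ hs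
    obtain ⟨hs₂, t₂, m₂, r₂, e₂, f₂⟩ := ih₂ hs₁
    refine ⟨hs₂, _, _, Run.loop_true he r₁ r₂, ?_, max_le f₁ f₂⟩
    have h2 := (e.cost_le hs).2
    simp only [Program.weight] at e₂ ⊢
    have h3 : t * (P.weight * (Q + 1) ^ 2) ≤ t * ((e.weight + 1 + P.weight) * (Q + 1) ^ 2) := by
      gcongr; omega
    nlinarith
  | @loop_false e P s he =>
    refine ⟨hs, _, _, Run.loop_false he, ?_, hs.space_le⟩
    have h2 := (e.cost_le hs).2
    simp only [Program.weight]
    nlinarith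
  | mono _ hle ih =>
    obtain ⟨hs₁, t₁, m₁, r₁, e₁, f₁⟩ := ih hs
    exact ⟨hs₁, _, _, r₁, e₁.trans (Nat.mul_le_mul_right _ hle), f₁⟩

/-- `Accepts` asks for some accepting run; determinism identifies it with the run that has been
constructed. -/
theorem Run.deterministic {ω : ℕ → Bool} {P : Program} {s s₁ : State} {t m : ℕ}
    (h : Run ω P s s₁ t m) : ∀ {s₂ t' m'}, Run ω P s s₂ t' m' → s₁ = s₂ := by
  induction h with
  | skip => intro _ _ _ h; cases h; rfl
  | store => intro _ _ _ h; cases h; rfl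
  | toss => intro _ _ _ h; cases h; rfl
  | seq _ _ ih₁ ih₂ =>
    intro _ _ _ h
    cases h with
    | seq h₁ h₂ =>
      cases ih₁ h₁
      exact ih₂ h₂
  | cond_true he _ ih =>
    intro _ _ _ h
    cases h with
    | cond_true _ h => exact ih h
    | cond_false he' _ => exact absurd he' he
  | cond_false he _ ih =>
    intro _ _ _ h
    cases h with
    | cond_true he' h => exact absurd he he'
    | cond_false _ h => exact ih h
  | loop_true he _ _ ih₁ ih₂ =>
    intro _ _ _ h
    cases h with
    | loop_true _ h₁ h₂ =>
      cases ih₁ h₁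
      exact ih₂ h₂
    | loop_false he' => exact absurd he' he
  | loop_false he =>
    intro _ _ _ h
    cases h with
    | loop_true he' _ _ => exact absurd he he'
    | loop_false _ => rfl

/-- Two states with the same contents outside of the arrays `L`. -/
def AgreeOff (L : List ℕ) (s s' : State) : Prop := ∀ y, y ∉ L → ∀ j, s'.mem (y, j) = s.mem (y, j)

theorem AgreeOff.trans {L : List ℕ} {s s' s'' : State} (h : AgreeOff L s s') (h' : AgreeOff L s' s'') :
    AgreeOff L s s'' := fun y hy j => (h' y hy j).trans (h y hy j)

theorem AgreeOff.mono {L L' : List ℕ} {s s' : State} (h : AgreeOff L s s') (hL : L ⊆ L') :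
    AgreeOff L' s s' := fun y hy j => h y (fun h => hy (hL h)) j

theorem agreeOff_write {L : List ℕ} (s : State) {x : ℕ} (hx : x ∈ L) (i v : ℕ) :
    AgreeOff L s (s.write x i v) := fun y hy j =>
  write_mem_of_ne s (by rintro rfl; exact hy hx) i v j

/-- The loop that runs the body for each value of the counter below a bound. -/
def forLoop (x : ℕ) (bound : Expr) (body : Program) : Program :=
  .seq (.store x (.const 0) (.const 0)) (.loop ((Expr.read x (.const 0)).lt bound)
    (.seq body (.store x (.const 0) (Expr.read x (.const 0) + .const 1))))

/-- The bound of the loop is evaluated anew in every round, so the invariant must fix its value and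
that of the counter. -/
theorem Steps.forLoop {Q : ℕ} {ω : ℕ → Bool} {x : ℕ} {bound : Expr} {body : Program} {n τ : ℕ}
    (hx : x < 12) (hn : n < 2 ^ Q) (hQ : 0 < Q) (I : ℕ → State → Prop)
    (hI : ∀ i s, I i s → s.mem (x, 0) = i ∧ bound.eval s = n)
    (hbody : ∀ i < n, ∀ s, I i s → ∃ s', Steps Q ω body s s' τ ∧ s'.mem (x, 0) = i ∧
      I (i + 1) (s'.write x 0 (i + 1)))
    {s : State} (hs : I 0 (s.write x 0 0)) :
    ∃ s', Steps Q ω (RAM.forLoop x bound body) s s' (n * (τ + 2) + 2) ∧ I n s' := by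
  have key : ∀ j i s, i + j = n → I i s → ∃ s', Steps Q ω (.loop ((Expr.read x (.const 0)).lt bound)
      (.seq body (.store x (.const 0) (Expr.read x (.const 0) + .const 1)))) s s'
      (j * (τ + 2) + 1) ∧ I n s' := by
    intro j
    induction j with
    | zero =>
      intro i s hi hs
      obtain ⟨h1, h2⟩ := hI i s hs
      refine ⟨s, ?_, by simpa [← hi] using hs⟩
      rw [zero_mul, zero_add]
      refine Steps.loop_false ?_
      simp [h1, h2]; omega
    | succ j ih =>
      intro i s hi hs
      obtain ⟨h1, h2⟩ := hI i s hs
      obtain ⟨s₁, h3, h4, h5⟩ := hbody i (by omega) s hs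
      obtain ⟨s₂, h6, h7⟩ := ih (i + 1) _ (by omega) h5
      refine ⟨s₂, ?_, h7⟩
      refine Steps.mono (Steps.loop_true ?_ (Steps.seq h3 (Steps.store hx rfl hQ ?_ ?_)) h6) ?_
      · simp [h1, h2]; omega
      · simp [h4]
      · omega
      · rw [add_mul]; omega
  obtain ⟨s', h1, h2⟩ := key n 0 _ (by omega) hs
  refine ⟨s', Steps.mono (Steps.seq (Steps.store hx (i := 0) rfl hQ rfl (by positivity)) h1) (by omega), h2⟩

/-- The program that fills a table from left to right. -/
def fill (T x : ℕ) (init len e : Expr) : Program :=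
  .seq (.store T (.const 0) init)
    (RAM.forLoop x len (.store T (Expr.read x (.const 0) + .const 1) e))

theorem Steps.fill {Q : ℕ} {ω : ℕ → Bool} {T x : ℕ} {init len e : Expr} {n : ℕ} (hT : T < 12)
    (hx : x < 12) (hTx : T ≠ x) (hn : n < Q) (F : ℕ → ℕ) {s : State} (h0 : init.eval s = F 0)
    (hF : ∀ i ≤ n, F i < 2 ^ Q) (hlen : ∀ s', AgreeOff [T, x] s s' → len.eval s' = n)
    (he : ∀ i < n, ∀ s', AgreeOff [T, x] s s' → s'.mem (x, 0) = i → (∀ j ≤ i, s'.mem (T, j) = F j) →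
      e.eval s' = F (i + 1)) :
    ∃ s', Steps Q ω (RAM.fill T x init len e) s s' (n * 3 + 3) ∧ AgreeOff [T, x] s s' ∧
      (∀ j ≤ n, s'.mem (T, j) = F j) ∧ s'.coins = s.coins := by
  obtain ⟨s', h1, h2, h3, h4, h5⟩ := Steps.forLoop (Q := Q) (ω := ω) (x := x) (bound := len)
    (body := .store T (Expr.read x (.const 0) + .const 1) e) (n := n) (τ := 1) hx
    (hn.trans Nat.lt_two_pow_self) (by omega)
    (fun i s' => AgreeOff [T, x] s s' ∧ s'.mem (x, 0) = i ∧
      (∀ j ≤ i, s'.mem (T, j) = F j) ∧ s'.coins = s.coins)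
    (fun i s' h => ⟨h.2.1, hlen s' h.1⟩)
    (fun i hi s' h => by
      refine ⟨_, Steps.store hT (i := i + 1) (by simp [h.2.1]) (by omega) (he i hi s' h.1 h.2.1 h.2.2.1)
        (hF _ (by omega)), ?_, ?_, ?_, ?_, h.2.2.2⟩
      · rw [write_mem_of_ne _ hTx.symm, h.2.1]
      · exact (h.1.trans (agreeOff_write _ (by simp) _ _)).trans (agreeOff_write _ (by simp) _ _)
      · simp
      · intro j hj
        rw [write_mem_of_ne _ hTx, write_mem]
        split_ifs with h5
        · rw [h5.2]
        · refine h.2.2.1 j ?_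
          by_contra h6
          exact h5 ⟨rfl, by omega⟩)
    (s := s.write T 0 (F 0))
    (by
      refine ⟨(agreeOff_write _ (by simp) _ _).trans (agreeOff_write _ (by simp) _ _), by simp, ?_, rfl⟩
      intro j hj
      rw [write_mem_of_ne _ hTx, Nat.le_zero.1 hj]
      simp)
  exact ⟨s', Steps.mono (Steps.seq (Steps.store hT (i := 0) rfl (by omega) h0 (hF 0 (by omega))) h1)
    (by omega), h2, h4, h5⟩

end RAM


/-! ### The input -/

namespace RAM

theorem start_mem (input : List ℕ) (x i : ℕ) :
    (start input).mem (x, i) = if x = 0 then input.getD i 0 else 0 := by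
  classical
  rw [start]
  simp only [Finsupp.coe_finsetSum, Finset.sum_apply, Finsupp.single_apply, Prod.mk.injEq]
  by_cases hx : x = 0
  · subst hx
    simp only [true_and, if_true, Finset.sum_ite_eq', Finset.mem_range]
    split_ifs with h
    · rfl
    · rw [List.getD_eq_default _ _ (by omega)]
  · simp [hx, Ne.symm hx]

end RAM

section Input

variable {n a : ℕ} (G : SimpleGraph (Fin n)) (c : Fin n → Finset (Fin a)) (k l : ℕ)

theorem flatten_ofFn_getD {m q : ℕ} (f : Fin m → Fin q → ℕ) (u : Fin m) (v : Fin q) :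
    (List.ofFn fun u => List.ofFn fun v => f u v).flatten.getD (u * q + v) 0 = f u v := by
  have h : (u : ℕ) * q + v < m * q := by
    calc (u : ℕ) * q + v < (u + 1) * q := by rw [add_mul]; omega
      _ ≤ m * q := Nat.mul_le_mul_right _ u.2
  have h1 : (List.ofFn fun u => List.ofFn fun v => f u v).flatten =
      List.ofFn fun i : Fin (m * q) => f i.divNat i.modNat := by
    rw [List.ofFn_mul]
    congr 2
    funext i
    congr 1
    funext j
    congr 1
    · refine Fin.ext ?_
      simp only [Fin.coe_divNat]
      rw [mul_comm, Nat.mul_add_div (by have := j.2; omega), Nat.div_eq_of_lt j.2, add_zero]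
    · refine Fin.ext ?_
      simp only [Fin.coe_modNat]
      rw [mul_comm, Nat.mul_add_mod, Nat.mod_eq_of_lt j.2]
  rw [h1, List.getD_eq_getElem _ _ (by simpa using h), List.getElem_ofFn]
  congr 1
  · refine Fin.ext ?_
    simp only [Fin.coe_divNat]
    rw [mul_comm, Nat.mul_add_div (by have := v.2; omega), Nat.div_eq_of_lt v.2, add_zero]
  · refine Fin.ext ?_
    simp only [Fin.coe_modNat]
    rw [mul_comm, Nat.mul_add_mod, Nat.mod_eq_of_lt v.2]

theorem flatten_ofFn_length {m q : ℕ} (f : Fin m → Fin q → ℕ) :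
    (List.ofFn fun u => List.ofFn fun v => f u v).flatten.length = m * q := by
  simp [List.length_flatten, List.map_ofFn, List.sum_ofFn]

theorem encodeInstance_length : (encodeInstance G c k l).length = 3 + n * n + n * a := by
  rw [encodeInstance, List.length_append, List.length_append, flatten_ofFn_length,
    flatten_ofFn_length]
  rfl

open scoped Classical in
theorem encodeInstance_adj (u v : Fin n) :
    (encodeInstance G c k l).getD (3 + u * n + v) 0 = if G.Adj u v then 1 else 0 := by
  have h : (u : ℕ) * n + v < n * n := by
    calc (u : ℕ) * n + v < (u + 1) * n := by rw [add_mul]; omega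
      _ ≤ n * n := Nat.mul_le_mul_right _ u.2
  rw [encodeInstance, List.getD_append, List.getD_append_right, ← flatten_ofFn_getD (fun u v =>
    if G.Adj u v then 1 else 0) u v]
  · congr 1
    simp only [List.length_cons, List.length_nil]
    omega
  · simp only [List.length_cons, List.length_nil]
    omega
  · rw [List.length_append, flatten_ofFn_length]
    simp only [List.length_cons, List.length_nil]
    omega

open scoped Classical in
theorem encodeInstance_color (v : Fin n) (i : Fin a) :
    (encodeInstance G c k l).getD (3 + n * n + v * a + i) 0 = if i ∈ c v then 1 else 0 := by
  rw [encodeInstance, List.getD_append_right, ← flatten_ofFn_getD (fun u i =>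
    if i ∈ c u then 1 else 0) v i]
  · congr 1
    rw [List.length_append, flatten_ofFn_length]
    simp only [List.length_cons, List.length_nil]
    omega
  · rw [List.length_append, flatten_ofFn_length]
    simp only [List.length_cons, List.length_nil]
    omega

end Input


/-! ### The expressions of the program -/

namespace TreeSearch

open RAM

/-- The constants on which the program depends. -/
structure Params where
  a : ℕ
  A : ℕ
  B : ℕ
  D : ℕ
  c : ℕ

/-- The number of vertices. -/
def nE : Expr := .read 0 (.const 0)

/-- The number of vertices of the tree. -/
def kE : Expr := .read 0 (.const 1)

/-- The number of leaves of the tree. -/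
def lE : Expr := .read 0 (.const 2)

/-- The outer counter. -/
def jE : Expr := .read 1 (.const 0)

/-- The counter of the sieve. -/
def xE : Expr := .read 2 (.const 0)

/-- The inner counter. -/
def iE : Expr := .read 3 (.const 0)

/-- A power of two. -/
def twoPowE (e : Expr) : Expr := .read 5 e

/-- Logical negation. -/
def notE (e : Expr) : Expr := .const 1 - e

/-- A case distinction. -/
def iteE (e f g : Expr) : Expr := e * f + notE e * g

/-- Whether two vertices are adjacent. -/
def adjE (u v : Expr) : Expr := .read 0 (.const 3 + u * nE + v)

/-- The number of an unordered pair of vertices. -/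
def pairE (u v : Expr) : Expr := iteE (u.lt v) (u * nE + v) (v * nE + u)

namespace Params

variable (p : Params)

/-- A number larger than all the lengths involved. -/
def sizeE : Expr := .const p.c * (nE + .const 1)

/-- The number of labels. -/
def labelsE : Expr := (.const p.A * kE + .const p.B * lE) / .const p.D

/-- The set of colors. -/
def maskE : Expr := jE % .const (2 ^ p.a)

/-- The root. -/
def rootE : Expr := jE / .const (2 ^ p.a) % nE

/-- The neighbor of the root. -/
def stemE : Expr := jE / .const (2 ^ p.a) / nE % nE

/-- The number of items. -/
def itemsE : Expr := jE / .const (2 ^ p.a) / nE / nE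

/-- The number of the first `i` colors of a vertex that belong to the set of colors. -/
def hitsE (v : Expr) : ℕ → Expr
  | 0 => .const 0
  | i + 1 => hitsE v i + .read 0 (.const 3 + nE * nE + v * .const p.a + .const i) *
      (p.maskE / .const (2 ^ i) % .const 2)

/-- Whether a vertex has a color from the set. -/
def hitE (v : Expr) : Expr := (Expr.const 0).lt (p.hitsE v p.a)

/-- The variable of the polynomials. -/
def baseE : Expr := twoPowE (p.sizeE.pow 5)

/-- A power of the counting variable. -/
def countE (e : Expr) : Expr := twoPowE (p.sizeE.pow 11 * e)

/-- The value of an edge variable. -/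
def edgeVarE (u v : Expr) : Expr :=
  .read 6 ((pairE u v * (p.labelsE + .const 1) + p.labelsE + .const 1) * p.sizeE)

/-- The value of an item. -/
def itemVarE (u v : Expr) : Expr := .read 7 ((pairE u v + .const 1) * (p.labelsE + .const 1))

/-- The weight of an edge. -/
def edgeE (leaf : Bool) (u v : Expr) : Expr :=
  adjE u v * notE (v.eq p.rootE) * p.countE (p.sizeE * p.sizeE) * p.edgeVarE u v *
    iteE (p.hitE u * p.hitE v) (p.countE (.const 1) * p.itemVarE u v) (.const 1) *
    iteE (if leaf then .const 1 else notE (p.hitE v)) (p.countE (.const 1) * p.itemVarE v v)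
      (.const 1) *
    (if leaf then p.countE p.sizeE else .const 1)

/-- The position of the digit that counts. -/
def digitE : Expr := (kE * p.sizeE + lE) * p.sizeE + p.itemsE

end Params

/-- An input. -/
structure Inst (p : Params) where
  n : ℕ
  G : SimpleGraph (Fin n)
  c : Fin n → Finset (Fin p.a)
  k : ℕ
  l : ℕ

namespace Inst

set_option linter.unusedSectionVars false

variable {p : Params} (I : Inst p)

/-- The encoded input. -/
noncomputable def input : List ℕ := encodeInstance I.G I.c I.k I.l

/-- The value of `sizeE`. -/
def size : ℕ := p.c * (I.n + 1)

/-- The value of `labelsE`. -/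
def labels : ℕ := (p.A * I.k + p.B * I.l) / p.D

/-- The vertices without a color from a set. -/
def Free (T : ℕ) (v : Fin I.n) : Prop := ∀ i ∈ I.c v, T / 2 ^ (i : ℕ) % 2 = 0

/-- The value of `baseE`. -/
def base : ℕ := 2 ^ I.size ^ 5

/-- The value of the counting variable. -/
def count : ℕ := 2 ^ I.size ^ 11

/-- The value of a random variable. -/
noncomputable def var (ω : ℕ → Bool) (e : Sym2 (Fin I.n)) (i : ℕ) : ℕ :=
  coinValue I.size I.base ω I.labels e i

/-- The conditions on the size of the input. -/
structure Small : Prop where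
  one_le_k : 1 ≤ I.k
  k_le : I.k ≤ I.n
  l_le : I.l ≤ I.n
  one_le_D : 1 ≤ p.D
  le_c : p.A + p.B + 2 ^ p.a + 10 ≤ p.c

/-- The memory holds the input. -/
def Holds (s : State) : Prop := ∀ i, s.mem (0, i) = I.input.getD i 0

/-- The memory holds the input and the tables of powers and of random variables. -/
structure Ready (ω : ℕ → Bool) (s : State) : Prop where
  holds : I.Holds s
  pow : ∀ i ≤ I.size ^ 14, s.mem (5, i) = 2 ^ i
  rnd : ∀ q < I.n * I.n * (I.labels + 1),
    s.mem (6, (q + 1) * I.size) = (coinPoly I.size ω q).eval I.base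

variable {I}

theorem Holds.agree {L : List ℕ} {s s' : State} (h : I.Holds s) (hs : AgreeOff L s s') (h0 : 0 ∉ L) :
    I.Holds s' := fun i => (hs 0 h0 i).trans (h i)

theorem Ready.agree {ω : ℕ → Bool} {L : List ℕ} {s s' : State} (h : I.Ready ω s)
    (hs : AgreeOff L s s') (h0 : 0 ∉ L) (h5 : 5 ∉ L) (h6 : 6 ∉ L) : I.Ready ω s' :=
  ⟨h.holds.agree hs h0, fun i hi => (hs 5 h5 _).trans (h.pow i hi),
    fun q hq => (hs 6 h6 _).trans (h.rnd q hq)⟩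

namespace Holds

variable {s : State} (h : I.Holds s)
include h

theorem eval_n : nE.eval s = I.n := h 0

theorem eval_k : kE.eval s = I.k := h 1

theorem eval_l : lE.eval s = I.l := h 2

theorem eval_size : p.sizeE.eval s = I.size := by
  simp [Params.sizeE, h.eval_n, size]

theorem eval_labels : p.labelsE.eval s = I.labels := by
  simp [Params.labelsE, h.eval_k, h.eval_l, labels]

open scoped Classical in
theorem eval_adj {u v : Expr} {u' v' : Fin I.n} (hu : u.eval s = u') (hv : v.eval s = v') :
    (adjE u v).eval s = if I.G.Adj u' v' then 1 else 0 := by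
  rw [adjE, eval_read, ← encodeInstance_adj I.G I.c I.k I.l]
  simp only [eval_add, eval_mul, eval_const, h.eval_n, hu, hv]
  exact h _

theorem eval_pair {u v : Expr} {u' v' : Fin I.n} (hu : u.eval s = u') (hv : v.eval s = v') :
    (pairE u v).eval s = pairIndex s(u', v') := by
  rw [pairIndex_mk]
  simp only [pairE, iteE, notE, eval_add, eval_mul, eval_sub, eval_lt, eval_const, h.eval_n, hu, hv]
  rcases Nat.lt_or_ge (u' : ℕ) v' with h1 | h1
  · simp [h1, min_eq_left h1.le, max_eq_right h1.le]
  · simp [not_lt.2 h1, min_eq_right h1, max_eq_left h1]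

open scoped Classical in
theorem eval_hits {T : ℕ} (hT : p.maskE.eval s = T) {v : Expr} {v' : Fin I.n} (hv : v.eval s = v')
    (i : ℕ) (hi : i ≤ p.a) : (p.hitsE v i).eval s = ∑ j : Fin i,
      (if (⟨j, j.2.trans_le hi⟩ : Fin p.a) ∈ I.c v' then 1 else 0) * (T / 2 ^ (j : ℕ) % 2) := by
  induction i with
  | zero => rfl
  | succ i ih =>
    rw [Fin.sum_univ_castSucc, Params.hitsE, eval_add, ih (by omega)]
    congr 1
    have := encodeInstance_color I.G I.c I.k I.l v' ⟨i, hi⟩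
    simp only [eval_mul, eval_mod, eval_div, eval_read, eval_add, eval_const, hT, hv, h.eval_n]
    congr 1
    exact (h _).trans this

open scoped Classical in
theorem eval_hit {T : ℕ} (hT : p.maskE.eval s = T) {v : Expr} {v' : Fin I.n} (hv : v.eval s = v') :
    (p.hitE v).eval s = if I.Free T v' then 0 else 1 := by
  rw [Params.hitE, eval_lt, h.eval_hits hT hv p.a le_rfl, eval_const]
  by_cases hf : I.Free T v'
  · rw [if_pos hf, if_neg]
    rw [Finset.sum_eq_zero]
    · simp
    · intro j _
      split_ifs with hj
      · rw [hf _ hj, mul_zero]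
      · rw [zero_mul]
  · rw [if_neg hf, if_pos]
    unfold Free at hf
    push Not at hf
    obtain ⟨i, hi, h1⟩ := hf
    refine lt_of_lt_of_le ?_ (Finset.single_le_sum (fun _ _ => Nat.zero_le _) (Finset.mem_univ i))
    rw [if_pos hi, one_mul]
    exact Nat.pos_of_ne_zero h1

end Holds

namespace Small

variable (hI : I.Small)
include hI

theorem le_size : (p.A + p.B + 2 ^ p.a + 10) * (I.n + 1) ≤ I.size := Nat.mul_le_mul_right _ hI.le_c

theorem ten_le : 10 ≤ I.size := by
  refine le_trans ?_ hI.le_size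
  nlinarith [Nat.zero_le (p.A + p.B + 2 ^ p.a), Nat.zero_le I.n]

theorem n_lt : 2 * I.n < I.size := by
  refine lt_of_lt_of_le ?_ hI.le_size
  nlinarith [Nat.zero_le ((p.A + p.B + 2 ^ p.a) * (I.n + 1)), Nat.zero_le I.n]

theorem masks_le : 2 ^ p.a ≤ I.size := by
  refine le_trans ?_ hI.le_size
  nlinarith [Nat.zero_le ((p.A + p.B + 10) * (I.n + 1)), Nat.zero_le (2 ^ p.a * I.n)]

theorem labels_lt : I.labels < I.size := by
  refine lt_of_lt_of_le ?_ hI.le_size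
  have h1 : I.labels ≤ p.A * I.k + p.B * I.l := Nat.div_le_self _ _
  have h2 : p.A * I.k ≤ p.A * I.n := Nat.mul_le_mul_left _ hI.k_le
  have h3 : p.B * I.l ≤ p.B * I.n := Nat.mul_le_mul_left _ hI.l_le
  have h4 : 0 ≤ 2 ^ p.a * (I.n + 1) := Nat.zero_le _
  nlinarith

theorem n_pos : 0 < I.n := lt_of_lt_of_le hI.one_le_k hI.k_le

/-- Thus the largest power of the marker `2 ^ size ^ 11` that is needed is `2 ^ size ^ 14`, which is
where the table of powers ends. -/
theorem digit_lt {r : ℕ} (hr : r ≤ I.labels) :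
    (I.k * I.size + I.l) * I.size + r + 1 ≤ I.size ^ 3 := by
  have h1 := hI.n_lt
  have h2 := hI.labels_lt
  have h3 := hI.k_le
  have h4 := hI.l_le
  have h5 : I.k * I.size + I.l + 1 ≤ I.size * I.size := by
    have : (I.k + 1) * I.size ≤ I.size * I.size := Nat.mul_le_mul_right _ (by omega)
    nlinarith
  calc (I.k * I.size + I.l) * I.size + r + 1 ≤ (I.k * I.size + I.l + 1) * I.size := by nlinarith
    _ ≤ I.size * I.size * I.size := Nat.mul_le_mul_right _ h5
    _ = I.size ^ 3 := by ring

end Small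

namespace Ready

variable {ω : ℕ → Bool} {s : State} (h : I.Ready ω s) (hI : I.Small)
include h hI

theorem eval_base : p.baseE.eval s = I.base := by
  rw [Params.baseE, twoPowE, eval_read, eval_pow, h.holds.eval_size]
  exact h.pow _ (Nat.pow_le_pow_right (by have := hI.ten_le; omega) (by norm_num))

theorem eval_count {e : Expr} {i : ℕ} (he : e.eval s = i) (hi : i ≤ I.size ^ 3) :
    (p.countE e).eval s = I.count ^ i := by
  rw [Params.countE, twoPowE, eval_read, eval_mul, eval_pow, h.holds.eval_size, he, count, ← pow_mul]
  refine h.pow _ ((Nat.mul_le_mul_left _ hi).trans ?_)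
  rw [← pow_add]

theorem eval_edgeVar {u v : Expr} {u' v' : Fin I.n} (hu : u.eval s = u') (hv : v.eval s = v') :
    (p.edgeVarE u v).eval s = I.var ω s(u', v') I.labels := by
  rw [Params.edgeVarE, eval_read]
  simp only [eval_mul, eval_add, h.holds.eval_pair hu hv, h.holds.eval_labels, h.holds.eval_size,
    eval_const]
  refine h.rnd _ ?_
  calc pairIndex s(u', v') * (I.labels + 1) + I.labels < (pairIndex s(u', v') + 1) * (I.labels + 1) := by
        rw [add_mul]; omega
    _ ≤ _ := Nat.mul_le_mul_right _ (pairIndex_lt _)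

end Ready

/-- The memory holds the table of the values of the items. -/
def Labelled (I : Inst p) (ω : ℕ → Bool) (X : ℕ) (s : State) : Prop :=
  ∀ q < I.n * I.n, s.mem (7, (q + 1) * (I.labels + 1)) = bitForm (I.labels + 1)
    (fun i => (coinPoly I.size ω (q * (I.labels + 1) + i)).eval I.base) X

/-- The value of an item. -/
noncomputable def itemVar (I : Inst p) (ω : ℕ → Bool) (X : ℕ) (e : Sym2 (Fin I.n)) : ℕ :=
  bitForm (I.labels + 1) (I.var ω e) X

/-- The weight of an edge. -/
noncomputable def edge (I : Inst p) (ω : ℕ → Bool) (X T : ℕ) (ρ : Fin I.n) (leaf : Bool)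
    (u v : Fin I.n) : ℕ :=
  edgeWeight I.G (I.Free T) ρ (I.count ^ (I.size * I.size)) (I.count ^ I.size) I.count
    (fun e => I.var ω e I.labels) (I.itemVar ω X) leaf u v

theorem eval_itemVar {ω : ℕ → Bool} {s : State} (h : I.Ready ω s) {X : ℕ} (hX : I.Labelled ω X s)
    {u v : Expr} {u' v' : Fin I.n} (hu : u.eval s = u') (hv : v.eval s = v') :
    (p.itemVarE u v).eval s = I.itemVar ω X s(u', v') := by
  rw [Params.itemVarE, eval_read]
  simp only [eval_mul, eval_add, h.holds.eval_pair hu hv, h.holds.eval_labels, eval_const]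
  exact hX _ (pairIndex_lt _)

theorem eval_edge {ω : ℕ → Bool} {s : State} (h : I.Ready ω s) (hI : I.Small) {X T : ℕ}
    {ρ : Fin I.n} (hX : I.Labelled ω X s) (hT : p.maskE.eval s = T) (hρ : p.rootE.eval s = ρ)
    {u v : Expr} {u' v' : Fin I.n} (hu : u.eval s = u') (hv : v.eval s = v') (leaf : Bool) :
    (p.edgeE leaf u v).eval s = I.edge ω X T ρ leaf u' v' := by
  have h10 := hI.ten_le
  have e1 := h.eval_count hI (e := p.sizeE * p.sizeE) (i := I.size * I.size)
    (by simp [h.holds.eval_size]) (by nlinarith [sq_nonneg I.size])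
  have e2 := h.eval_count hI (e := .const 1) (i := 1) rfl (Nat.one_le_pow _ _ (by omega))
  have e3 := h.eval_count hI h.holds.eval_size (Nat.le_self_pow (by norm_num) _)
  have e4 : v.eval s = p.rootE.eval s ↔ v' = ρ := by rw [hv, hρ, Fin.ext_iff]
  simp only [Params.edgeE, edge, edgeWeight, eval_mul, iteE, notE, eval_add, eval_sub, eval_eq,
    eval_const, e4, e1, e2, h.holds.eval_adj hu hv, h.eval_edgeVar hI hu hv,
    h.holds.eval_hit hT hu, h.holds.eval_hit hT hv, eval_itemVar h hX hu hv, eval_itemVar h hX hv hv]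
  cases leaf <;> by_cases f1 : I.G.Adj u' v' <;> by_cases f2 : v' = ρ <;>
    by_cases f3 : I.Free T u' <;> by_cases f4 : I.Free T v' <;>
    simp [f1, f2, f3, f4, e3, h.holds.eval_hit hT hv]

end Inst

end TreeSearch


/-! ### The tables of the program -/

namespace TreeSearch

open RAM

/-- A table that consists of blocks of length `P`, each of which starts from `0`. -/
def blockTable (P : ℕ) (f : ℕ → ℕ → ℕ) : ℕ → ℕ
  | 0 => 0
  | t + 1 => f (t / P) (t % P + 1)

/-- Cell `(q + 1) * P` holds the final value of block `q`, while block `q + 1` starts from `0`. The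
factor resets the running value there, so each loop over blocks can be a single linear pass. -/
theorem blockTable_mul {P : ℕ} (hP : 0 < P) {f : ℕ → ℕ → ℕ} (h0 : ∀ q, f q 0 = 0) (i : ℕ) :
    (if 0 < i % P then 1 else 0) * blockTable P f i = f (i / P) (i % P) := by
  split_ifs with h
  · cases i with
    | zero => simp at h
    | succ t =>
      have h1 : (t + 1) % P = t % P + 1 ∧ (t + 1) / P = t / P := by
        have h2 := Nat.mod_lt t hP
        have h3 : t + 1 = P * (t / P) + (t % P + 1) := by rw [← add_assoc, Nat.div_add_mod]
        have h4 : t % P + 1 < P := by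
          by_contra h5
          rw [h3, show t % P + 1 = P by omega, Nat.mul_add_mod, Nat.mod_self] at h
          omega
        constructor
        · conv_lhs => rw [h3, Nat.mul_add_mod, Nat.mod_eq_of_lt h4]
        · conv_lhs => rw [h3, Nat.mul_add_div hP, Nat.div_eq_of_lt h4, add_zero]
      rw [one_mul, blockTable, h1.1, h1.2]
  · rw [zero_mul, Nat.eq_zero_of_not_pos h, h0]

theorem blockTable_end {P : ℕ} (hP : 0 < P) (f : ℕ → ℕ → ℕ) (q : ℕ) :
    blockTable P f ((q + 1) * P) = f q P := by
  obtain ⟨m, rfl⟩ : ∃ m, P = m + 1 := ⟨P - 1, by omega⟩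
  have h : (q + 1) * (m + 1) = ((m + 1) * q + m) + 1 := by ring
  rw [h, blockTable, Nat.mul_add_div (by omega), Nat.mul_add_mod, Nat.div_eq_of_lt (by omega),
    Nat.mod_eq_of_lt (by omega), add_zero]

/-- The number whose digits are given by `j` coins. -/
def coinPart (B : ℕ) (ω : ℕ → Bool) (o : ℕ) : ℕ → ℕ
  | 0 => 0
  | j + 1 => coinPart B ω o j * B + (ω (o + j)).toNat

theorem coinPart_eq (B : ℕ) (ω : ℕ → Bool) (o j : ℕ) :
    coinPart B ω o j = ∑ i ∈ Finset.range j, (ω (o + i)).toNat * B ^ (j - 1 - i) := by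
  induction j with
  | zero => rfl
  | succ j ih =>
    rw [coinPart, ih, Finset.sum_range_succ, Finset.sum_mul]
    congr 1
    · refine Finset.sum_congr rfl fun i hi => ?_
      rw [Finset.mem_range] at hi
      rw [mul_assoc, ← pow_succ]
      congr 2
      omega
    · simp

theorem coinPart_eq_eval (B : ℕ) (ω : ℕ → Bool) (q w : ℕ) :
    coinPart B ω (q * w) w = (coinPoly w ω q).eval B := by
  rw [coinPart_eq, coinPoly, Polynomial.eval_finsetSum]
  refine Finset.sum_congr rfl fun i _ => ?_
  simp

theorem coinPart_le {B : ℕ} (hB : 1 ≤ B) (ω : ℕ → Bool) (o : ℕ) {j w : ℕ} (hj : j ≤ w) :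
    coinPart B ω o j ≤ w * B ^ w := by
  rw [coinPart_eq]
  refine (Finset.sum_le_card_nsmul _ _ (B ^ w) ?_).trans ?_
  · intro i _
    calc (ω (o + i)).toNat * B ^ (j - 1 - i) ≤ 1 * B ^ w :=
          Nat.mul_le_mul (Bool.toNat_le _) (Nat.pow_le_pow_right hB (by omega))
      _ = _ := one_mul _
  · rw [Finset.card_range, smul_eq_mul]
    exact Nat.mul_le_mul_right _ hj

section Accumulate

variable {n : ℕ} (φ : Bool → Fin n → Fin n → ℕ) (M : ℕ)

/-- The product over the first `j` children of a vertex, minus `1`. -/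
def partialAcc (g : Fin n → Fin n → ℕ) (u v : Fin n) : ℕ → ℕ
  | 0 => 0
  | j + 1 => if h : j < n then
      (partialAcc g u v j + (partialAcc g u v j + 1) * (1 - if j = u then 1 else 0) *
        (φ true v ⟨j, h⟩ + φ false v ⟨j, h⟩ * g v ⟨j, h⟩)) % M
      else 0

/-- The sums over nonempty sets of branches of bounded depth. -/
def accTable : ℕ → Fin n → Fin n → ℕ
  | 0 => fun _ _ => 0
  | d + 1 => fun u v => partialAcc φ M (accTable d) u v n

theorem partialAcc_lt {M : ℕ} (hM : 0 < M) (g : Fin n → Fin n → ℕ) (u v : Fin n) (j : ℕ) :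
    partialAcc φ M g u v j < M := by
  cases j with
  | zero => exact hM
  | succ j =>
    rw [partialAcc]
    by_cases h : j < n
    · rw [dif_pos h]
      exact Nat.mod_lt _ hM
    · rwa [dif_neg h]

/-- The blocks of the table of accumulated sums. -/
def accBlock (q j : ℕ) : ℕ :=
  if h : 0 < n then
    if q / n / n = 0 then 0 else
      partialAcc φ M (accTable φ M (q / n / n - 1)) ⟨q / n % n, Nat.mod_lt _ h⟩
        ⟨q % n, Nat.mod_lt _ h⟩ j
  else 0

theorem accBlock_zero (q : ℕ) : accBlock φ M q 0 = 0 := by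
  unfold accBlock
  split_ifs <;> rfl

theorem accBlock_end (d : ℕ) (u v : Fin n) :
    accBlock φ M (d * n * n + u * n + v) n = accTable φ M d u v := by
  have hn : 0 < n := u.pos
  have h1 : (d * n * n + u * n + v) / n = d * n + u := by
    rw [show d * n * n + u * n + v = n * (d * n + u) + v by ring, Nat.mul_add_div hn,
      Nat.div_eq_of_lt v.2, add_zero]
  have h2 : (d * n * n + u * n + v) % n = v := by
    rw [show d * n * n + u * n + v = n * (d * n + u) + v by ring, Nat.mul_add_mod,
      Nat.mod_eq_of_lt v.2]
  have h3 : (d * n + u) / n = d := by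
    rw [mul_comm, Nat.mul_add_div hn, Nat.div_eq_of_lt u.2, add_zero]
  have h4 : (d * n + u) % n = u := by
    rw [mul_comm, Nat.mul_add_mod, Nat.mod_eq_of_lt u.2]
  simp only [accBlock, dif_pos hn, h1, h2, h3, h4]
  cases d with
  | zero => rfl
  | succ d => rfl

end Accumulate

namespace Params

variable (p : Params)

/-- Fill the table of powers of two. -/
def powTable : Program := fill 5 3 (.const 1) (p.sizeE.pow 14) (twoPowE iE * .const 2)

/-- Fill the table of random variables. -/
def rndTable : Program :=
  .seq (.store 6 (.const 0) (.const 0)) (forLoop 3 (nE * nE * (p.labelsE + .const 1) * p.sizeE)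
    (.seq (.toss 4 (.const 0)) (.store 6 (iE + .const 1)
      ((Expr.const 0).lt (iE % p.sizeE) * .read 6 iE * p.baseE + .read 4 (.const 0)))))

/-- Fill the table of the values of the items. -/
def itemTable : Program :=
  fill 7 3 (.const 0) (nE * nE * (p.labelsE + .const 1))
    ((Expr.const 0).lt (iE % (p.labelsE + .const 1)) * .read 7 iE +
      xE / twoPowE (iE % (p.labelsE + .const 1)) % .const 2 *
        .read 6 ((iE + .const 1) * p.sizeE))

/-- The part of `accTableP` that has been computed for the present vertex. -/
def accE : Expr := (Expr.const 0).lt (iE % nE) * .read 8 iE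

/-- Fill the table of the sums over sets of branches. -/
def accTableP : Program :=
  fill 8 3 (.const 0) ((nE + .const 1) * nE * nE * nE)
    ((Expr.const 0).lt (iE / nE / nE / nE) *
      ((accE + (accE + .const 1) * notE ((iE % nE).eq (iE / nE / nE % nE)) *
        (p.edgeE true (iE / nE % nE) (iE % nE) + p.edgeE false (iE / nE % nE) (iE % nE) *
          .read 8 (((iE / nE / nE / nE - .const 1) * nE * nE + iE / nE % nE * nE + iE % nE + .const 1) *
            nE))) % p.countE (p.digitE + .const 1)))

end Params

namespace Inst

variable {p : Params} {I : Inst p}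

section

variable (hI : I.Small)
include hI

theorem two_pow_lt {Q i : ℕ} (hQ : I.size ^ 15 ≤ Q) (hi : i ≤ I.size ^ 14) : 2 ^ i < 2 ^ Q := by
  have h10 := hI.ten_le
  refine Nat.pow_lt_pow_right one_lt_two (lt_of_le_of_lt hi (lt_of_lt_of_le ?_ hQ))
  exact Nat.pow_lt_pow_right (by omega) (by norm_num)

theorem length_lt {Q i : ℕ} (hQ : I.size ^ 15 ≤ Q) (hi : i ≤ I.size ^ 14) : i < Q := by
  have h10 := hI.ten_le
  refine lt_of_le_of_lt hi (lt_of_lt_of_le ?_ hQ)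
  exact Nat.pow_lt_pow_right (by omega) (by norm_num)

theorem var_lt {Q x : ℕ} (hQ : I.size ^ 15 ≤ Q) (hx : x ≤ I.size * (I.size * I.base ^ I.size)) :
    x < 2 ^ Q := by
  have h10 := hI.ten_le
  have h2 : I.size ≤ 2 ^ I.size := Nat.lt_two_pow_self.le
  refine lt_of_le_of_lt (hx.trans (Nat.mul_le_mul h2 (Nat.mul_le_mul h2 le_rfl)))
    (lt_of_le_of_lt (b := 2 ^ (I.size + (I.size + I.size ^ 5 * I.size))) ?_ (two_pow_lt hI hQ ?_))
  · rw [base, ← pow_mul, ← pow_add, ← pow_add]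
  · have e1 : I.size ^ 1 ≤ I.size ^ 6 := Nat.pow_le_pow_right (by omega) (by norm_num)
    have e2 : I.size ^ 14 = I.size ^ 8 * I.size ^ 6 := by ring
    have e3 : 10 ^ 8 ≤ I.size ^ 8 := Nat.pow_le_pow_left h10 8
    rw [pow_one] at e1
    rw [show I.size ^ 5 * I.size = I.size ^ 6 by ring, e2]
    nlinarith [Nat.zero_le (I.size ^ 6)]

theorem rnd_length_le : I.n * I.n * (I.labels + 1) * I.size ≤ I.size ^ 4 := by
  have h1 := hI.n_lt
  have h2 := hI.labels_lt
  calc I.n * I.n * (I.labels + 1) * I.size ≤ I.size * I.size * I.size * I.size := by gcongr <;> omega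
    _ = _ := by ring

theorem size_pow_le {i : ℕ} (hi : i ≤ 14) : I.size ^ i ≤ I.size ^ 14 :=
  Nat.pow_le_pow_right (by have := hI.ten_le; omega) hi

theorem steps_powTable {Q : ℕ} (hQ : I.size ^ 15 ≤ Q) (ω : ℕ → Bool) {s : State} (h : I.Holds s) :
    ∃ s', Steps Q ω p.powTable s s' (I.size ^ 14 * 3 + 3) ∧ AgreeOff [5, 3] s s' ∧
      (∀ i ≤ I.size ^ 14, s'.mem (5, i) = 2 ^ i) ∧ s'.coins = s.coins := by
  refine Steps.fill (F := fun i => 2 ^ i) (by norm_num) (by norm_num) (by norm_num)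
    (length_lt hI hQ le_rfl) rfl (fun i hi => two_pow_lt hI hQ hi) ?_ ?_
  · intro s' hs'
    rw [eval_pow, (h.agree hs' (by simp)).eval_size]
  · intro i _ s' _ h3 h5
    simp only [twoPowE, iE, eval_mul, eval_read, eval_const, h3, h5 i le_rfl, pow_succ]

/-- One coin is tossed per cell, so the number of coins tossed equals the loop counter and coin `i`
belongs to block `i / size`. Horner's rule within a block produces the value of `coinPoly` at the
base. -/
theorem steps_rndTable {Q : ℕ} (hQ : I.size ^ 15 ≤ Q) (ω : ℕ → Bool) {s : State} (h : I.Holds s)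
    (hp : ∀ i ≤ I.size ^ 14, s.mem (5, i) = 2 ^ i) (hc : s.coins = 0) :
    ∃ s', Steps Q ω p.rndTable s s' (I.size ^ 4 * 4 + 3) ∧ AgreeOff [3, 4, 6] s s' ∧
      I.Ready ω s' := by
  have h10 := hI.ten_le
  have hS : 0 < I.size := by omega
  let F := blockTable I.size fun q j => coinPart I.base ω (q * I.size) j
  have hB : 1 ≤ I.base := Nat.one_le_two_pow
  have hF : ∀ i, F i < 2 ^ Q := by
    intro i
    refine var_lt hI hQ ?_
    cases i with
    | zero => exact Nat.zero_le _
    | succ t =>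
      refine (coinPart_le hB _ _ (Nat.mod_lt t hS)).trans ?_
      exact Nat.le_mul_of_pos_left _ hS
  have hlen : I.n * I.n * (I.labels + 1) * I.size < Q :=
    length_lt hI hQ ((rnd_length_le hI).trans (size_pow_le hI (by norm_num)))
  obtain ⟨s', h1, h2, h3, h4, h5⟩ := Steps.forLoop (Q := Q) (ω := ω) (x := 3)
    (bound := nE * nE * (p.labelsE + .const 1) * p.sizeE)
    (body := .seq (.toss 4 (.const 0)) (.store 6 (iE + .const 1)
      ((Expr.const 0).lt (iE % p.sizeE) * .read 6 iE * p.baseE + .read 4 (.const 0))))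
    (n := I.n * I.n * (I.labels + 1) * I.size) (τ := 2) (by norm_num)
    (hlen.trans Nat.lt_two_pow_self) (by omega)
    (fun i s' => AgreeOff [3, 4, 6] s s' ∧ s'.mem (3, 0) = i ∧ s'.coins = i ∧
      ∀ j ≤ i, s'.mem (6, j) = F j)
    (fun i s' h' => by
      have hh := h.agree h'.1 (by simp)
      refine ⟨h'.2.1, ?_⟩
      simp [hh.eval_n, hh.eval_labels, hh.eval_size])
    (fun i hi s₁ ⟨k1, k2, k3, k4⟩ => by
      have hag : AgreeOff [3, 4, 6] s (s₁.toss ω 4 0) :=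
        k1.trans (agreeOff_write s₁ (by simp) _ _)
      have hh := h.agree hag (by simp)
      have m3 : (s₁.toss ω 4 0).mem (3, 0) = i := by
        rw [toss_mem, write_mem_of_ne _ (by norm_num), k2]
      have m6 : ∀ j ≤ i, (s₁.toss ω 4 0).mem (6, j) = F j := by
        intro j hj
        rw [toss_mem, write_mem_of_ne _ (by norm_num), k4 j hj]
      have m4 : (s₁.toss ω 4 0).mem (4, 0) = (ω i).toNat := by
        rw [toss_mem, write_mem_self, k3]
      have m5 : p.baseE.eval (s₁.toss ω 4 0) = I.base := by
        rw [Params.baseE, twoPowE, eval_read, eval_pow, hh.eval_size, hag 5 (by simp)]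
        exact hp _ (size_pow_le hI (by norm_num))
      refine ⟨_, Steps.seq (Steps.toss (by norm_num) (i := 0) rfl (by omega))
        (Steps.store (by norm_num) (i := i + 1) (v := F (i + 1)) ?_ (by omega) ?_ (hF _)), ?_, ?_, ?_, ?_, ?_⟩
      · simp [iE, m3]
      · simp only [eval_add, eval_mul, eval_lt, eval_mod, eval_read, eval_const, iE, m3, m4, m5,
          m6 i le_rfl, hh.eval_size]
        rw [blockTable_mul hS (fun _ => rfl)]
        simp only [F, blockTable, coinPart]
        rw [mul_comm (i / I.size) I.size, Nat.div_add_mod]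
      · rw [write_mem_of_ne _ (by norm_num), m3]
      · exact (hag.trans (agreeOff_write _ (by simp) _ _)).trans (agreeOff_write _ (by simp) _ _)
      · simp
      · simp [k3]
      · intro j hj
        rw [write_mem_of_ne _ (by norm_num), write_mem]
        split_ifs with h5
        · rw [h5.2]
        · refine m6 j ?_
          by_contra h6
          exact h5 ⟨rfl, by omega⟩)
    (s := s.write 6 0 0)
    (by
      refine ⟨(agreeOff_write _ (by simp) _ _).trans (agreeOff_write _ (by simp) _ _), by simp,
        by simp [hc], ?_⟩
      intro j hj
      rw [write_mem_of_ne _ (by norm_num), Nat.le_zero.1 hj]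
      simp [F, blockTable])
  refine ⟨s', Steps.mono (Steps.seq (Steps.store (by norm_num) (i := 0) rfl (by omega) rfl
    (by positivity)) h1) ?_, h2, h.agree h2 (by simp), ?_, ?_⟩
  · have := rnd_length_le hI
    omega
  · intro i hi
    rw [h2 5 (by simp), hp i hi]
  · intro q hq
    rw [h5, ← coinPart_eq_eval]
    · exact blockTable_end hS _ q
    · exact Nat.mul_le_mul_right _ hq

theorem steps_itemTable {Q : ℕ} (hQ : I.size ^ 15 ≤ Q) {ω : ℕ → Bool} {s : State}
    (h : I.Ready ω s) {X : ℕ} (hX : s.mem (2, 0) = X) :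
    ∃ s', Steps Q ω p.itemTable s s' (I.size ^ 4 * 3 + 3) ∧ AgreeOff [7, 3] s s' ∧
      I.Labelled ω X s' := by
  have h10 := hI.ten_le
  have hB : 1 ≤ I.base := Nat.one_le_two_pow
  have hlt := hI.labels_lt
  have hlen : I.n * I.n * (I.labels + 1) ≤ I.size ^ 4 :=
    (Nat.le_mul_of_pos_right _ (by omega)).trans (rnd_length_le hI)
  let f : ℕ → ℕ → ℕ := fun q j => bitForm j
    (fun i => (coinPoly I.size ω (q * (I.labels + 1) + i)).eval I.base) X
  have hf : ∀ q, f q 0 = 0 := fun q => rfl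
  have hR : 0 < I.labels + 1 := by omega
  obtain ⟨s', h1, h2, h3, -⟩ := Steps.fill (Q := Q) (ω := ω) (T := 7) (x := 3) (init := .const 0)
    (len := nE * nE * (p.labelsE + .const 1))
    (e := (Expr.const 0).lt (iE % (p.labelsE + .const 1)) * .read 7 iE +
      xE / twoPowE (iE % (p.labelsE + .const 1)) % .const 2 * .read 6 ((iE + .const 1) * p.sizeE))
    (n := I.n * I.n * (I.labels + 1)) (by norm_num) (by norm_num)
    (by norm_num) (length_lt hI hQ (hlen.trans (size_pow_le hI (by norm_num))))
    (F := blockTable (I.labels + 1) f) (s := s) rfl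
    (by
      intro i _
      refine var_lt hI hQ ?_
      cases i with
      | zero => exact Nat.zero_le _
      | succ t =>
        refine (bitForm_le _ _ _ _ (fun i => eval_coinPoly_le _ _ _ _ hB)).trans ?_
        refine Nat.mul_le_mul_right _ ?_
        have := Nat.mod_lt t hR
        omega)
    (by
      intro s' hs'
      have hh := h.holds.agree hs' (by simp)
      simp [hh.eval_n, hh.eval_labels])
    (by
      intro i hi s' hs' h3 h7
      have hr := h.agree hs' (by simp) (by simp) (by simp)
      have hh := hr.holds
      have hm : i % (I.labels + 1) < I.labels + 1 := Nat.mod_lt _ hR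
      have h5 : s'.mem (5, i % (I.labels + 1)) = 2 ^ (i % (I.labels + 1)) := by
        refine hr.pow _ (((Nat.lt_succ_iff.1 hm).trans hlt.le).trans ?_)
        exact Nat.le_self_pow (by norm_num) _
      have h2 : s'.mem (2, 0) = X := by rw [hs' 2 (by simp), hX]
      simp only [eval_add, eval_mul, eval_lt, eval_mod, eval_read, eval_const, iE, xE, h3,
        h7 i le_rfl, hh.eval_size, hh.eval_labels, eval_div, twoPowE, h5, h2, hr.rnd i hi]
      rw [blockTable_mul hR hf]
      simp only [f, blockTable, bitForm]
      rw [Finset.sum_range_succ, mul_comm (i / (I.labels + 1)) (I.labels + 1), Nat.div_add_mod]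
      simp)
  refine ⟨s', Steps.mono h1 (by omega), h2, ?_⟩
  intro q hq
  rw [h3 _ (Nat.mul_le_mul_right _ hq), blockTable_end hR]

end

end Inst

end TreeSearch


/-! ### The program -/

namespace TreeSearch

open RAM

namespace Params

variable (p : Params)

/-- The contribution of one element of the sieve. -/
def walkE : Expr :=
  p.countE (p.sizeE * p.sizeE) * p.countE p.sizeE *
    (p.countE (.const 1) * p.itemVarE p.rootE p.rootE) *
    (p.edgeE true p.rootE p.stemE + p.edgeE false p.rootE p.stemE *
      .read 8 ((nE * nE * nE + p.rootE * nE + p.stemE + .const 1) * nE)) /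
    p.countE p.digitE % p.countE (.const 1)

/-- Sum over the sieve. -/
def sieveLoop : Program :=
  forLoop 2 (twoPowE p.itemsE) (.seq p.itemTable (.seq p.accTableP
    (.store 9 (.const 0) (.read 9 (.const 0) + p.walkE))))

/-- Add up the parities of the digits. -/
def digitLoop : Program :=
  forLoop 3 (p.sizeE.pow 11) (.seq
    (.store 10 (.const 0) (.read 10 (.const 0) + .read 9 (.const 0) % .const 2))
    (.store 9 (.const 0) (.read 9 (.const 0) / p.baseE)))

/-- Try all sets of colors, roots and numbers of items. -/
def outerLoop : Program :=
  forLoop 1 (.const (2 ^ p.a) * nE * nE * (p.labelsE + .const 1))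
    (.seq (.store 9 (.const 0) (.const 0)) (.seq p.sieveLoop p.digitLoop))

/-- The search for trees with at least two vertices. -/
def search : Program :=
  .seq p.powTable (.seq p.rndTable (.seq (.store 10 (.const 0) (.const 0))
    (.seq p.outerLoop (.store 0 (.const 0) (.read 10 (.const 0))))))

/-- The algorithm. -/
def program : Program :=
  .cond (nE.lt kE + nE.lt lE + kE.eq (.const 0)) (.store 0 (.const 0) (.const 0))
    (.cond (kE.eq (.const 1)) (.store 0 (.const 0) (lE.eq (.const 0))) p.search)

end Params

namespace Inst

set_option linter.unusedSectionVars false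

variable {p : Params} {I : Inst p}

/-- The set of colors in a round of the outer loop. -/
def maskOf (_ : Inst p) (J : ℕ) : ℕ := J % 2 ^ p.a

/-- The root in a round of the outer loop. -/
def rootOf (hI : I.Small) (J : ℕ) : Fin I.n := ⟨J / 2 ^ p.a % I.n, Nat.mod_lt _ hI.n_pos⟩

/-- The neighbor of the root in a round of the outer loop. -/
def stemOf (hI : I.Small) (J : ℕ) : Fin I.n := ⟨J / 2 ^ p.a / I.n % I.n, Nat.mod_lt _ hI.n_pos⟩

/-- The number of items in a round of the outer loop. -/
def itemsOf (I : Inst p) (J : ℕ) : ℕ := J / 2 ^ p.a / I.n / I.n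

/-- The position of the digit that counts. -/
def digitOf (I : Inst p) (J : ℕ) : ℕ := (I.k * I.size + I.l) * I.size + I.itemsOf J

/-- The modulus. -/
def modulus (I : Inst p) (J : ℕ) : ℕ := I.count ^ (I.digitOf J + 1)

/-- The weight of an edge in a round of the outer loop. -/
noncomputable def roundEdge (hI : I.Small) (ω : ℕ → Bool) (J X : ℕ) (leaf : Bool) (u v : Fin I.n) : ℕ :=
  I.edge ω X (I.maskOf J) (rootOf hI J) leaf u v

/-- The value of `walkE`. -/
noncomputable def walkValue (hI : I.Small) (ω : ℕ → Bool) (J X : ℕ) : ℕ :=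
  I.count ^ (I.size * I.size) * I.count ^ I.size *
    (I.count * I.itemVar ω X s(rootOf hI J, rootOf hI J)) *
    (roundEdge hI ω J X true (rootOf hI J) (stemOf hI J) +
      roundEdge hI ω J X false (rootOf hI J) (stemOf hI J) *
      accTable (roundEdge hI ω J X) (I.modulus J) I.n (rootOf hI J) (stemOf hI J)) /
    I.count ^ I.digitOf J % I.count

/-- The result of the sieve. -/
noncomputable def sieveValue (hI : I.Small) (ω : ℕ → Bool) (J : ℕ) : ℕ :=
  ∑ X ∈ Finset.range (2 ^ I.itemsOf J), walkValue hI ω J X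

/-- The number of odd digits of the result of the sieve. -/
noncomputable def oddDigits (hI : I.Small) (ω : ℕ → Bool) (J : ℕ) : ℕ :=
  ∑ i ∈ Finset.range (I.size ^ 11), sieveValue hI ω J / I.base ^ i % 2

/-- The number of rounds. -/
def rounds (I : Inst p) : ℕ := 2 ^ p.a * I.n * I.n * (I.labels + 1)

section

variable (hI : I.Small)
include hI

theorem itemsOf_le {J : ℕ} (hJ : J < I.rounds) : I.itemsOf J ≤ I.labels := by
  refine Nat.lt_succ_iff.1 ?_
  rw [itemsOf, Nat.div_lt_iff_lt_mul hI.n_pos, Nat.div_lt_iff_lt_mul hI.n_pos,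
    Nat.div_lt_iff_lt_mul (by positivity)]
  refine lt_of_lt_of_eq hJ ?_
  rw [rounds, Nat.succ_eq_add_one]
  ring

theorem rounds_le : I.rounds ≤ I.size ^ 4 := by
  have h1 := hI.n_lt
  have h2 := hI.labels_lt
  have h3 := hI.masks_le
  calc I.rounds ≤ I.size * I.size * I.size * I.size := by unfold rounds; gcongr <;> omega
    _ = _ := by ring

theorem modulus_pos (J : ℕ) : 0 < I.modulus J := by unfold modulus count; positivity

theorem modulus_le {J : ℕ} (hJ : J < I.rounds) : I.modulus J ≤ 2 ^ I.size ^ 14 := by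
  rw [modulus, count, ← pow_mul]
  refine Nat.pow_le_pow_right two_pos ?_
  calc I.size ^ 11 * (I.digitOf J + 1) ≤ I.size ^ 11 * I.size ^ 3 :=
        Nat.mul_le_mul_left _ (hI.digit_lt (itemsOf_le hI hJ))
    _ = I.size ^ 14 := by ring

theorem eval_mask {s : State} {J : ℕ} (hJ : s.mem (1, 0) = J) : p.maskE.eval s = I.maskOf J := by
  simp [Params.maskE, jE, hJ, maskOf]

theorem eval_root {s : State} (h : I.Holds s) {J : ℕ} (hJ : s.mem (1, 0) = J) :
    p.rootE.eval s = rootOf hI J := by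
  simp [Params.rootE, jE, hJ, rootOf, h.eval_n]

theorem eval_stem {s : State} (h : I.Holds s) {J : ℕ} (hJ : s.mem (1, 0) = J) :
    p.stemE.eval s = stemOf hI J := by
  simp [Params.stemE, jE, hJ, stemOf, h.eval_n]

theorem eval_items {s : State} (h : I.Holds s) {J : ℕ} (hJ : s.mem (1, 0) = J) :
    p.itemsE.eval s = I.itemsOf J := by
  simp [Params.itemsE, jE, hJ, itemsOf, h.eval_n]

theorem eval_digit {s : State} (h : I.Holds s) {J : ℕ} (hJ : s.mem (1, 0) = J) :
    p.digitE.eval s = I.digitOf J := by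
  simp [Params.digitE, eval_items hI h hJ, digitOf, h.eval_size, h.eval_k, h.eval_l]

theorem steps_accTable {Q : ℕ} (hQ : I.size ^ 15 ≤ Q) {ω : ℕ → Bool} {s : State}
    (h : I.Ready ω s) {J X : ℕ} (hJ : s.mem (1, 0) = J) (hJr : J < I.rounds)
    (hX : I.Labelled ω X s) :
    ∃ s', Steps Q ω p.accTableP s s' (I.size ^ 4 * 3 + 3) ∧ AgreeOff [8, 3] s s' ∧
      ∀ u v : Fin I.n, s'.mem (8, (I.n * I.n * I.n + u * I.n + v + 1) * I.n) =
        accTable (roundEdge hI ω J X) (I.modulus J) I.n u v := by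
  have h10 := hI.ten_le
  have hn := hI.n_pos
  have hnlt := hI.n_lt
  have hlen : (I.n + 1) * I.n * I.n * I.n ≤ I.size ^ 4 := by
    calc (I.n + 1) * I.n * I.n * I.n ≤ I.size * I.size * I.size * I.size := by gcongr <;> omega
      _ = _ := by ring
  have hf : ∀ q, accBlock (roundEdge hI ω J X) (I.modulus J) q 0 = 0 := accBlock_zero _ _
  obtain ⟨s', h1, h2, h3, -⟩ := Steps.fill (Q := Q) (ω := ω) (T := 8) (x := 3) (init := .const 0)
    (len := (nE + .const 1) * nE * nE * nE) (e := (Expr.const 0).lt (iE / nE / nE / nE) *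
      ((Params.accE + (Params.accE + .const 1) * notE ((iE % nE).eq (iE / nE / nE % nE)) *
        (p.edgeE true (iE / nE % nE) (iE % nE) + p.edgeE false (iE / nE % nE) (iE % nE) *
          .read 8 (((iE / nE / nE / nE - .const 1) * nE * nE + iE / nE % nE * nE + iE % nE + .const 1) *
            nE))) % p.countE (p.digitE + .const 1)))
    (n := (I.n + 1) * I.n * I.n * I.n) (by norm_num) (by norm_num)
    (by norm_num) (length_lt hI hQ (hlen.trans (size_pow_le hI (by norm_num))))
    (F := blockTable I.n (accBlock (roundEdge hI ω J X) (I.modulus J))) (s := s) rfl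
    (by
      intro i _
      refine lt_of_lt_of_le ?_ ((modulus_le hI hJr).trans (two_pow_lt hI hQ le_rfl).le)
      cases i with
      | zero => exact modulus_pos hI J
      | succ t =>
        simp only [blockTable, accBlock]
        split_ifs
        · exact modulus_pos hI J
        · exact partialAcc_lt _ (modulus_pos hI J) _ _ _ _)
    (by
      intro s' hs'
      have hh := h.holds.agree hs' (by simp)
      simp [hh.eval_n])
    (by
      intro i hi s' hs' h3 h8
      have hr := h.agree hs' (by simp) (by simp) (by simp)
      have hh := hr.holds
      have hJ' : s'.mem (1, 0) = J := by rw [hs' 1 (by simp), hJ]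
      have hX' : I.Labelled ω X s' := fun q hq => by rw [hs' 7 (by simp), hX q hq]
      have ei : iE.eval s' = i := h3
      let U : Fin I.n := ⟨i / I.n / I.n % I.n, Nat.mod_lt _ hn⟩
      let V : Fin I.n := ⟨i / I.n % I.n, Nat.mod_lt _ hn⟩
      let W : Fin I.n := ⟨i % I.n, Nat.mod_lt _ hn⟩
      have eV : (iE / nE % nE).eval s' = V := by simp [ei, hh.eval_n, V]
      have eW : (iE % nE).eval s' = W := by simp [ei, hh.eval_n, W]
      -- The running product minus `1` for the present pair of vertices, reset to `0` when the child
      -- index returns to `0`.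
      have eacc : Params.accE.eval s' =
          accBlock (roundEdge hI ω J X) (I.modulus J) (i / I.n) (i % I.n) := by
        simp only [Params.accE, eval_mul, eval_lt, eval_const, eval_mod, eval_read, ei, hh.eval_n,
          h8 i le_rfl]
        exact blockTable_mul hn hf i
      have emod : (p.countE (p.digitE + .const 1)).eval s' = I.modulus J :=
        hr.eval_count hI (by simp [eval_digit hI hh hJ']) (hI.digit_lt (itemsOf_le hI hJr))
      have eedge : ∀ leaf, (p.edgeE leaf (iE / nE % nE) (iE % nE)).eval s' =
          roundEdge hI ω J X leaf V W := fun leaf =>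
        eval_edge hr hI hX' (eval_mask hI hJ') (eval_root hI hh hJ') eV eW leaf
      rw [eval_mul, eval_mod, eval_add, eval_mul, eval_mul, eval_add, eval_add, eval_mul, eacc, emod,
        eedge, eedge]
      simp only [notE, eval_sub, eval_eq, eval_const, eval_mod, eval_div, eval_read, eval_lt,
        eval_mul, eval_add, ei, hh.eval_n]
      simp only [blockTable, accBlock, dif_pos hn]
      by_cases hd : i / I.n / I.n / I.n = 0
      · simp [hd]
      · rw [if_neg hd, if_neg hd, if_pos (Nat.pos_of_ne_zero hd), one_mul]
        have hidx : ((i / I.n / I.n / I.n - 1) * I.n * I.n + i / I.n % I.n * I.n + i % I.n + 1) * I.n ≤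
            i := by
          have e1 : i % I.n + 1 ≤ I.n := Nat.mod_lt _ hn
          have e2 : (i / I.n % I.n + 1) * I.n ≤ I.n * I.n := Nat.mul_le_mul_right _ (Nat.mod_lt _ hn)
          have e3 : (i / I.n / I.n / I.n - 1) * I.n * I.n + I.n * I.n =
              i / I.n / I.n / I.n * I.n * I.n := by
            conv_rhs => rw [← Nat.sub_add_cancel (Nat.pos_of_ne_zero hd)]
            ring
          have e4 : i / I.n / I.n / I.n * I.n * I.n ≤ i / I.n := by
            calc _ ≤ i / I.n / I.n * I.n := Nat.mul_le_mul_right _ (Nat.div_mul_le_self _ _)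
              _ ≤ _ := Nat.div_mul_le_self _ _
          calc _ ≤ i / I.n * I.n := Nat.mul_le_mul_right _ (by nlinarith)
            _ ≤ i := Nat.div_mul_le_self _ _
        rw [h8 _ hidx, blockTable_end hn]
        have := accBlock_end (roundEdge hI ω J X) (I.modulus J) (i / I.n / I.n / I.n - 1) V W
        rw [this, partialAcc, dif_pos (Nat.mod_lt _ hn)])
  refine ⟨s', Steps.mono h1 (by omega), h2, ?_⟩
  intro u v
  rw [h3, blockTable_end hn, ← accBlock_end]
  have e1 : (u + 1) * I.n ≤ I.n * I.n := Nat.mul_le_mul_right _ u.2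
  refine Nat.mul_le_mul_right _ ?_
  have e2 := v.2
  nlinarith

theorem walkValue_lt (ω : ℕ → Bool) (J X : ℕ) : walkValue hI ω J X < I.count :=
  Nat.mod_lt _ (by unfold count; positivity)

theorem sum_walkValue_lt {Q : ℕ} (hQ : I.size ^ 15 ≤ Q) (ω : ℕ → Bool) {J : ℕ} (hJ : J < I.rounds)
    {X : ℕ} (hX : X ≤ 2 ^ I.itemsOf J) :
    ∑ X' ∈ Finset.range X, walkValue hI ω J X' < 2 ^ Q := by
  have h10 := hI.ten_le
  refine lt_of_le_of_lt (Finset.sum_le_card_nsmul _ _ I.count fun X' _ => (walkValue_lt hI ω J X').le) ?_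
  rw [Finset.card_range, smul_eq_mul]
  refine lt_of_le_of_lt (Nat.mul_le_mul_right _ hX) ?_
  rw [count, ← pow_add]
  refine two_pow_lt hI hQ ?_
  have h1 := (itemsOf_le hI hJ).trans hI.labels_lt.le
  have h2 : I.size ^ 1 ≤ I.size ^ 11 := Nat.pow_le_pow_right (by omega) (by norm_num)
  have h3 : 2 * I.size ^ 11 ≤ I.size ^ 14 := by
    have : 2 ≤ I.size ^ 3 := (by omega : 2 ≤ I.size).trans (Nat.le_self_pow (by norm_num) _)
    calc 2 * I.size ^ 11 ≤ I.size ^ 3 * I.size ^ 11 := Nat.mul_le_mul_right _ this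
      _ = _ := by ring
  rw [pow_one] at h2
  omega

theorem eval_walkE {ω : ℕ → Bool} {s : State} (h : I.Ready ω s) {J X : ℕ} (hJ : s.mem (1, 0) = J)
    (hJr : J < I.rounds) (hX : I.Labelled ω X s)
    (hacc : ∀ u v : Fin I.n, s.mem (8, (I.n * I.n * I.n + u * I.n + v + 1) * I.n) =
        accTable (roundEdge hI ω J X) (I.modulus J) I.n u v) :
    p.walkE.eval s = walkValue hI ω J X := by
  have h10 := hI.ten_le
  have hh := h.holds
  have e1 := h.eval_count hI (e := p.sizeE * p.sizeE) (i := I.size * I.size)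
    (by simp [hh.eval_size]) (by nlinarith [sq_nonneg I.size])
  have e2 := h.eval_count hI (e := .const 1) (i := 1) rfl (Nat.one_le_pow _ _ (by omega))
  have e3 := h.eval_count hI hh.eval_size (Nat.le_self_pow (by norm_num) _)
  have e4 := h.eval_count hI (eval_digit hI hh hJ) (by
    have := hI.digit_lt (itemsOf_le hI hJr); unfold digitOf; omega)
  have e5 := eval_root hI hh hJ
  have e6 := eval_stem hI hh hJ
  have e7 : ∀ leaf, (p.edgeE leaf p.rootE p.stemE).eval s = roundEdge hI ω J X leaf _ _ := fun leaf =>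
    eval_edge h hI hX (eval_mask hI hJ) e5 e5 e6 leaf
  simp only [Params.walkE, eval_mod, eval_div, eval_mul, eval_add, eval_read, eval_const, e1, e2, e3,
    e4, e7, eval_itemVar h hX e5 e5, hh.eval_n, e5, e6, hacc, pow_one, walkValue]

theorem steps_sieveLoop {Q : ℕ} (hQ : I.size ^ 15 ≤ Q) {ω : ℕ → Bool} {s : State}
    (h : I.Ready ω s) {J : ℕ} (hJ : s.mem (1, 0) = J) (hJr : J < I.rounds) (h9 : s.mem (9, 0) = 0) :
    ∃ s', Steps Q ω p.sieveLoop s s' (2 ^ I.labels * (I.size ^ 4 * 6 + 9) + 2) ∧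
      AgreeOff [2, 3, 7, 8, 9] s s' ∧ s'.mem (9, 0) = sieveValue hI ω J := by
  have h10 := hI.ten_le
  have hQ0 : 0 < Q := lt_of_lt_of_le (by positivity) hQ
  have hr := itemsOf_le hI hJr
  have hr14 : I.itemsOf J ≤ I.size ^ 14 :=
    (hr.trans hI.labels_lt.le).trans (Nat.le_self_pow (by norm_num) _)
  obtain ⟨s', h1, h2, h3, h4⟩ := Steps.forLoop (Q := Q) (ω := ω) (x := 2)
    (bound := twoPowE p.itemsE) (body := .seq p.itemTable (.seq p.accTableP
      (.store 9 (.const 0) (.read 9 (.const 0) + p.walkE))))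
    (n := 2 ^ I.itemsOf J) (τ := I.size ^ 4 * 6 + 7) (by norm_num) (two_pow_lt hI hQ hr14) hQ0
    (fun X s' => AgreeOff [2, 3, 7, 8, 9] s s' ∧ s'.mem (2, 0) = X ∧
      s'.mem (9, 0) = ∑ X' ∈ Finset.range X, walkValue hI ω J X')
    (fun X s' h' => by
      have hh := h.agree h'.1 (by simp) (by simp) (by simp)
      refine ⟨h'.2.1, ?_⟩
      rw [twoPowE, eval_read, eval_items hI hh.holds (by rw [h'.1 1 (by simp), hJ])]
      exact hh.pow _ hr14)
    (fun X hX s₁ ⟨k1, k2, k3⟩ => by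
      have hh := h.agree k1 (by simp) (by simp) (by simp)
      obtain ⟨s₂, a1, a2, a3⟩ := steps_itemTable hI hQ hh k2
      have k4 := k1.trans (a2.mono (by simp))
      have hJ2 : s₂.mem (1, 0) = J := by rw [k4 1 (by simp), hJ]
      have hh2 := h.agree k4 (by simp) (by simp) (by simp)
      obtain ⟨s₃, b1, b2, b3⟩ := steps_accTable hI hQ hh2 hJ2 hJr a3
      have k5 := k4.trans (b2.mono (by simp))
      have hJ3 : s₃.mem (1, 0) = J := by rw [k5 1 (by simp), hJ]
      have hh3 := h.agree k5 (by simp) (by simp) (by simp)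
      have hX3 : I.Labelled ω X s₃ := fun q hq => by rw [b2 7 (by simp), a3 q hq]
      have m9 : s₃.mem (9, 0) = ∑ X' ∈ Finset.range X, walkValue hI ω J X' := by
        rw [b2 9 (by simp), a2 9 (by simp), k3]
      have m2 : s₃.mem (2, 0) = X := by
        rw [b2 2 (by simp), a2 2 (by simp), k2]
      refine ⟨_, Steps.mono (Steps.seq a1 (Steps.seq b1 (Steps.store (by norm_num) (i := 0)
        (v := ∑ X' ∈ Finset.range (X + 1), walkValue hI ω J X') rfl hQ0 ?_ ?_))) ?_, ?_, ?_, ?_, ?_⟩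
      · rw [eval_add, eval_read, eval_const, m9, eval_walkE hI hh3 hJ3 hJr hX3 b3,
          Finset.sum_range_succ]
      · exact sum_walkValue_lt hI hQ ω hJr hX
      · omega
      · rw [write_mem_of_ne _ (by norm_num), m2]
      · exact (k5.trans (agreeOff_write _ (by simp) _ _)).trans (agreeOff_write _ (by simp) _ _)
      · simp
      · rw [write_mem_of_ne _ (by norm_num), write_mem_self])
    (s := s)
    (by
      refine ⟨agreeOff_write _ (by simp) _ _, by simp, ?_⟩
      rw [write_mem_of_ne _ (by norm_num), h9]
      simp)
  refine ⟨s', Steps.mono h1 ?_, h2, h4⟩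
  have : 2 ^ I.itemsOf J ≤ 2 ^ I.labels := Nat.pow_le_pow_right two_pos hr
  exact Nat.add_le_add_right (Nat.mul_le_mul_right _ this) _

theorem steps_digitLoop {Q : ℕ} (hQ : I.size ^ 15 ≤ Q) {ω : ℕ → Bool} {s : State}
    (h : I.Ready ω s) {t z : ℕ} (h9 : s.mem (9, 0) = t) (ht : t < 2 ^ Q) (hA : s.mem (10, 0) = z)
    (hz : z + I.size ^ 11 < 2 ^ Q) :
    ∃ s', Steps Q ω p.digitLoop s s' (I.size ^ 11 * 4 + 2) ∧
      AgreeOff [3, 9, 10] s s' ∧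
      s'.mem (10, 0) = z + ∑ i ∈ Finset.range (I.size ^ 11), t / I.base ^ i % 2 := by
  have h10 := hI.ten_le
  have hQ0 : 0 < Q := lt_of_lt_of_le (by positivity) hQ
  have hS := size_pow_le hI (i := 11) (by norm_num)
  obtain ⟨s', h1, h2, h3, h4, h5⟩ := Steps.forLoop (Q := Q) (ω := ω) (x := 3)
    (bound := p.sizeE.pow 11) (body := .seq
      (.store 10 (.const 0) (.read 10 (.const 0) + .read 9 (.const 0) % .const 2))
      (.store 9 (.const 0) (.read 9 (.const 0) / p.baseE)))
    (n := I.size ^ 11) (τ := 2) (by norm_num) ((length_lt hI hQ hS).trans Nat.lt_two_pow_self) hQ0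
    (fun i s' => AgreeOff [3, 9, 10] s s' ∧ s'.mem (3, 0) = i ∧ s'.mem (9, 0) = t / I.base ^ i ∧
      s'.mem (10, 0) = z + ∑ i ∈ Finset.range i, t / I.base ^ i % 2)
    (fun i s' h' => by
      have hh := h.holds.agree h'.1 (by simp)
      exact ⟨h'.2.1, by rw [eval_pow, hh.eval_size]⟩)
    (fun i hi s₁ ⟨k1, k2, k3, k4⟩ => by
      have hsum : ∑ i ∈ Finset.range (i + 1), t / I.base ^ i % 2 ≤ I.size ^ 11 := by
        refine (Finset.sum_le_card_nsmul _ _ 1 fun j _ => ?_).trans ?_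
        · omega
        · simpa using hi
      have k5 : AgreeOff [3, 9, 10] s (s₁.write 10 0
          (z + ∑ i ∈ Finset.range (i + 1), t / I.base ^ i % 2)) :=
        k1.trans (agreeOff_write _ (by simp) _ _)
      have hh := h.agree k5 (by simp) (by simp) (by simp)
      refine ⟨_, Steps.seq (Steps.store (by norm_num) (i := 0)
        (v := z + ∑ i ∈ Finset.range (i + 1), t / I.base ^ i % 2) rfl hQ0 ?_ ?_)
        (Steps.store (by norm_num) (i := 0) (v := t / I.base ^ (i + 1)) rfl hQ0 ?_ ?_), ?_, ?_, ?_, ?_, ?_⟩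
      · simp only [eval_add, eval_read, eval_const, eval_mod, k3, k4]
        rw [Finset.sum_range_succ, add_assoc]
      · omega
      · rw [eval_div, hh.eval_base hI, eval_read, eval_const, write_mem_of_ne _ (by norm_num), k3,
          Nat.div_div_eq_div_mul, pow_succ]
      · exact (Nat.div_le_self _ _).trans_lt ht
      · rw [write_mem_of_ne _ (by norm_num), write_mem_of_ne _ (by norm_num), k2]
      · exact (k5.trans (agreeOff_write _ (by simp) _ _)).trans (agreeOff_write _ (by simp) _ _)
      · simp
      · rw [write_mem_of_ne _ (by norm_num), write_mem_self]
      · rw [write_mem_of_ne _ (by norm_num), write_mem_of_ne _ (by norm_num), write_mem_self])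
    (s := s)
    (by
      refine ⟨agreeOff_write _ (by simp) _ _, by simp, ?_, ?_⟩
      · rw [write_mem_of_ne _ (by norm_num), h9]; simp
      · rw [write_mem_of_ne _ (by norm_num), hA]; simp)
  exact ⟨s', h1, h2, h5⟩

theorem oddDigits_le (ω : ℕ → Bool) (J : ℕ) : oddDigits hI ω J ≤ I.size ^ 11 := by
  refine (Finset.sum_le_card_nsmul _ _ 1 fun j _ => ?_).trans (by simp)
  omega

theorem sum_oddDigits_lt {Q : ℕ} (hQ : I.size ^ 15 ≤ Q) (ω : ℕ → Bool) {J : ℕ} (hJ : J < I.rounds) :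
    ∑ J' ∈ Finset.range J, oddDigits hI ω J' + I.size ^ 11 < 2 ^ Q := by
  have h1 : ∑ J' ∈ Finset.range J, oddDigits hI ω J' ≤ J * I.size ^ 11 := by
    refine (Finset.sum_le_card_nsmul _ _ (I.size ^ 11) fun j _ => oddDigits_le hI ω j).trans ?_
    simp
  have h2 := rounds_le hI
  calc ∑ J' ∈ Finset.range J, oddDigits hI ω J' + I.size ^ 11 ≤ (J + 1) * I.size ^ 11 := by
        rw [add_mul]; omega
    _ ≤ I.size ^ 4 * I.size ^ 11 := Nat.mul_le_mul_right _ (by omega)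
    _ = I.size ^ 15 := by ring
    _ ≤ Q := hQ
    _ < 2 ^ Q := Nat.lt_two_pow_self

theorem steps_outerLoop {Q : ℕ} (hQ : I.size ^ 15 ≤ Q) {ω : ℕ → Bool} {s : State}
    (h : I.Ready ω s) (hA : s.mem (10, 0) = 0) :
    ∃ s', Steps Q ω p.outerLoop s s'
      (I.size ^ 4 * (2 ^ I.labels * (I.size ^ 4 * 6 + 9) + I.size ^ 11 * 4 + 7) + 2) ∧
      s'.mem (10, 0) = ∑ J ∈ Finset.range I.rounds, oddDigits hI ω J ∧
      s'.mem (10, 0) < 2 ^ Q := by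
  have h10 := hI.ten_le
  have hQ0 : 0 < Q := lt_of_lt_of_le (by positivity) hQ
  have hlen := length_lt hI hQ ((rounds_le hI).trans (size_pow_le hI (by norm_num)))
  obtain ⟨s', h1, h2, h3, h4, h5⟩ := Steps.forLoop (Q := Q) (ω := ω) (x := 1)
    (bound := .const (2 ^ p.a) * nE * nE * (p.labelsE + .const 1))
    (body := .seq (.store 9 (.const 0) (.const 0)) (.seq p.sieveLoop p.digitLoop))
    (n := I.rounds) (τ := 2 ^ I.labels * (I.size ^ 4 * 6 + 9) + I.size ^ 11 * 4 + 5) (by norm_num)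
    (hlen.trans Nat.lt_two_pow_self) hQ0
    (fun J s' => AgreeOff [1, 2, 3, 7, 8, 9, 10] s s' ∧ s'.mem (1, 0) = J ∧
      s'.mem (10, 0) = ∑ J' ∈ Finset.range J, oddDigits hI ω J' ∧ s'.mem (10, 0) < 2 ^ Q)
    (fun J s' h' => by
      have hh := h.holds.agree h'.1 (by simp)
      exact ⟨h'.2.1, by simp [hh.eval_n, hh.eval_labels, rounds]⟩)
    (fun J hJ s₁ ⟨k1, k2, k3, _⟩ => by
      have k4 : AgreeOff [1, 2, 3, 7, 8, 9, 10] s (s₁.write 9 0 0) :=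
        k1.trans (agreeOff_write _ (by simp) _ _)
      obtain ⟨s₂, a1, a2, a3⟩ := steps_sieveLoop hI hQ (h.agree k4 (by simp) (by simp) (by simp))
        (J := J) (by rw [write_mem_of_ne _ (by norm_num), k2]) hJ (by simp)
      have k5 := k4.trans (a2.mono (by simp))
      obtain ⟨s₃, b1, b2, b3⟩ := steps_digitLoop hI hQ (h.agree k5 (by simp) (by simp) (by simp)) a3
        (sum_walkValue_lt hI hQ ω hJ le_rfl) (z := ∑ J' ∈ Finset.range J, oddDigits hI ω J')
        (by rw [a2 10 (by simp), write_mem_of_ne _ (by norm_num), k3]) (sum_oddDigits_lt hI hQ ω hJ)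
      have k6 := k5.trans (b2.mono (by simp))
      refine ⟨s₃, Steps.mono (Steps.seq (Steps.store (by norm_num) (i := 0) rfl hQ0 rfl
        (by positivity)) (Steps.seq a1 b1)) (by omega), ?_, ?_, by simp, ?_, ?_⟩
      · rw [b2 1 (by simp), a2 1 (by simp), write_mem_of_ne _ (by norm_num), k2]
      · exact k6.trans (agreeOff_write _ (by simp) _ _)
      · rw [write_mem_of_ne _ (by norm_num), b3, Finset.sum_range_succ]
        rfl
      · rw [write_mem_of_ne _ (by norm_num), b3]
        refine lt_of_le_of_lt ?_ (sum_oddDigits_lt hI hQ ω hJ)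
        exact Nat.add_le_add_left (oddDigits_le hI ω J) _)
    (s := s)
    (by
      refine ⟨agreeOff_write _ (by simp) _ _, by simp, ?_, ?_⟩
      · rw [write_mem_of_ne _ (by norm_num), hA]; simp
      · rw [write_mem_of_ne _ (by norm_num), hA]; positivity)
  refine ⟨s', Steps.mono h1 ?_, h4, h5⟩
  exact Nat.add_le_add_right (Nat.mul_le_mul_right _ (rounds_le hI)) _

theorem steps_search {Q : ℕ} (hQ : I.size ^ 15 ≤ Q) (ω : ℕ → Bool) {s : State} (h : I.Holds s)
    (hc : s.coins = 0) :
    ∃ s', Steps Q ω p.search s s' (2 ^ I.labels * I.size ^ 20) ∧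
      s'.mem (0, 0) = ∑ J ∈ Finset.range I.rounds, oddDigits hI ω J := by
  have h10 := hI.ten_le
  have hQ0 : 0 < Q := lt_of_lt_of_le (by positivity) hQ
  obtain ⟨s₁, a1, a2, a3, a4⟩ := steps_powTable hI hQ ω h
  obtain ⟨s₂, b1, b2, b3⟩ := steps_rndTable hI hQ ω (h.agree a2 (by simp)) a3 (a4.trans hc)
  obtain ⟨s₃, c1, c2, c3⟩ := steps_outerLoop hI hQ (s := s₂.write 10 0 0)
    (b3.agree (agreeOff_write (L := [10]) _ (by simp) _ _) (by simp) (by simp) (by simp)) (by simp)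
  refine ⟨_, Steps.mono (Steps.seq a1 (Steps.seq b1 (Steps.seq (Steps.store (by norm_num) (i := 0) rfl
    hQ0 rfl (by positivity)) (Steps.seq c1 (Steps.store (by norm_num) (i := 0) rfl hQ0 rfl c3))))) ?_,
    ?_⟩
  · have e1 : 1 ≤ 2 ^ I.labels := Nat.one_le_two_pow
    generalize 2 ^ I.labels = T at e1 ⊢
    have e4 : 1 ≤ I.size ^ 4 := Nat.one_le_pow _ _ (by omega)
    have e11 : I.size ^ 4 ≤ I.size ^ 15 := Nat.pow_le_pow_right (by omega) (by norm_num)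
    have e8 : I.size ^ 8 ≤ I.size ^ 15 := Nat.pow_le_pow_right (by omega) (by norm_num)
    have e14 : I.size ^ 14 ≤ I.size ^ 15 := Nat.pow_le_pow_right (by omega) (by norm_num)
    -- Since `size` is at least `10`, passing from the fifteenth to the twentieth power absorbs all
    -- constant factors.
    have e20 : 10 ^ 5 * I.size ^ 15 ≤ I.size ^ 20 := by
      calc 10 ^ 5 * I.size ^ 15 ≤ I.size ^ 5 * I.size ^ 15 :=
            Nat.mul_le_mul_right _ (Nat.pow_le_pow_left h10 5)
        _ = _ := by ring
    have e5 : I.size ^ 4 * (T * (I.size ^ 4 * 6 + 9) + I.size ^ 11 * 4 + 7) =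
        T * (6 * I.size ^ 8 + 9 * I.size ^ 4) + 4 * I.size ^ 15 + 7 * I.size ^ 4 := by ring
    have e6 : T * (6 * I.size ^ 8 + 9 * I.size ^ 4) ≤ T * (15 * I.size ^ 15) :=
      Nat.mul_le_mul_left _ (by omega)
    have e7 : I.size ^ 15 ≤ T * I.size ^ 15 := Nat.le_mul_of_pos_left _ e1
    have e9 : T * (10 ^ 5 * I.size ^ 15) ≤ T * I.size ^ 20 := Nat.mul_le_mul_left _ e20
    rw [e5]
    nlinarith
  · rw [write_mem_self, eval_read, eval_const, c2]

end

end Inst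

end TreeSearch


/-! ### The numbers computed by the program -/

namespace TreeSearch

section

variable {n : ℕ} (φ : Bool → Fin n → Fin n → ℕ) (M : ℕ)

/-- Reduction modulo `M` disappears in `ZMod M`. The truncated difference `1 - [j = u]` is the
indicator that excludes the step back, and `(1 + acc) * (1 + x) = 1 + (acc + (acc + 1) * x)` is the
recursion. -/
theorem cast_partialAcc (g : Fin n → Fin n → ℕ) (u v : Fin n) (j : ℕ) (hj : j ≤ n) :
    (1 + (partialAcc φ M g u v j : ZMod M)) = ∏ i ∈ Finset.range j, if h : i < n then
      1 + (if (⟨i, h⟩ : Fin n) = u then 0 else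
        (φ true v ⟨i, h⟩ + φ false v ⟨i, h⟩ * g v ⟨i, h⟩ : ZMod M)) else 1 := by
  induction j with
  | zero => simp [partialAcc]
  | succ j ih =>
    have hjn : j < n := hj
    rw [Finset.prod_range_succ, ← ih (by omega), dif_pos hjn, partialAcc, dif_pos hjn,
      ZMod.natCast_mod]
    by_cases h : j = u
    · simp [h]
    · have h' : (⟨j, hjn⟩ : Fin n) ≠ u := fun h1 => h (congrArg Fin.val h1)
      simp only [h, h', if_false]
      push_cast
      ring

theorem cast_accTable (d : ℕ) (u v : Fin n) :
    (1 + (accTable φ M d u v : ZMod M)) = ∏ w, (1 + if w = u then 0 else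
      if d = 0 then 0 else (φ true v w + φ false v w * accTable φ M (d - 1) v w : ZMod M)) := by
  cases d with
  | zero => simp [accTable]
  | succ d =>
    rw [accTable, cast_partialAcc _ _ _ _ _ _ le_rfl, Finset.prod_range]
    simp

end

theorem cast_edgeWeight {V A : Type*} [DecidableEq V] [CommSemiring A] (G : SimpleGraph V)
    (P : V → Prop) (ρ : V) (z y q : ℕ) (x a : Sym2 V → ℕ) (leaf : Bool) (u v : V) :
    ((edgeWeight G P ρ z y q x a leaf u v : ℕ) : A) =
      edgeWeight G P ρ (z : A) y q (fun e => x e) (fun e => a e) leaf u v := by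
  simp only [edgeWeight]
  push_cast
  rfl

theorem cast_treeMonomial {V A : Type*} [Fintype V] [DecidableEq V] [CommSemiring A]
    (P : V → Prop) (ρ : V) (z y q : ℕ) (x a : Sym2 V → ℕ) (S : Finset (List V)) :
    ((treeMonomial P ρ z y q x a S : ℕ) : A) =
      treeMonomial P ρ (z : A) y q (fun e => x e) (fun e => a e) S := by
  simp only [treeMonomial]
  push_cast [Multiset.map_map, Function.comp_def]
  rfl

theorem sum_treeMonomial_modEq {n : ℕ} (G : SimpleGraph (Fin n)) (P : Fin n → Prop) (ρ σ : Fin n)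
    (z y q : ℕ) (x a : Sym2 (Fin n) → ℕ) (M d : ℕ) :
    z * y * (q * a s(ρ, ρ)) * (edgeWeight G P ρ z y q x a true ρ σ +
      edgeWeight G P ρ z y q x a false ρ σ * accTable (edgeWeight G P ρ z y q x a) M d ρ σ) ≡
      ∑ S ∈ walkTrees G ρ σ (d + 1), treeMonomial P ρ z y q x a S [MOD M] := by
  rw [← ZMod.natCast_eq_natCast_iff]
  let φ := edgeWeight G P ρ z y q x a
  let f : ℕ → Fin n → Fin n → ZMod M := fun d u v => if d = 0 then 0 else
    (φ true u v + φ false u v * accTable φ M (d - 1) u v : ZMod M)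
  have h1 := sum_walkFamily_eq_table G P ρ (z : ZMod M) y q (fun e => x e) (fun e => a e) (d + 1) f
    (fun _ _ => rfl)
    (by
      intro d' _ u v
      refine ⟨accTable φ M d' u v, cast_accTable φ M d' u v, ?_⟩
      rw [← cast_edgeWeight, ← cast_edgeWeight]
      simp only [f, φ, Nat.add_sub_cancel, Nat.add_eq_zero_iff, one_ne_zero, and_false, if_false])
    (d + 1) le_rfl σ ρ []
  have h2 := sum_walkTrees G P ρ σ (z : ZMod M) y q (fun e => x e) (fun e => a e) (d + 1)
  push_cast
  simp only [cast_treeMonomial]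
  rw [← h2, h1]
  simp only [f, φ, Nat.add_sub_cancel, Nat.add_eq_zero_iff, one_ne_zero, and_false, if_false,
    List.head?_nil, Option.mem_def, reduceCtorEq, false_imp_iff, implies_true, if_true, one_mul]

namespace Inst

variable {p : Params} {I : Inst p} (hI : I.Small)
include hI

theorem sieveValue_eq (ω : ℕ → Bool) {J : ℕ} (hJ : J < I.rounds) :
    sieveValue hI ω J = (randomTotal I.G (I.Free (I.maskOf J)) (rootOf hI J) (stemOf hI J) (I.n + 1)
      I.k I.l (I.itemsOf J) I.labels I.size ω).eval I.base := by
  rw [base, randomTotal_eval_eq hI.n_lt hI.labels_lt (itemsOf_le hI hJ) hI.ten_le hI.k_le hI.l_le]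
  refine Finset.sum_congr rfl fun X _ => ?_
  have h := sum_treeMonomial_modEq I.G (I.Free (I.maskOf J)) (rootOf hI J) (stemOf hI J)
    (I.count ^ (I.size * I.size)) (I.count ^ I.size) I.count (fun e => I.var ω e I.labels)
    (I.itemVar ω X) (I.modulus J) I.n
  -- Working modulo `count ^ (digit + 1)` keeps the digit that is read, and it keeps the table
  -- entries short.
  have h2 : ∀ W, W / I.count ^ I.digitOf J % I.count =
      W % I.modulus J / I.count ^ I.digitOf J := by
    intro W
    rw [modulus, pow_succ, Nat.mod_mul_right_div_self]
  have h3 : walkValue hI ω J X = _ / I.count ^ I.digitOf J % I.count := rfl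
  rw [h3, h2]
  exact (congrArg (· / I.count ^ I.digitOf J) h).trans (h2 _).symm

theorem oddDigits_pos_iff (ω : ℕ → Bool) {J : ℕ} (hJ : J < I.rounds) :
    oddDigits hI ω J ≠ 0 ↔ ∃ i, (randomTotal I.G (I.Free (I.maskOf J)) (rootOf hI J) (stemOf hI J)
      (I.n + 1) I.k I.l (I.itemsOf J) I.labels I.size ω).coeff i % 2 ≠ 0 := by
  have h1 : ∀ i, sieveValue hI ω J / I.base ^ i % 2 = (randomTotal I.G (I.Free (I.maskOf J))
      (rootOf hI J) (stemOf hI J) (I.n + 1) I.k I.l (I.itemsOf J) I.labels I.size ω).coeff i % 2 := by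
    intro i
    rw [sieveValue_eq hI ω hJ, base]
    exact randomTotal_digits hI.n_lt hI.labels_lt (itemsOf_le hI hJ) hI.ten_le hI.k_le ω i
  rw [oddDigits, Ne, Finset.sum_eq_zero_iff]
  simp only [h1]
  push Not
  constructor
  · rintro ⟨i, -, hi⟩
    exact ⟨i, hi⟩
  · rintro ⟨i, hi⟩
    refine ⟨i, Finset.mem_range.2 ?_, hi⟩
    exact randomTotal_digit_index hI.n_lt hI.labels_lt (itemsOf_le hI hJ) hI.ten_le hI.k_le ω i hi

theorem sum_oddDigits_eq_zero (hno : ¬ HasKLTree I.G I.k I.l) (ω : ℕ → Bool) :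
    ∑ J ∈ Finset.range I.rounds, oddDigits hI ω J = 0 := by
  refine Finset.sum_eq_zero fun J hJ => ?_
  by_contra h
  obtain ⟨i, hi⟩ := (oddDigits_pos_iff hI ω (Finset.mem_range.1 hJ)).1 h
  exact hi (randomTotal_coeff_even (by have := hI.k_le; omega) hno ω i)

theorem exists_round {T r : ℕ} (hT : T < 2 ^ p.a) (ρ σ : Fin I.n) (hr : r ≤ I.labels) :
    ∃ J < I.rounds, I.maskOf J = T ∧ rootOf hI J = ρ ∧ stemOf hI J = σ ∧ I.itemsOf J = r := by
  have hn := hI.n_pos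
  have h2 : 0 < 2 ^ p.a := by positivity
  refine ⟨2 ^ p.a * (I.n * (I.n * r + σ) + ρ) + T, ?_, ?_, ?_, ?_, ?_⟩
  · have e1 : I.n * r + σ + 1 ≤ I.n * (I.labels + 1) := by
      have := σ.2
      calc I.n * r + σ + 1 ≤ I.n * (r + 1) := by rw [mul_add, mul_one]; omega
        _ ≤ _ := Nat.mul_le_mul_left _ (by omega)
    have e2 : I.n * (I.n * r + σ) + ρ + 1 ≤ I.n * (I.n * (I.labels + 1)) := by
      have := ρ.2
      calc I.n * (I.n * r + σ) + ρ + 1 ≤ I.n * (I.n * r + σ + 1) := by rw [mul_add _ _ 1, mul_one]; omega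
        _ ≤ _ := Nat.mul_le_mul_left _ e1
    calc _ < 2 ^ p.a * (I.n * (I.n * r + σ) + ρ + 1) := by rw [mul_add _ _ 1, mul_one]; omega
      _ ≤ 2 ^ p.a * (I.n * (I.n * (I.labels + 1))) := Nat.mul_le_mul_left _ e2
      _ = I.rounds := by rw [rounds]; ring
  · rw [maskOf, Nat.mul_add_mod, Nat.mod_eq_of_lt hT]
  · refine Fin.ext ?_
    simp only [rootOf]
    rw [Nat.mul_add_div h2, Nat.div_eq_of_lt hT, add_zero, Nat.mul_add_mod, Nat.mod_eq_of_lt ρ.2]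
  · refine Fin.ext ?_
    simp only [stemOf]
    rw [Nat.mul_add_div h2, Nat.div_eq_of_lt hT, add_zero, Nat.mul_add_div hn,
      Nat.div_eq_of_lt ρ.2, add_zero, Nat.mul_add_mod, Nat.mod_eq_of_lt σ.2]
  · rw [itemsOf, Nat.mul_add_div h2, Nat.div_eq_of_lt hT, add_zero, Nat.mul_add_div hn,
      Nat.div_eq_of_lt ρ.2, add_zero, Nat.mul_add_div hn, Nat.div_eq_of_lt σ.2, add_zero]

open scoped Classical in
/-- The hypothesis on the coloring: for some set of colors the number of items of a tree is at most
the number of labels. -/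
def Labelable (I : Inst p) : Prop :=
  ∀ (vs ls : Finset (Fin I.n)) (E : Finset (Sym2 (Fin I.n))), vs.card = I.k → ls ⊆ vs →
    ls.card = I.l → E.card + 1 = I.k → (∀ e ∈ E, e ∈ I.G.edgeSet) →
    ∃ T < 2 ^ p.a, (vs.filter fun v => I.Free T v ∨ v ∈ ls).card +
      (E.filter fun e => ∀ v ∈ e, ¬ I.Free T v).card ≤ I.labels

theorem half_le_measure (hk : 2 ≤ I.k) (hlab : I.Labelable) (h : HasKLTree I.G I.k I.l) :
    1 / 2 ≤ RAM.coinMeasure {ω | ∑ J ∈ Finset.range I.rounds, oddDigits hI ω J ≠ 0} := by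
  classical
  obtain ⟨ρ, σ, vs, ls, E, h1, h2, h3, h4, h5, h6⟩ :=
    exists_treeTotal_eq_one (Polynomial (ZMod 2)) (d := I.n + 1) hk (by have := hI.k_le; omega) h
  obtain ⟨T, hT, h7⟩ := hlab vs ls E h1 h2 h3 h4 h5
  obtain ⟨ξ, hξ⟩ := h6 (I.Free T) I.labels _ (by convert rfl) h7
  obtain ⟨J, hJ, e1, e2, e3, e4⟩ := exists_round hI hT ρ σ h7
  have hw : (I.k + I.itemsOf J) * 2 ≤ 2 ^ I.size := by
    have h10 := hI.n_lt
    have h11 := hI.labels_lt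
    have h12 := hI.k_le
    have h13 := itemsOf_le hI hJ
    obtain ⟨s, hs⟩ : ∃ s, I.size = s + 3 := ⟨I.size - 3, by have := hI.ten_le; omega⟩
    have h14 : s < 2 ^ s := Nat.lt_two_pow_self
    rw [hs, pow_add]
    omega
  refine half_le_coinMeasure_of_compl (t := {ω | ∀ i, (randomTotal I.G (I.Free (I.maskOf J))
    (rootOf hI J) (stemOf hI J) (I.n + 1) I.k I.l (I.itemsOf J) I.labels I.size ω).coeff i % 2 = 0})
    ?_ ?_
  · intro ω hω
    simp only [Set.mem_ofPred_eq] at hω ⊢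
    push Not at hω
    rw [Ne, Finset.sum_eq_zero_iff]
    exact fun h => (oddDigits_pos_iff hI ω hJ).2 hω (h J (Finset.mem_range.2 hJ))
  · refine randomTotal_coeff_odd hw ξ ?_
    rw [e1, e2, e3, e4]
    exact hξ

end Inst

end TreeSearch


/-! ### The choice of the set of colors -/

namespace TreeSearch

open Finset in
theorem card_filter_disjoint {a : ℕ} (t : ℕ) (S : Finset (Fin a)) :
    ((powersetCard t (univ : Finset (Fin a))).filter fun T => Disjoint T S).card =
      (a - S.card).choose t := by
  have h : ((powersetCard t (univ : Finset (Fin a))).filter fun T => Disjoint T S) =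
      powersetCard t Sᶜ := by
    ext T
    simp only [mem_filter, mem_powersetCard, subset_univ, true_and, subset_compl_iff_disjoint_right]
    exact and_comm
  rw [h, card_powersetCard, card_compl, Fintype.card_fin]

open Finset in
/-- Averaging over the sets of `t` colors. -/
theorem exists_colors {n a b t A B k l : ℕ} {G : SimpleGraph (Fin n)} {c : Fin n → Finset (Fin a)}
    (hc : IsFractionalColoring G a b c) (hta : t ≤ a)
    (hA : 2 * b ≤ a → A + (a - b).choose t = a.choose t + (a - 2 * b).choose t)
    (hB : B + (a - b).choose t = a.choose t) (vs ls : Finset (Fin n)) (E : Finset (Sym2 (Fin n)))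
    (hvs : vs.card = k) (hls : ls ⊆ vs) (hlsl : ls.card = l) (hE : E.card + 1 = k)
    (hEG : ∀ e ∈ E, e ∈ G.edgeSet) (hk : 2 ≤ k) :
    ∃ T : Finset (Fin a), (vs.filter fun v => Disjoint T (c v) ∨ v ∈ ls).card +
      (E.filter fun e => ∀ v ∈ e, ¬ Disjoint T (c v)).card ≤ (A * k + B * l) / a.choose t := by
  classical
  have hD : 0 < a.choose t := Nat.choose_pos hta
  set 𝒯 := powersetCard t (univ : Finset (Fin a)) with h𝒯
  have h𝒯card : 𝒯.card = a.choose t := by rw [h𝒯, card_powersetCard, card_univ, Fintype.card_fin]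
  have hfree : ∀ v, (𝒯.filter fun T => Disjoint T (c v)).card = (a - b).choose t := fun v => by
    rw [h𝒯, card_filter_disjoint, hc.1]
  have hadj : ∀ u v, G.Adj u v → 2 * b ≤ a ∧
      (𝒯.filter fun T => ¬ Disjoint T (c u) ∧ ¬ Disjoint T (c v)).card + 2 * (a - b).choose t =
        a.choose t + (a - 2 * b).choose t := by
    intro u v huv
    have hcard : (c u ∪ c v).card = 2 * b := by
      rw [card_union_of_disjoint (hc.2 u v huv), hc.1, hc.1, two_mul]
    have h1 : 2 * b ≤ a := by
      rw [← hcard]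
      exact (card_le_univ _).trans (by simp)
    refine ⟨h1, ?_⟩
    have h2 : (𝒯.filter fun T => Disjoint T (c u) ∧ Disjoint T (c v)).card = (a - 2 * b).choose t := by
      rw [← hcard, ← card_filter_disjoint t (c u ∪ c v)]
      congr 1
      exact filter_congr fun T _ => by rw [disjoint_union_right]
    have h3 := hfree u
    have h4 := hfree v
    have h5 := card_union_add_card_inter (𝒯.filter fun T => Disjoint T (c u))
      (𝒯.filter fun T => Disjoint T (c v))
    rw [← filter_or, ← filter_and, h2, h3, h4] at h5
    have h6 := card_filter_add_card_filter_not (s := 𝒯) (fun T => Disjoint T (c u) ∨ Disjoint T (c v))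
    simp only [not_or] at h6
    omega
  have hEne : E.Nonempty := card_pos.1 (by omega)
  -- Adjacent vertices carry `2 * b` different colors. A tree with an edge therefore forces `2 * b ≤
  -- a`, the only case in which the formula for `A` is required.
  have h2b : 2 * b ≤ a := by
    obtain ⟨e, he⟩ := hEne
    induction e using Sym2.ind with
    | _ u v => exact (hadj u v (hEG _ he)).1
  have hA' := hA h2b
  -- A vertex is free for `(a - b).choose t` of the sets. A leaf counts for all of them, which costs
  -- the additional `B`.
  have hsum1 : ∑ T ∈ 𝒯, (vs.filter fun v => Disjoint T (c v) ∨ v ∈ ls).card ≤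
      k * (a - b).choose t + l * B := by
    simp only [card_filter]
    rw [sum_comm]
    simp only [← card_filter]
    have h1 : ∀ v ∈ vs, (𝒯.filter fun T => Disjoint T (c v) ∨ v ∈ ls).card ≤
        (a - b).choose t + if v ∈ ls then B else 0 := by
      intro v _
      split_ifs with hv
      · refine (card_filter_le _ _).trans ?_
        omega
      · simp only [hv, or_false, add_zero, hfree, le_refl]
    refine (sum_le_sum h1).trans ?_
    rw [sum_add_distrib, ← sum_filter, filter_mem_eq_inter, inter_eq_right.2 hls]
    simp [hvs, hlsl]
  -- By inclusion-exclusion the number of sets meeting both color sets at the ends of an edge is `A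
  -- - (a - b).choose t`.
  have hsum2 : ∑ T ∈ 𝒯, (E.filter fun e => ∀ v ∈ e, ¬ Disjoint T (c v)).card +
      E.card * (a - b).choose t ≤ E.card * A := by
    simp only [card_filter]
    rw [sum_comm]
    simp only [← card_filter]
    rw [← smul_eq_mul, ← smul_eq_mul, ← sum_const, ← sum_const, ← sum_add_distrib]
    refine sum_le_sum fun e he => ?_
    have he' := hEG e he
    induction e using Sym2.ind with
    | _ u v =>
      have := (hadj u v he').2
      simp only [Sym2.mem_iff, forall_eq_or_imp, forall_eq]
      omega
  -- There are `k` vertices but only `k - 1` edges. The surplus `A - (a - b).choose t` is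
  -- nonnegative, since it counts the sets that meet both ends of an edge.
  have htotal : ∑ T ∈ 𝒯, ((vs.filter fun v => Disjoint T (c v) ∨ v ∈ ls).card +
      (E.filter fun e => ∀ v ∈ e, ¬ Disjoint T (c v)).card) ≤ A * k + B * l := by
    rw [sum_add_distrib]
    have h7 : (a - b).choose t ≤ A := by
      obtain ⟨e, he⟩ := hEne
      have he' := hEG e he
      induction e using Sym2.ind with
      | _ u v =>
        have := (hadj u v he').2
        omega
    have h8 : k * (a - b).choose t = E.card * (a - b).choose t + (a - b).choose t := by
      rw [← hE]; ring
    have h9 : A * k = E.card * A + A := by rw [← hE]; ring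
    have h10 : B * l = l * B := mul_comm _ _
    omega
  have hne : 𝒯.Nonempty := card_pos.1 (by omega)
  obtain ⟨T, _, hT⟩ := exists_le_of_sum_le (s := 𝒯) (f := fun T => a.choose t *
    ((vs.filter fun v => Disjoint T (c v) ∨ v ∈ ls).card +
      (E.filter fun e => ∀ v ∈ e, ¬ Disjoint T (c v)).card)) (g := fun _ => A * k + B * l) hne (by
    rw [← mul_sum, sum_const, h𝒯card, smul_eq_mul]
    exact Nat.mul_le_mul_left _ htotal)
  exact ⟨T, (Nat.le_div_iff_mul_le hD).2 (by rw [mul_comm]; exact hT)⟩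

theorem labelable {p : Params} (I : Inst p) {b t : ℕ} (hc : IsFractionalColoring I.G p.a b I.c)
    (hta : t ≤ p.a)
    (hA : 2 * b ≤ p.a → p.A + (p.a - b).choose t = p.a.choose t + (p.a - 2 * b).choose t)
    (hB : p.B + (p.a - b).choose t = p.a.choose t) (hD : p.D = p.a.choose t) (hk : 2 ≤ I.k) :
    I.Labelable := by
  classical
  intro vs ls E h1 h2 h3 h4 h5
  obtain ⟨T, hT⟩ := exists_colors hc hta hA hB vs ls E h1 h2 h3 h4 h5 hk
  -- The mask has as its bits the indicator of `T`, as `Free` expects.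
  refine ⟨Nat.ofBits fun i => decide (i ∈ T), Nat.ofBits_lt_two_pow _, ?_⟩
  have hfree : ∀ v, I.Free (Nat.ofBits fun i => decide (i ∈ T)) v ↔ Disjoint T (I.c v) := by
    intro v
    rw [Finset.disjoint_right]
    refine forall₂_congr fun i hi => ?_
    rw [← Nat.toNat_testBit, Nat.testBit_ofBits_lt _ _ i.2]
    simp
  simp only [hfree, Inst.labels, hD]
  convert hT

/-! ### Small trees -/

theorem HasKLTree.bounds {n : ℕ} {G : SimpleGraph (Fin n)} {k l : ℕ} (h : HasKLTree G k l) :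
    1 ≤ k ∧ k ≤ n ∧ l ≤ n := by
  obtain ⟨T, hT, hk, hl⟩ := h
  have hle : ∀ s : Set (Fin n), s.ncard ≤ n := fun s => by
    refine (Set.ncard_le_ncard (Set.subset_univ s) (Set.toFinite _)).trans ?_
    rw [Set.ncard_univ, Nat.card_eq_fintype_card, Fintype.card_fin]
  refine ⟨?_, hk ▸ hle _, hl ▸ hle _⟩
  rw [← hk]
  obtain ⟨v⟩ := hT.connected.nonempty
  exact (Set.ncard_pos (Set.toFinite _)).2 ⟨v, v.2⟩

/-- The only vertex of such a tree has degree `0` and is not a leaf. The search roots its trees at a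
leaf, so this case is answered separately. -/
theorem hasKLTree_one_iff {n : ℕ} (hn : 0 < n) {G : SimpleGraph (Fin n)} {l : ℕ} :
    HasKLTree G 1 l ↔ l = 0 := by
  constructor
  · rintro ⟨T, hT, hk, hl⟩
    obtain ⟨v, hv⟩ := Set.ncard_eq_one.1 hk
    rw [← hl, Set.ncard_eq_zero (Set.toFinite _), Set.eq_empty_iff_forall_notMem]
    rintro w ⟨hw, h1⟩
    obtain ⟨u, hu⟩ := Set.ncard_eq_one.1 h1
    have h2 : T.Adj w u := by
      have : u ∈ T.neighborSet w := by rw [hu]; rfl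
      exact this
    have h3 := h2.snd_mem
    rw [hv, Set.mem_singleton_iff] at hw h3
    rw [hw, h3] at h2
    exact h2.ne rfl
  · rintro rfl
    refine ⟨G.singletonSubgraph ⟨0, hn⟩, ?_, ?_, ?_⟩
    · have : Subsingleton (G.singletonSubgraph (⟨0, hn⟩ : Fin n)).verts :=
        inferInstanceAs (Subsingleton ({(⟨0, hn⟩ : Fin n)} : Set (Fin n)))
      have : Nonempty (G.singletonSubgraph (⟨0, hn⟩ : Fin n)).verts :=
        ⟨⟨⟨0, hn⟩, rfl⟩⟩
      exact SimpleGraph.IsTree.of_subsingleton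
    · exact Set.ncard_singleton _
    · rw [Set.ncard_eq_zero (Set.toFinite _), Set.eq_empty_iff_forall_notMem]
      rintro w ⟨hw, h1⟩
      have : (G.singletonSubgraph (⟨0, hn⟩ : Fin n)).neighborSet w = ∅ := by
        ext u
        simp [SimpleGraph.singletonSubgraph]
      rw [this] at h1
      simp at h1

/-! ### The main theorem -/

open RAM

theorem length_le_inputSize (L : List ℕ) : L.length ≤ inputSize L := by
  induction L with
  | nil => simp
  | cons x L ih =>
    rw [inputSize] at ih ⊢
    simp only [List.map_cons, List.sum_cons, List.length_cons]
    omega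

theorem size_le_inputSize {L : List ℕ} {x : ℕ} (h : x ∈ L) : Nat.size x ≤ inputSize L := by
  have := List.single_le_sum (l := L.map fun x => Nat.size x + 1) (fun _ _ => Nat.zero_le _) _
    (List.mem_map_of_mem h)
  rw [inputSize]
  omega

theorem start_bounded {L : List ℕ} {Q : ℕ} (hQ : inputSize L ≤ Q) : (start L).Bounded Q := by
  intro x i h
  rw [start_mem] at h ⊢
  split_ifs at h ⊢ with hx
  · have hi : i < L.length := by
      by_contra h1
      rw [List.getD_eq_default _ _ (by omega)] at h
      exact h rfl
    refine ⟨by omega, hi.trans_le ((length_le_inputSize L).trans hQ), ?_⟩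
    rw [List.getD_eq_getElem _ _ hi]
    exact Nat.size_le.1 ((size_le_inputSize (List.getElem_mem hi)).trans hQ)
  · exact absurd rfl h

/-- The bound for the numbers in the memory, as a polynomial of the input size. -/
noncomputable def boundPoly (c : ℕ) : Polynomial ℕ :=
  (Polynomial.C c * (Polynomial.X + 1)) ^ 15 + Polynomial.X

theorem steps_program {p : Params} (hD : 1 ≤ p.D) (hp : p.c = p.A + p.B + 2 ^ p.a + 10) (I : Inst p)
    {Q : ℕ} (hQ : I.size ^ 15 ≤ Q) (ω : ℕ → Bool) {s : State} (h : I.Holds s) (hc : s.coins = 0) :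
    ∃ s' τ, Steps Q ω p.program s s' τ ∧ (τ ≤ 3 ∨ τ ≤ 2 ^ I.labels * I.size ^ 20 + 2) ∧
      ((¬ HasKLTree I.G I.k I.l ∧ s'.mem (0, 0) = 0) ∨
        (HasKLTree I.G I.k I.l ∧ s'.mem (0, 0) ≠ 0) ∨
        ∃ hI : I.Small, 2 ≤ I.k ∧ s'.mem (0, 0) = ∑ J ∈ Finset.range I.rounds, Inst.oddDigits hI ω J) := by
  have hQ0 : 0 < Q := by
    refine lt_of_lt_of_le ?_ hQ
    unfold Inst.size
    rw [hp]
    positivity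
  have h1Q : 1 < 2 ^ Q := Nat.one_lt_two_pow (by omega)
  by_cases hbad : I.n < I.k ∨ I.n < I.l ∨ I.k = 0
  · refine ⟨_, _, Steps.cond_true ?_ (Steps.store (by norm_num) (i := 0) rfl hQ0 rfl (by positivity)),
      Or.inl (by norm_num), Or.inl ⟨?_, by simp⟩⟩
    · simp only [eval_add, eval_lt, eval_eq, eval_const, h.eval_n, h.eval_k, h.eval_l]
      rcases hbad with h1 | h1 | h1 <;> simp [h1]
    · intro ht
      have := HasKLTree.bounds ht
      omega
  · push Not at hbad
    obtain ⟨hkn, hln, hk0⟩ := hbad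
    have hcond : (nE.lt kE + nE.lt lE + kE.eq (.const 0)).eval s = 0 := by
      simp only [eval_add, eval_lt, eval_eq, eval_const, h.eval_n, h.eval_k, h.eval_l]
      simp [hkn, hln, hk0]
    by_cases hk1 : I.k = 1
    · have hn : 0 < I.n := by omega
      have hiff := hasKLTree_one_iff hn (G := I.G) (l := I.l)
      rw [← hk1] at hiff
      refine ⟨_, _, Steps.cond_false hcond (Steps.cond_true ?_ (Steps.store (by norm_num) (i := 0)
        (v := if I.l = 0 then 1 else 0) rfl hQ0 ?_ ?_)), Or.inl (by norm_num), ?_⟩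
      · simp [h.eval_k, hk1]
      · simp [h.eval_l]
      · split_ifs <;> omega
      · rw [write_mem_self, hiff]
        by_cases hl : I.l = 0 <;> simp [hl]
    · have hI : I.Small := ⟨by omega, hkn, hln, hD, hp.ge⟩
      obtain ⟨s', h1, h2⟩ := Inst.steps_search hI hQ ω h hc
      refine ⟨s', _, Steps.cond_false hcond (Steps.cond_false ?_ h1), Or.inr le_rfl,
        Or.inr (Or.inr ⟨hI, by omega, h2⟩)⟩
      simp [h.eval_k, hk1]

theorem solvable (p : Params) (b : ℕ) (hD : 1 ≤ p.D) (hp : p.c = p.A + p.B + 2 ^ p.a + 10)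
    (hlab : ∀ I : Inst p, IsFractionalColoring I.G p.a b I.c → 2 ≤ I.k → I.Labelable) :
    KLTreeSolvableInTime p.a b fun k l => ((p.A : ℝ) * k + (p.B : ℝ) * l) / (p.D : ℝ) := by
  obtain ⟨W, hW⟩ : ∃ W, W = p.program.weight := ⟨_, rfl⟩
  obtain ⟨q, hq⟩ : ∃ q, q = boundPoly p.c := ⟨_, rfl⟩
  refine ⟨p.program, ((Polynomial.C p.c * (Polynomial.X + 1)) ^ 20 + 3) *
    (Polynomial.C W * (q + 1) ^ 2), 12 * q * (2 * q + 4), ?_⟩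
  intro n G c hc k l
  let I : Inst p := ⟨n, G, c, k, l⟩
  set S := inputSize (encodeInstance G c k l) with hS
  have hnS : n ≤ S := by
    have h1 := length_le_inputSize (encodeInstance G c k l)
    rw [encodeInstance_length] at h1
    nlinarith
  -- The first summand dominates `size ^ 15`, which bounds the lengths and table indices in the
  -- search; the second accommodates the input itself.
  obtain ⟨Q, hQdef⟩ : ∃ Q, Q = (p.c * (S + 1)) ^ 15 + S := ⟨_, rfl⟩
  have hsize : I.size ≤ p.c * (S + 1) := Nat.mul_le_mul_left _ (Nat.succ_le_succ hnS)
  have hQ : I.size ^ 15 ≤ Q := by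
    rw [hQdef]
    exact (Nat.pow_le_pow_left hsize 15).trans (Nat.le_add_right _ _)
  have hqQ : q.eval S = Q := by
    simp [hq, boundPoly, hQdef]
  have hb : (start (encodeInstance G c k l)).Bounded Q := start_bounded (by rw [hQdef]; exact Nat.le_add_left _ _)
  have hholds : I.Holds (start (encodeInstance G c k l)) := fun i => by
    rw [start_mem, if_pos rfl]
    rfl
  have key : ∀ ω, ∃ s' t m, Run ω p.program (start (encodeInstance G c k l)) s' t m ∧
      (t ≤ 3 * (W * (Q + 1) ^ 2) ∨ t ≤ (2 ^ I.labels * I.size ^ 20 + 2) * (W * (Q + 1) ^ 2)) ∧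
      m ≤ 12 * Q * (2 * Q + 4) ∧
      ((¬ HasKLTree I.G I.k I.l ∧ s'.mem (0, 0) = 0) ∨
        (HasKLTree I.G I.k I.l ∧ s'.mem (0, 0) ≠ 0) ∨
        ∃ hI : I.Small, 2 ≤ I.k ∧
          s'.mem (0, 0) = ∑ J ∈ Finset.range I.rounds, Inst.oddDigits hI ω J) := by
    intro ω
    obtain ⟨s', τ, h1, h2, h3⟩ := steps_program hD hp I hQ ω hholds rfl
    obtain ⟨-, t, m, h4, h5, h6⟩ := h1.run hb
    rw [← hW] at h5
    refine ⟨s', t, m, h4, ?_, h6, h3⟩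
    rcases h2 with h2 | h2
    · exact Or.inl (h5.trans (Nat.mul_le_mul_right _ h2))
    · exact Or.inr (h5.trans (Nat.mul_le_mul_right _ h2))
  have hacc : ∀ ω s' t m, Run ω p.program (start (encodeInstance G c k l)) s' t m →
      (Accepts p.program (encodeInstance G c k l) ω ↔ s'.mem (0, 0) ≠ 0) := by
    intro ω s' t m h
    constructor
    · rintro ⟨s'', t', m', h1, h2⟩
      rwa [h.deterministic h1]
    · intro h1
      exact ⟨s', t, m, h, h1⟩
  refine ⟨?_, ?_, ?_⟩
  · intro ω
    obtain ⟨s', t, m, h1, h2, h3, -⟩ := key ω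
    refine ⟨s', t, m, h1, ?_, ?_⟩
    · have hpe : ((Polynomial.C p.c * (Polynomial.X + 1)) ^ 20 + 3 : Polynomial ℕ).eval S =
          (p.c * (S + 1)) ^ 20 + 3 := by simp
      have hpe' : (Polynomial.C W * (q + 1) ^ 2).eval S = W * (Q + 1) ^ 2 := by simp [hqQ]
      rw [Polynomial.eval_mul, hpe, hpe']
      -- The number of labels is the rounded-down quotient, so rounding only shortens the running
      -- time.
      have hexp : (I.labels : ℝ) ≤ ((p.A : ℝ) * k + (p.B : ℝ) * l) / (p.D : ℝ) := by
        have := Nat.cast_div_le (α := ℝ) (m := p.A * k + p.B * l) (n := p.D)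
        push_cast at this
        exact this
      have hT : ((2 ^ I.labels : ℕ) : ℝ) ≤ (2 : ℝ) ^ (((p.A : ℝ) * k + (p.B : ℝ) * l) / (p.D : ℝ)) := by
        push_cast
        rw [← Real.rpow_natCast]
        exact Real.rpow_le_rpow_of_exponent_le one_le_two hexp
      have h1T : 1 ≤ 2 ^ I.labels := Nat.one_le_two_pow
      have h4 : t ≤ ((p.c * (S + 1)) ^ 20 + 3) * (W * (Q + 1) ^ 2) * 2 ^ I.labels := by
        have h5 : I.size ^ 20 ≤ (p.c * (S + 1)) ^ 20 := Nat.pow_le_pow_left hsize 20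
        generalize (p.c * (S + 1)) ^ 20 = Y at h5 ⊢
        generalize W * (Q + 1) ^ 2 = U at h2 ⊢
        generalize 2 ^ I.labels = T at h1T h2 ⊢
        rcases h2 with h2 | h2
        · refine h2.trans ?_
          calc 3 * U ≤ (Y + 3) * U := Nat.mul_le_mul_right _ (by omega)
            _ ≤ (Y + 3) * U * T := Nat.le_mul_of_pos_right _ h1T
        · refine h2.trans ?_
          calc (T * I.size ^ 20 + 2) * U ≤ (T * Y + 3 * T) * U := by
                refine Nat.mul_le_mul_right _ (Nat.add_le_add (Nat.mul_le_mul_left _ h5) (by omega))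
            _ = (Y + 3) * U * T := by ring
      calc (t : ℝ) ≤ (((p.c * (S + 1)) ^ 20 + 3) * (W * (Q + 1) ^ 2) * 2 ^ I.labels : ℕ) :=
            Nat.cast_le.2 h4
        _ = (((p.c * (S + 1)) ^ 20 + 3) * (W * (Q + 1) ^ 2) : ℕ) * ((2 ^ I.labels : ℕ) : ℝ) :=
            Nat.cast_mul _ _
        _ ≤ _ := mul_le_mul_of_nonneg_left hT (Nat.cast_nonneg _)
    · refine h3.trans (le_of_eq ?_)
      simp [hqQ]
  · intro hyes
    by_cases hsmall : ∃ hI : I.Small, 2 ≤ I.k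
    · obtain ⟨hI, hk⟩ := hsmall
      refine (Inst.half_le_measure hI hk (hlab I hc hk) hyes).trans (measure_mono ?_)
      intro ω hω
      obtain ⟨s', t, m, h1, -, -, h2⟩ := key ω
      refine (hacc ω s' t m h1).2 ?_
      rcases h2 with h2 | h2 | ⟨_, _, h2⟩
      · exact absurd hyes h2.1
      · exact h2.2
      · rw [h2]
        exact hω
    · have : {ω | Accepts p.program (encodeInstance G c k l) ω} = Set.univ := by
        refine Set.eq_univ_of_forall fun ω => ?_
        obtain ⟨s', t, m, h1, -, -, h2⟩ := key ω
        refine (hacc ω s' t m h1).2 ?_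
        rcases h2 with h2 | h2 | ⟨hI, hk, _⟩
        · exact absurd hyes h2.1
        · exact h2.2
        · exact absurd ⟨hI, hk⟩ hsmall
      rw [this, measure_univ]
      exact ENNReal.half_le_self
  · intro hno ω
    obtain ⟨s', t, m, h1, -, -, h2⟩ := key ω
    rw [hacc ω s' t m h1, not_not]
    rcases h2 with h2 | h2 | ⟨hI, hk, h2⟩
    · exact h2.2
    · exact absurd h2.1 hno
    · rw [h2, Inst.sum_oddDigits_eq_zero hI hno]

end TreeSearch


theorem mainTheorem7 (a b : ℕ) (hb : 1 ≤ b) (hba : b ≤ a) :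
    (∀ t : ℕ, 1 ≤ t → t ≤ b →
      KLTreeSolvableInTime a b (fun k l =>
        (1 - (((a - b).choose t : ℝ) - ((a - 2 * b).choose t : ℝ)) / (a.choose t : ℝ)) * (k : ℝ)
          + (1 - ((a - b).choose t : ℝ) / (a.choose t : ℝ)) * (l : ℝ))) ∧
    KLTreeSolvableInTime a b (fun k l =>
      (1 - (b : ℝ) / (a : ℝ)) * (k : ℝ) + ((b : ℝ) / (a : ℝ)) * (l : ℝ)) := by
  constructor
  · intro t _ htb
    have hta : t ≤ a := htb.trans hba
    have hD : 0 < a.choose t := Nat.choose_pos hta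
    have hle : (a - b).choose t ≤ a.choose t := Nat.choose_le_choose t (Nat.sub_le a b)
    -- Here `A`, `B` and `D` are the numerators and the common denominator of the two coefficients
    -- in the exponent.
    have h := TreeSearch.solvable ⟨a, a.choose t - (a - b).choose t + (a - 2 * b).choose t,
      a.choose t - (a - b).choose t, a.choose t,
      a.choose t - (a - b).choose t + (a - 2 * b).choose t + (a.choose t - (a - b).choose t) +
        2 ^ a + 10⟩ b hD rfl (fun I hc hk =>
        TreeSearch.labelable I hc hta (fun _ => by simp only; omega) (by simp only; omega) rfl hk)
    convert h using 3
    push_cast [hle]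
    field_simp
    ring
  · have ha : 0 < a := by omega
    -- For `2 * b ≤ a` this is the case `t = 1`. For `a < 2 * b` the formula for `t = 1` has the
    -- coefficient `b / a` of `k`, larger than `1 - b / a`, so the claim is not a specialization. It
    -- still holds with `A = a - b`, because then `G` has no edges and the condition on `A` is void.
    have h := TreeSearch.solvable ⟨a, a - b, b, a, a - b + b + 2 ^ a + 10⟩ b ha rfl (fun I hc hk =>
      TreeSearch.labelable I hc (t := 1) (by simp only; omega)
        (fun h2 => by simp only [Nat.choose_one_right] at h2 ⊢; omega)
        (by simp only [Nat.choose_one_right]; omega) (by simp) hk)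
    convert h using 3
    push_cast [hba]
    field_simp
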